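/- Let $\alpha\ge 0$, $\sigma>0$, $N\ge 1$, and consider the regression $y_{1t}=\beta' x_t+\eta_t$, $t=1,\dots,T_1$, where $x_t=(1,\tilde y_t')'\in\mathbb R^{N}$, $\tilde y_t\in\mathbb R^{N-1}$ are the outcomes of the control units and $\beta=(\delta_1,\delta')'$. **Errors.** The $\eta_t$ are i.i.d., independent of the control outcomes $(\tilde y_t)_t$, with density $\sigma^{-1}f(\cdot/\sigma)$, where $f$ is a density with mean zero and variance one. With $u=f'/f$ put $M_{f,i,j}^{(\alpha)}=\int s^i u(s)^j f(s)^{1+\alpha}\,ds$. The density $f$ is regular at $\alpha$: it is positive and twice continuously differentiable, $s^iu(s)^jf(s)^{1+\alpha}$ is integrable for $i,j=0,1,2$ (in particular $\int f^{1+\alpha}<\infty$), and, with $\psi=f^\alpha u$, there are $\delta>0$ and a function $h$ with $hf$ integrable such that $(1+|z|)|\psi(z)|+(1+z^2)|\psi'(z)|\le h(s)$ for $z=(s-c)/\tau$ and all $s\in\mathbb R$, $|c|\le\delta$, $|\tau-1|\le\delta$. **Design.** Let $X_0'=[x_1,\dots,x_{T_1}]$. For every $\varepsilon>0$ there are $C,c>0$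 such that, for all large $T_1$, with probability at least $1-\varepsilon$: $|x_{tj}|\le C$ and $|x_{tj}x_{tk}|\le C$ for all $t\le T_1$ and all $j,k$; $T_1^{-1}\sum_{t\le T_1}|x_{tj}x_{tk}x_{tl}|\le C$ for all $j,k,l$; the smallest eigenvalue of $T_1^{-1}X_0'X_0$ is at least $c$; and $\max_{t\le T_1}x_t'(X_0'X_0)^{-1}x_t\le C/T_1$. Moreover $T_1^{-1}X_0'X_0\to\Sigma_x$ in probability, for a constant matrix $\Sigma_x$. **Estimators.** With $r_t=(y_{1t}-b'x_t)/\sqrt{s^2}$, the minimum density power divergence estimating equations in $(b,s^2)$, $s^2>0$, are $$\sum_{t\le T_1} f(r_t)^\alpha u(r_t)\,x_t=0,\qquad \frac1{T_1}\sum_{t\le T_1}\bigl[1+r_tu(r_t)\bigr]f(r_t)^\alpha=\frac{\alpha}{1+\alpha}\int f^{1+\alpha}.$$ A consistent sequence of roots (MDPDEs) is a sequence $(\hat\beta_\alpha,\hat\sigma^2_\alpha)$ that solves these equations with probability tending to one and converges in probability to $(\beta,\sigma^2)$. **Claim.** Suppose in addition that $M_{f,0,1}^{(a)}=0=M_{f,1,2}^{(a)}$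 for every $a>0$. Put $\zeta_{11,\alpha}=M_{f,0,2}^{(\alpha)}$, $\zeta_{22,\alpha}=\tfrac14\bigl[M_{f,2,2}^{(\alpha)}+2M_{f,1,1}^{(\alpha)}+M_{f,0,0}^{(\alpha)}\bigr]$, $\phi_{1,\alpha}=-M_{f,0,1}^{(\alpha)}$, $\phi_{2,\alpha}=-\tfrac12\bigl[M_{f,0,0}^{(\alpha)}+M_{f,1,1}^{(\alpha)}\bigr]$ and $$v_\beta(\alpha)=\frac{\zeta_{11,2\alpha}-\phi_{1,\alpha}^2}{\zeta_{11,\alpha}^2},\qquad v_\sigma(\alpha)=\frac{\zeta_{22,2\alpha}-\phi_{2,\alpha}^2}{\zeta_{22,\alpha}^2}.$$ Then $\Sigma_x$ is positive definite, $v_\beta(\alpha),v_\sigma(\alpha)\ge0$, there is a consistent sequence of roots that are measurable functions of the data, and for every consistent sequence of roots, as $T_1\to\infty$, $$\sqrt{T_1}(\hat\beta_\alpha-\beta)\to N_N\bigl(0,\sigma^2v_\beta(\alpha)\Sigma_x^{-1}\bigr),\qquad \sqrt{T_1}(\hat\sigma_\alpha^2-\sigma^2)\to N\bigl(0,\sigma^4v_\sigma(\alpha)\bigr)$$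 in distribution, and $\hat\beta_\alpha$, $\hat\sigma^2_\alpha$ are asymptotically independent: the joint law of the two rescaled errors converges to the product of these two limits. **Normal errors.** The standard normal density satisfies all the above conditions on $f$ at every $\alpha\ge0$, including $M_{f,0,1}^{(a)}=0=M_{f,1,2}^{(a)}$ for all $a>0$, and for it $$v_\beta(\alpha)=\Bigl(1+\frac{\alpha^2}{1+2\alpha}\Bigr)^{3/2},\qquad v_\sigma(\alpha)=\frac{4}{(\alpha^2+2)^2}\Bigl[2(1+2\alpha^2)\Bigl(1+\frac{\alpha^2}{1+2\alpha}\Bigr)^{5/2}-\alpha^2(1+\alpha)^2\Bigr].$$ -/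

import Mathlib

open MeasureTheory ProbabilityTheory Filter Topology

namespace MDPDE

noncomputable section

/-- The score `u = f' / f` of a univariate density `f`. -/
def score (f : ℝ → ℝ) (s : ℝ) : ℝ := deriv f s / f s

/-- The weighted score `f ^ α * u`, i.e. the derivative of `f ^ α / α` (of `log f` if `α = 0`). -/
def wscore (f : ℝ → ℝ) (α : ℝ) (s : ℝ) : ℝ := f s ^ α * score f s

/-- `M_{f,i,j}^{(α)} = ∫ s ^ i u(s) ^ j f(s) ^ (1 + α) ds`. -/
def M (f : ℝ → ℝ) (i j : ℕ) (α : ℝ) : ℝ := ∫ s, s ^ i * score f s ^ j * f s ^ (1 + α)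

def zeta11 (f : ℝ → ℝ) (α : ℝ) : ℝ := M f 0 2 α

def zeta22 (f : ℝ → ℝ) (α : ℝ) : ℝ := (M f 2 2 α + 2 * M f 1 1 α + M f 0 0 α) / 4

def phi1 (f : ℝ → ℝ) (α : ℝ) : ℝ := -M f 0 1 α

def phi2 (f : ℝ → ℝ) (α : ℝ) : ℝ := -(M f 0 0 α + M f 1 1 α) / 2

/-- The factor `v_β(α)`. -/
def vBeta (f : ℝ → ℝ) (α : ℝ) : ℝ := (zeta11 f (2 * α) - phi1 f α ^ 2) / zeta11 f α ^ 2

/-- The factor `v_σ(α)`. -/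
def vSigma (f : ℝ → ℝ) (α : ℝ) : ℝ := (zeta22 f (2 * α) - phi2 f α ^ 2) / zeta22 f α ^ 2

/-- A standardized (mean zero, variance one) error density, with the regularity at the tuning
parameter `α` under which the estimating equations below may be formed and differentiated. -/
structure IsErrorDensity (f : ℝ → ℝ) (α : ℝ) : Prop where
  pos : ∀ s, 0 < f s
  integrable : Integrable f
  integral_eq_one : ∫ s, f s = 1
  integrable_sq : Integrable (fun s => s ^ 2 * f s)
  mean_zero : ∫ s, s * f s = 0
  variance_one : ∫ s, s ^ 2 * f s = 1
  contDiff : ContDiff ℝ 2 f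
  /-- The constants `M_{f,i,j}^{(α)}`, `i, j = 0, 1, 2`, are finite
  (the case `i = j = 0` says that `∫ f ^ (1 + α)` is finite). -/
  integrable_M : ∀ i ≤ 2, ∀ j ≤ 2,
    Integrable (fun s => s ^ i * score f s ^ j * f s ^ (1 + α))
  /-- The derivatives of the estimating functions with respect to location and scale are dominated,
  near the true location and scale, by a function that is integrable under the model. -/
  dominated : ∃ δ > 0, ∃ h : ℝ → ℝ, Integrable (fun s => h s * f s) ∧
    ∀ s c τ : ℝ, |c| ≤ δ → |τ - 1| ≤ δ →
      (1 + |(s - c) / τ|) * |wscore f α ((s - c) / τ)|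
        + (1 + ((s - c) / τ) ^ 2) * |deriv (wscore f α) ((s - c) / τ)| ≤ h s

/-- The regressor `x = (1, w')'`, `w` being the vector of outcomes of the control units. -/
def regressor {m : ℕ} (w : Fin m → ℝ) : Fin (m + 1) → ℝ := Fin.cons 1 w

/-- The `T × (m + 1)` design matrix with rows `(1, w_t')`. -/
def design {m T : ℕ} (w : Fin T → Fin m → ℝ) : Matrix (Fin T) (Fin (m + 1)) ℝ :=
  Matrix.of fun t => regressor (w t)

/-- `T⁻¹ X' X`. -/
def gram {m T : ℕ} (w : Fin T → Fin m → ℝ) : Matrix (Fin (m + 1)) (Fin (m + 1)) ℝ :=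
  (T : ℝ)⁻¹ • ((design w).transpose * design w)

/-- The standardized residual `(y - b' x) / √s2`. -/
def stdResidual {m : ℕ} (y : ℝ) (w : Fin m → ℝ) (b : EuclideanSpace ℝ (Fin (m + 1))) (s2 : ℝ) :
    ℝ :=
  (y - ∑ j, b j * regressor w j) / √s2

/-- `(b, s2)`, with `s2 > 0`, solves the minimum density power divergence estimating equations with
tuning parameter `α` for the sample `(y_t, w_t)`, `t < T` (`α = 0`: the likelihood equations). -/
def IsRoot (f : ℝ → ℝ) (α : ℝ) {m T : ℕ} (d : Fin T → ℝ × (Fin m → ℝ))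
    (b : EuclideanSpace ℝ (Fin (m + 1))) (s2 : ℝ) : Prop :=
  0 < s2 ∧
  (∀ j, ∑ t, f (stdResidual (d t).1 (d t).2 b s2) ^ α
      * score f (stdResidual (d t).1 (d t).2 b s2) * regressor (d t).2 j = 0) ∧
  (T : ℝ)⁻¹ * ∑ t, (1 + stdResidual (d t).1 (d t).2 b s2
      * score f (stdResidual (d t).1 (d t).2 b s2)) * f (stdResidual (d t).1 (d t).2 b s2) ^ α
    = α * M f 0 0 α / (1 + α)

/-- The bounds on the design of the first `T` periods: `C` is the constant in all the
`O`-terms, and `c` is the lower bound on the eigenvalues of `T⁻¹ X' X`. -/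
def DesignBounds {m T : ℕ} (w : Fin T → Fin m → ℝ) (C c : ℝ) : Prop :=
  (∀ t j, |design w t j| ≤ C) ∧
  (∀ t j k, |design w t j * design w t k| ≤ C) ∧
  (∀ j k l, (T : ℝ)⁻¹ * ∑ t, |design w t j * design w t k * design w t l| ≤ C) ∧
  (∀ μ ∈ spectrum ℝ (gram w), c ≤ μ) ∧
  (∀ t, design w t ⬝ᵥ (((design w).transpose * design w)⁻¹.mulVec (design w t)) ≤ C / T)

/-- The sample of the first `T` periods. -/
def sample {Ω : Type*} {m : ℕ} (y : ℕ → Ω → ℝ) (w : ℕ → Ω → Fin m → ℝ) (T : ℕ) (ω : Ω) :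
    Fin T → ℝ × (Fin m → ℝ) := fun t => (y t ω, w t ω)

/-- The pre-treatment regression `y_t = β' x_t + η_t`, `x_t = (1, w_t')'`, where `y_t` is the outcome
of the treated unit and `w_t` are the outcomes of the `m` control units: given the `w_t`, the errors
are i.i.d. with density `σ⁻¹ f (· / σ)`; the design is bounded in probability and nondegenerate,
and `T⁻¹ X' X → Σ_x` in probability. -/
structure IsModel {Ω : Type*} [MeasurableSpace Ω] (P : Measure Ω) {m : ℕ} (f : ℝ → ℝ) (σ : ℝ)
    (β : EuclideanSpace ℝ (Fin (m + 1))) (Sx : Matrix (Fin (m + 1)) (Fin (m + 1)) ℝ)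
    (y η : ℕ → Ω → ℝ) (w : ℕ → Ω → Fin m → ℝ) : Prop where
  measurable_error : ∀ t, Measurable (η t)
  measurable_control : ∀ t, Measurable (w t)
  outcome : ∀ t ω, y t ω = ∑ j, β j * regressor (w t ω) j + η t ω
  error_density : ∀ t,
    P.map (η t) = volume.withDensity (fun z => ENNReal.ofReal (1 / σ * f (z / σ)))
  error_indep : iIndepFun η P
  error_indep_control : IndepFun (fun ω t => η t ω) (fun ω t => w t ω) P
  design_bounds : ∀ ε > 0, ∃ C > 0, ∃ c > 0, ∀ᶠ T : ℕ in atTop,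
    1 - ENNReal.ofReal ε ≤ P {ω | DesignBounds (fun t : Fin T => w t ω) C c}
  gram_tendsto : ∀ j k,
    TendstoInMeasure P (fun (T : ℕ) ω => gram (fun t : Fin T => w t ω) j k) atTop
      (fun _ => Sx j k)

/-- `(b_T, s2_T)` is a sequence of (random) roots of the estimating equations, with probability
tending to one, that is consistent for `(β, σ²)`. -/
structure IsConsistentRootSeq {Ω : Type*} [MeasurableSpace Ω] (P : Measure Ω) {m : ℕ}
    (f : ℝ → ℝ) (α σ : ℝ) (β : EuclideanSpace ℝ (Fin (m + 1)))
    (y : ℕ → Ω → ℝ) (w : ℕ → Ω → Fin m → ℝ)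
    (b : ℕ → Ω → EuclideanSpace ℝ (Fin (m + 1))) (s2 : ℕ → Ω → ℝ) : Prop where
  aemeasurable_beta : ∀ T, AEMeasurable (b T) P
  aemeasurable_sigma : ∀ T, AEMeasurable (s2 T) P
  isRoot : Tendsto (fun T => P {ω | IsRoot f α (sample y w T ω) (b T ω) (s2 T ω)}) atTop (𝓝 1)
  consistent_beta : TendstoInMeasure P b atTop (fun _ => β)
  consistent_sigma : TendstoInMeasure P s2 atTop (fun _ => σ ^ 2)

end

end MDPDE

/-! ### Identities for powers of the density and the constants `M` -/

namespace MDPDE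

noncomputable section

/-! The equations define an M-estimator of location and scale with scores `ψ = f^α u` and `χ = (1 +
z u) f^α - K`, where `K = α M₀₀ / (1 + α)`. The argument is the classical one: the averaged scores
are nearly affine close to the truth, so a consistent root is to first order a linear function of
the scores at the truth, and these obey a central limit theorem.

Put `κ = (b - β)/√s2` and `l = σ/√s2`. The standardized residual becomes `l e_t - κ' x_t`, linear in
`(κ, l)`, where `e_t = η_t/σ` has density `f` and the truth is `(0, 1)`. Integrating by parts
against `f` gives the sensitivities `E ψ' = -ζ₁₁` and `E zχ' = -4 ζ₂₂`. Both cross-sensitivities, `E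
zψ'` and `E χ'`, equal `-(M₀₁ + M₁₂)` at `α`, and the covariance `E ψχ` equals `M₀₁ + M₁₂` at `2α`.
That these sums vanish makes the limiting derivative block diagonal and the two limits independent.
`IsErrorDensity.isEstimatingPair` collects these facts in `IsEstimatingPair`; the asymptotics use
only that structure and `IsDesign`.

Multiplying the averaged scores by the inverse of their limiting derivative gives random maps `N_T`
whose increments near `(0, 1)` are those of the identity up to a small Lipschitz error, with
probability close to one (`IsDesign.exists_isNearIdentity`). The domination hypothesis makes the
oscillation of `ψ'` and `χ'` small in mean, and a weighted law of large numbers handles the averaged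
derivatives. Two consequences follow. A root `θ` near `θ₀ = (0, 1)` satisfies `θ - θ₀ = -N_T(θ₀)` up
to a small multiple of `‖N_T(θ₀)‖` (`IsNearIdentity.norm_root_sub_le`). And the map `θ - N_T(θ)` is
a contraction, so its iterates converge to a root (`IsNearIdentity.tendsto_iterate`); they are
continuous in the data, so the limit is measurable.

The law of large numbers and the central limit theorem both rest on
`IsDesign.tendsto_integral_exp_sum`. As the errors are independent of each other and of the
regressors, the characteristic function of a sum over `t` is the mean of a product of factors
depending on the `x_t`. If each factor is `exp(-q_T(x_t))` up to `o(1/T)`, uniformly for bounded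
regressors, and `∑ q_T(x_t)` tends in probability to a constant, the limit can be read off. The
delta method for `s2 = σ²/l²` returns to the original parameters.

For the normal density every constant that does not vanish is a rational multiple of `M₀₀`, and
`M₀₀(2a) / M₀₀(a)² = √(1 + a²/(1 + 2a))`, which yields the closed forms. -/

/-- The estimating function `(1 + z u(z)) f(z) ^ α` of the scale parameter. -/
def scaleScore (f : ℝ → ℝ) (α : ℝ) (z : ℝ) : ℝ := (1 + z * score f z) * f z ^ α

namespace IsErrorDensity

variable {f : ℝ → ℝ} {α : ℝ}

lemma rpow_one_add (hf : IsErrorDensity f α) (a s : ℝ) : f s ^ (1 + a) = f s ^ a * f s := by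
  rw [Real.rpow_add (hf.pos s), Real.rpow_one, mul_comm]

lemma rpow_one_add_two_mul (hf : IsErrorDensity f α) (a s : ℝ) :
    f s ^ (1 + 2 * a) = f s ^ a * f s ^ a * f s := by
  rw [two_mul, Real.rpow_add (hf.pos s), Real.rpow_one, Real.rpow_add (hf.pos s), mul_comm]

lemma hasDerivAt (hf : IsErrorDensity f α) (s : ℝ) : HasDerivAt f (score f s * f s) s := by
  have h := (hf.contDiff.differentiable (by norm_num) s).hasDerivAt
  rwa [score, div_mul_cancel₀ _ (hf.pos s).ne']

lemma hasDerivAt_rpow (hf : IsErrorDensity f α) (a s : ℝ) :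
    HasDerivAt (fun s => f s ^ a) (a * (score f s * f s ^ a)) s := by
  have h := (hf.hasDerivAt s).rpow_const (p := a) (Or.inl (hf.pos s).ne')
  convert h using 1
  rw [Real.rpow_sub_one (hf.pos s).ne']
  field_simp [(hf.pos s).ne']

lemma contDiff_score (hf : IsErrorDensity f α) : ContDiff ℝ 1 (score f) := by
  have h1 : ContDiff ℝ 1 (deriv f) := (contDiff_succ_iff_deriv.1 hf.contDiff).2.2
  exact h1.div (hf.contDiff.of_le (by norm_num)) fun s => (hf.pos s).ne'

lemma contDiff_rpow (hf : IsErrorDensity f α) (a : ℝ) : ContDiff ℝ 1 (fun s => f s ^ a) :=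
  (hf.contDiff.of_le (by norm_num)).rpow_const_of_ne fun s => (hf.pos s).ne'

lemma contDiff_wscore (hf : IsErrorDensity f α) (a : ℝ) : ContDiff ℝ 1 (wscore f a) :=
  (hf.contDiff_rpow a).mul hf.contDiff_score

lemma hasDerivAt_wscore (hf : IsErrorDensity f α) (a s : ℝ) :
    HasDerivAt (wscore f a) (deriv (wscore f a) s) s :=
  ((hf.contDiff_wscore a).differentiable (by norm_num) s).hasDerivAt

lemma continuous_deriv_wscore (hf : IsErrorDensity f α) (a : ℝ) :
    Continuous (deriv (wscore f a)) :=
  (hf.contDiff_wscore a).continuous_deriv (by norm_num)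

lemma scaleScore_eq (a : ℝ) : scaleScore f a = fun z => f z ^ a + z * wscore f a z := by
  funext z
  simp only [scaleScore, wscore]
  ring

lemma hasDerivAt_scaleScore (hf : IsErrorDensity f α) (a s : ℝ) :
    HasDerivAt (scaleScore f a) ((1 + a) * wscore f a s + s * deriv (wscore f a) s) s := by
  rw [scaleScore_eq]
  refine ((hf.hasDerivAt_rpow a s).add
    ((hasDerivAt_id s).mul (hf.hasDerivAt_wscore a s))).congr_deriv ?_
  have : wscore f a s = f s ^ a * score f s := rfl
  rw [this]
  simp only [id]
  ring

lemma continuous_rpow (hf : IsErrorDensity f α) (a : ℝ) : Continuous fun s => f s ^ a :=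
  (hf.contDiff_rpow a).continuous

lemma continuous_score (hf : IsErrorDensity f α) : Continuous (score f) :=
  hf.contDiff_score.continuous

lemma continuous_wscore (hf : IsErrorDensity f α) (a : ℝ) : Continuous (wscore f a) :=
  (hf.contDiff_wscore a).continuous

/-- A primitive of an integrable function is bounded, and `f ^ (1 + α)` is one. -/
lemma exists_le (hf : IsErrorDensity f α) (hα : 0 ≤ α) : ∃ B, ∀ s, f s ≤ B := by
  have hint : Integrable fun s => (1 + α) * (score f s * f s ^ (1 + α)) := by
    simpa using (hf.integrable_M 0 (by norm_num) 1 (by norm_num)).const_mul (1 + α)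
  set K := f 0 ^ (1 + α) + ∫ s, ‖(1 + α) * (score f s * f s ^ (1 + α))‖ with hK
  have hb : ∀ s, f s ^ (1 + α) ≤ K := by
    intro s
    have h := intervalIntegral.integral_eq_sub_of_hasDerivAt (a := 0) (b := s)
      (fun x _ => hf.hasDerivAt_rpow (1 + α) x) hint.intervalIntegrable
    have h2 := intervalIntegral.norm_integral_le_integral_norm_uIoc (a := 0) (b := s)
      (f := fun s => (1 + α) * (score f s * f s ^ (1 + α))) (μ := volume)
    have h3 := setIntegral_le_integral (s := Set.uIoc 0 s) hint.norm
      (Eventually.of_forall fun _ => norm_nonneg _)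
    have h4 := le_abs_self (f s ^ (1 + α) - f 0 ^ (1 + α))
    rw [← h, ← Real.norm_eq_abs] at h4
    linarith
  refine ⟨K ^ (1 + α)⁻¹, fun s => ?_⟩
  have h1 : (0 : ℝ) < 1 + α := by linarith
  calc f s = (f s ^ (1 + α)) ^ (1 + α)⁻¹ := by
        rw [← Real.rpow_mul (hf.pos s).le, mul_inv_cancel₀ h1.ne', Real.rpow_one]
    _ ≤ _ := Real.rpow_le_rpow (Real.rpow_nonneg (hf.pos s).le _) (hb s) (by positivity)

/-- The integrand is the one at `α` times `f^α`, which is bounded because `f` is. Hence second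
moments of the scores need no hypothesis at `2α`. -/
lemma integrable_M_two_mul (hf : IsErrorDensity f α) (hα : 0 ≤ α) {i j : ℕ} (hi : i ≤ 2)
    (hj : j ≤ 2) : Integrable fun s => s ^ i * score f s ^ j * f s ^ (1 + 2 * α) := by
  obtain ⟨B, hB⟩ := hf.exists_le hα
  have h := (hf.integrable_M i hi j hj).mul_bdd (c := B ^ α)
    (hf.continuous_rpow α).aestronglyMeasurable (Eventually.of_forall fun s => by
      rw [Real.norm_of_nonneg (Real.rpow_nonneg (hf.pos s).le _)]
      exact Real.rpow_le_rpow (hf.pos s).le (hB s) hα)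
  refine h.congr (Eventually.of_forall fun s => ?_)
  simp only [hf.rpow_one_add_two_mul]
  rw [hf.rpow_one_add]
  ring

/-- `(1 + α) u f^(1+α)` is the derivative of the integrable function `f^(1+α)`. This covers `α = 0`,
where the assumption on `M₀₁` says nothing. -/
lemma M_zero_one (hf : IsErrorDensity f α) (hα : 0 ≤ α) : M f 0 1 α = 0 := by
  have h1 := hf.integrable_M 0 (by norm_num) 1 (by norm_num)
  have h := integral_eq_zero_of_hasDerivAt_of_integrable (hf.hasDerivAt_rpow (1 + α))
    (by simpa using h1.const_mul (1 + α))
    (by simpa using hf.integrable_M 0 (by norm_num) 0 (by norm_num))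
  rw [integral_const_mul] at h
  simpa [M, (by linarith : 1 + α ≠ 0)] using h

/-- The derivative of `s f^(1+α)` integrates to zero, so `M₀₀ + (1 + α) M₁₁ = 0`. The left side is
the mean of the scale score, so the constant in the scale equation is exactly the one that centers
it. -/
lemma M_one_one (hf : IsErrorDensity f α) (hα : 0 ≤ α) :
    M f 0 0 α + M f 1 1 α = α * M f 0 0 α / (1 + α) := by
  have h00 := hf.integrable_M 0 (by norm_num) 0 (by norm_num)
  have h11 := hf.integrable_M 1 (by norm_num) 1 (by norm_num)
  have h10 := hf.integrable_M 1 (by norm_num) 0 (by norm_num)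
  have h := integral_eq_zero_of_hasDerivAt_of_integrable
    (fun x => (hasDerivAt_id x).mul (hf.hasDerivAt_rpow (1 + α) x))
    ((h00.add (h11.const_mul (1 + α))).congr (Eventually.of_forall fun s => by
      simp only [Pi.add_apply, id]; ring))
    (h10.congr (Eventually.of_forall fun s => by simp))
  have h' : M f 0 0 α + (1 + α) * M f 1 1 α = 0 := by
    rw [M, M, ← integral_const_mul, ← integral_add h00 (h11.const_mul _), ← h]
    congr 1; funext s; simp only [id]; ring
  rw [eq_div_iff (by linarith)]
  linarith

/-- If `M_{f,1,2}^{(a)} = 0` for `a > 0`, then also for `a = 0`. -/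
lemma M_one_two_zero (hf : IsErrorDensity f 0) (h : ∀ a > 0, M f 1 2 a = 0) : M f 1 2 0 = 0 := by
  obtain ⟨B, hB⟩ := hf.exists_le le_rfl
  have hlim : Tendsto (fun n : ℕ => M f 1 2 (1 / ((n : ℝ) + 1))) atTop (𝓝 (M f 1 2 0)) := by
    -- For exponents `a` in `(0, 1]` one has `f^a ≤ max 1 B`, whether `f ≤ 1` or not, so the
    -- integrand at zero times this constant dominates.
    refine tendsto_integral_of_dominated_convergence
      (fun s => ‖s ^ 1 * score f s ^ 2 * f s ^ (1 + (0 : ℝ))‖ * max 1 B) (fun n => ?_) ?_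
      (fun n => Eventually.of_forall fun s => ?_) (Eventually.of_forall fun s => ?_)
    · exact (((continuous_id.pow 1).mul (hf.continuous_score.pow 2)).mul
        (hf.continuous_rpow _)).aestronglyMeasurable
    · exact (hf.integrable_M 1 (by norm_num) 2 (by norm_num)).norm.mul_const _
    · have hn : (0 : ℝ) < 1 / ((n : ℝ) + 1) := by positivity
      have hn1 : 1 / ((n : ℝ) + 1) ≤ 1 := by
        rw [div_le_one (by positivity)]; linarith [n.cast_nonneg (α := ℝ)]
      have hpow : f s ^ (1 / ((n : ℝ) + 1)) ≤ max 1 B := by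
        rcases le_total (f s) 1 with h1 | h1
        · exact (Real.rpow_le_one (hf.pos s).le h1 hn.le).trans (le_max_left _ _)
        · calc f s ^ (1 / ((n : ℝ) + 1)) ≤ f s ^ (1 : ℝ) := Real.rpow_le_rpow_of_exponent_le h1 hn1
            _ = f s := Real.rpow_one _
            _ ≤ _ := (hB s).trans (le_max_right _ _)
      rw [hf.rpow_one_add, hf.rpow_one_add, Real.rpow_zero, one_mul, norm_mul _ (_ * f s),
        norm_mul (f s ^ _), norm_mul _ (f s),
        Real.norm_of_nonneg (Real.rpow_nonneg (hf.pos s).le _)]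
      have := mul_le_mul_of_nonneg_left hpow
        (mul_nonneg (norm_nonneg (s ^ 1 * score f s ^ 2)) (norm_nonneg (f s)))
      linarith
    · have ht : Tendsto (fun n : ℕ => 1 + 1 / ((n : ℝ) + 1)) atTop (𝓝 (1 + 0)) :=
        tendsto_const_nhds.add tendsto_one_div_add_atTop_nhds_zero_nat
      exact ((Real.continuousAt_const_rpow (hf.pos s).ne').tendsto.comp ht).const_mul _
  refine tendsto_nhds_unique hlim ?_
  simp only [h _ (Nat.one_div_pos_of_nat)]
  exact tendsto_const_nhds

lemma M_orthogonal (hf : IsErrorDensity f α) (hα : 0 ≤ α)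
    (hM : ∀ a > 0, M f 0 1 a = 0 ∧ M f 1 2 a = 0) : M f 1 2 α = 0 ∧ M f 1 2 (2 * α) = 0
      ∧ M f 0 1 (2 * α) = 0 := by
  rcases hα.eq_or_lt with rfl | h
  · have := hf.M_one_two_zero fun a ha => (hM a ha).2
    have h2 := hf.M_zero_one le_rfl
    simp [this, h2]
  · exact ⟨(hM α h).2, (hM _ (by positivity)).2, (hM _ (by positivity)).1⟩

end IsErrorDensity

end

end MDPDE

/-! ### Estimating pairs: domination and nondegeneracy -/

namespace MDPDE

noncomputable section

/-- Estimating functions `ψ`, `χ` of a location and a scale parameter with derivatives `ψ'`, `χ'`: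
under the error law `ν` they are centered, square integrable and orthogonal, with sensitivities
`a`, `d` and no cross-sensitivities. -/
structure IsEstimatingPair (ν : Measure ℝ) (ψ χ ψ' χ' : ℝ → ℝ) (a d v₁ v₂ : ℝ) : Prop where
  hasDerivAt_loc : ∀ z, HasDerivAt ψ (ψ' z) z
  hasDerivAt_scale : ∀ z, HasDerivAt χ (χ' z) z
  continuous_loc' : Continuous ψ'
  continuous_scale' : Continuous χ'
  integrable_loc_sq : Integrable (fun z => ψ z ^ 2) ν
  integrable_scale_sq : Integrable (fun z => χ z ^ 2) ν
  integral_loc : ∫ z, ψ z ∂ν = 0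
  integral_scale : ∫ z, χ z ∂ν = 0
  integral_loc_sq : ∫ z, ψ z ^ 2 ∂ν = v₁
  integral_scale_sq : ∫ z, χ z ^ 2 ∂ν = v₂
  integral_loc_mul_scale : ∫ z, ψ z * χ z ∂ν = 0
  integral_loc' : ∫ z, ψ' z ∂ν = -a
  integral_mul_loc' : ∫ z, z * ψ' z ∂ν = 0
  integral_scale' : ∫ z, χ' z ∂ν = 0
  integral_mul_scale' : ∫ z, z * χ' z ∂ν = -d
  pos_loc : 0 < a
  pos_scale : 0 < d
  envelope : ∃ δ > 0, ∃ h : ℝ → ℝ, Integrable h ν ∧ ∀ s c l : ℝ, |c| ≤ δ → |l - 1| ≤ δ →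
    (1 + |s|) * (|ψ' (l * s - c)| + |χ' (l * s - c)|) ≤ h s

/-- The law with density `f`. -/
def errorLaw (f : ℝ → ℝ) : Measure ℝ := volume.withDensity fun s => ENNReal.ofReal (f s)

namespace IsErrorDensity

variable {f : ℝ → ℝ} {α : ℝ}

lemma measurable_ofReal (hf : IsErrorDensity f α) :
    Measurable fun s => ENNReal.ofReal (f s) :=
  ENNReal.measurable_ofReal.comp hf.contDiff.continuous.measurable

lemma integrable_errorLaw (hf : IsErrorDensity f α) {g : ℝ → ℝ} :
    Integrable g (errorLaw f) ↔ Integrable (fun s => g s * f s) := by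
  rw [errorLaw, integrable_withDensity_iff hf.measurable_ofReal (by simp)]
  simp only [ENNReal.toReal_ofReal (hf.pos _).le]

lemma integral_errorLaw (hf : IsErrorDensity f α) (g : ℝ → ℝ) :
    ∫ s, g s ∂errorLaw f = ∫ s, g s * f s := by
  rw [errorLaw, integral_withDensity_eq_integral_toReal_smul hf.measurable_ofReal (by simp)]
  simp only [ENNReal.toReal_ofReal (hf.pos _).le, smul_eq_mul, mul_comm]

lemma isProbabilityMeasure (hf : IsErrorDensity f α) : IsProbabilityMeasure (errorLaw f) := by
  constructor
  rw [errorLaw, withDensity_apply _ MeasurableSet.univ, setLIntegral_univ,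
    ← ofReal_integral_eq_lintegral_ofReal hf.integrable
      (Eventually.of_forall fun s => (hf.pos s).le), hf.integral_eq_one, ENNReal.ofReal_one]

/-- The residual `l s - c` is `(s - c/l)/(1/l)`, so the hypothesis applies with shift `c/l` and
scale `1/l`. For `l ≥ 1/2` these move by at most twice `|c|` and `|l - 1|`, whence the radius `min
(1/2) (δ/2)`. The weight `1 + |s|` is at most `2 + 2|z|`, and expanding the product accounts for the
factor `2(4 + α)`. -/
lemma dominated' (hf : IsErrorDensity f α) (hα : 0 ≤ α) :
    ∃ δ > 0, ∃ h : ℝ → ℝ, Integrable h (errorLaw f) ∧ ∀ s c l : ℝ, |c| ≤ δ → |l - 1| ≤ δ →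
      (1 + |s|) * (|wscore f α (l * s - c)| + |deriv (wscore f α) (l * s - c)|
        + |(1 + α) * wscore f α (l * s - c) + (l * s - c) * deriv (wscore f α) (l * s - c)|)
        ≤ h s := by
  obtain ⟨δ, hδ, h, hint, hdom⟩ := hf.dominated
  refine ⟨min (1 / 2) (δ / 2), by positivity, fun s => 2 * (4 + α) * h s, ?_, ?_⟩
  · rw [hf.integrable_errorLaw]
    exact (hint.const_mul (2 * (4 + α))).congr (Eventually.of_forall fun s => by ring)
  intro s c l hc hl
  have hc1 := hc.trans (min_le_left _ _)
  have hc2 := hc.trans (min_le_right _ _)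
  have hl1 := hl.trans (min_le_left _ _)
  have hl2 := hl.trans (min_le_right _ _)
  have hl0 : 1 / 2 ≤ l := by linarith [(abs_le.1 hl1).1]
  have hlp : 0 < l := by linarith
  have key := hdom s (c / l) (1 / l) (by
      rw [abs_div, abs_of_pos hlp, div_le_iff₀ hlp]; nlinarith) (by
      rw [show 1 / l - 1 = (1 - l) / l by field_simp, abs_div, abs_of_pos hlp, div_le_iff₀ hlp,
        abs_sub_comm]; nlinarith)
  have hz : (s - c / l) / (1 / l) = l * s - c := by field_simp
  rw [hz] at key
  set z := l * s - c with hzdef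
  set p := wscore f α z
  set q := deriv (wscore f α) z
  have hs : |s| ≤ 2 * |z| + 1 := by
    have h1 : l * |s| ≤ |z| + |c| := by
      calc l * |s| = |z + c| := by rw [hzdef, sub_add_cancel, abs_mul, abs_of_pos hlp]
        _ ≤ _ := abs_add_le _ _
    nlinarith [abs_nonneg s]
  have hchi : |(1 + α) * p + z * q| ≤ (1 + α) * |p| + |z| * |q| := by
    refine (abs_add_le _ _).trans ?_
    rw [abs_mul, abs_mul, abs_of_nonneg (by linarith : 0 ≤ 1 + α)]
  have hp := abs_nonneg p
  have hq := abs_nonneg q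
  have hzn := abs_nonneg z
  have hzz : z ^ 2 = |z| ^ 2 := (sq_abs z).symm
  rw [hzz] at key
  have hzq : |z| * |q| ≤ (1 + |z| ^ 2) * |q| := by nlinarith [sq_nonneg (|z| - 1)]
  have hqq : |q| ≤ (1 + |z| ^ 2) * |q| := by nlinarith [sq_nonneg (|z|)]
  have hpz : 0 ≤ |z| * |p| := by positivity
  have hpα : 0 ≤ α * (1 + |z| ^ 2) * |q| := by positivity
  calc (1 + |s|) * (|p| + |q| + |(1 + α) * p + z * q|)
      ≤ (2 + 2 * |z|) * (|p| + |q| + ((1 + α) * |p| + |z| * |q|)) := by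
        exact mul_le_mul (by linarith) (by linarith) (by positivity) (by positivity)
    _ ≤ 2 * (4 + α) * ((1 + |z|) * |p| + (1 + |z| ^ 2) * |q|) := by nlinarith
    _ ≤ _ := by
        exact mul_le_mul_of_nonneg_left key (by positivity)

/-- Otherwise the continuous nonnegative integrand vanishes identically, the score is zero and `f`
is a positive constant, which is not integrable. -/
lemma zeta11_pos (hf : IsErrorDensity f α) : 0 < zeta11 f α := by
  have hnn : ∀ s, 0 ≤ s ^ 0 * score f s ^ 2 * f s ^ (1 + α) := fun s => by
    have := Real.rpow_nonneg (hf.pos s).le (1 + α)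
    positivity
  refine lt_of_le_of_ne (integral_nonneg hnn) fun h0 => ?_
  have hcont : Continuous fun s => s ^ 0 * score f s ^ 2 * f s ^ (1 + α) :=
    ((continuous_id.pow 0).mul (hf.continuous_score.pow 2)).mul (hf.continuous_rpow _)
  have hae : _ =ᵐ[volume] fun _ => (0 : ℝ) := (integral_eq_zero_iff_of_nonneg hnn
    (hf.integrable_M 0 (by norm_num) 2 (by norm_num))).1 h0.symm
  have heq := (hcont.ae_eq_iff_eq volume continuous_const).1 hae
  have hscore : ∀ s, score f s = 0 := fun s => by
    have := congrFun heq s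
    simpa [(Real.rpow_pos_of_pos (hf.pos s) _).ne'] using this
  have hconst : ∀ s, f s = f 0 := fun s =>
    is_const_of_deriv_eq_zero (hf.contDiff.differentiable (by norm_num))
      (fun x => by rw [(hf.hasDerivAt x).deriv, hscore x, zero_mul]) s 0
  have hi := hf.integrable
  rw [show f = fun _ => f 0 from funext hconst] at hi
  rw [integrable_const_iff] at hi
  rcases hi with hi | hi
  · exact (hf.pos 0).ne' hi
  · exact absurd hi.measure_univ_lt_top (by simp)

lemma integrable_combo (hf : IsErrorDensity f α) :
    Integrable fun s => (1 + s * score f s) ^ 2 * f s ^ (1 + α) := by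
  refine (((hf.integrable_M 2 le_rfl 2 le_rfl).add
    ((hf.integrable_M 1 (by norm_num) 1 (by norm_num)).const_mul 2)).add
    (hf.integrable_M 0 (by norm_num) 0 (by norm_num))).congr (Eventually.of_forall fun s => ?_)
  simp only [Pi.add_apply]
  ring

lemma four_mul_zeta22 (h22 : Integrable fun s => s ^ 2 * score f s ^ 2 * f s ^ (1 + α))
    (h11 : Integrable fun s => s ^ 1 * score f s ^ 1 * f s ^ (1 + α))
    (h00 : Integrable fun s => s ^ 0 * score f s ^ 0 * f s ^ (1 + α)) :
    4 * zeta22 f α = ∫ s, (1 + s * score f s) ^ 2 * f s ^ (1 + α) := by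
  have hA : Integrable fun s => s ^ 2 * score f s ^ 2 * f s ^ (1 + α)
      + 2 * (s ^ 1 * score f s ^ 1 * f s ^ (1 + α)) := h22.add (h11.const_mul 2)
  rw [zeta22, mul_div_cancel₀ _ (by norm_num : (4 : ℝ) ≠ 0), M, M, M, ← integral_const_mul,
    ← integral_add h22 (h11.const_mul 2), ← integral_add hA h00]
  congr 1
  funext s
  ring

/-- `4 ζ₂₂` is the integral of the continuous function `(1 + s u)² f^(1+α) ≥ 0`, whose value at `s =
0` is `f(0)^(1+α) > 0`, whatever the score is there. -/
lemma zeta22_pos (hf : IsErrorDensity f α) : 0 < zeta22 f α := by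
  have h4 := four_mul_zeta22 (hf.integrable_M 2 le_rfl 2 le_rfl)
    (hf.integrable_M 1 (by norm_num) 1 (by norm_num))
    (hf.integrable_M 0 (by norm_num) 0 (by norm_num))
  have hnn : ∀ s, 0 ≤ (1 + s * score f s) ^ 2 * f s ^ (1 + α) := fun s => by
    have := Real.rpow_nonneg (hf.pos s).le (1 + α)
    positivity
  suffices 0 < 4 * zeta22 f α by linarith
  rw [h4]
  refine lt_of_le_of_ne (integral_nonneg hnn) fun h0 => ?_
  have hcont : Continuous fun s => (1 + s * score f s) ^ 2 * f s ^ (1 + α) :=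
    ((continuous_const.add (continuous_id.mul hf.continuous_score)).pow 2).mul
      (hf.continuous_rpow _)
  have hae : _ =ᵐ[volume] fun _ => (0 : ℝ) := (integral_eq_zero_iff_of_nonneg hnn hf.integrable_combo).1 h0.symm
  have := congrFun ((hcont.ae_eq_iff_eq volume continuous_const).1 hae) 0
  simp [(Real.rpow_pos_of_pos (hf.pos 0) _).ne'] at this

end IsErrorDensity

end

end MDPDE

/-! ### The density power scores form an estimating pair -/

namespace MDPDE

noncomputable section

namespace IsErrorDensity

variable {f : ℝ → ℝ} {α : ℝ}

lemma integral_deriv_mul {g g' p p' : ℝ → ℝ} (hg : ∀ x, HasDerivAt g (g' x) x)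
    (hp : ∀ x, HasDerivAt p (p' x) x) (h1 : Integrable fun x => g' x * p x)
    (h2 : Integrable fun x => g x * p' x) (h3 : Integrable fun x => g x * p x) :
    ∫ x, g' x * p x = -∫ x, g x * p' x := by
  have := integral_mul_deriv_eq_deriv_mul_of_integrable (u := g) (v := p) (fun x _ => hg x)
    (fun x _ => hp x) h2 h1 h3
  rw [this, neg_neg]

/-- The four sensitivities come from integration by parts, against `f` or against `s f`; the
boundary terms vanish by integrability. The scale score is twice the usual normalization, which is
where the factors 4 come from; they cancel in the final variance. -/
theorem isEstimatingPair (hf : IsErrorDensity f α) (hα : 0 ≤ α)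
    (hM : ∀ a > 0, M f 0 1 a = 0 ∧ M f 1 2 a = 0) :
    IsEstimatingPair (errorLaw f) (wscore f α)
      (fun z => scaleScore f α z - α * M f 0 0 α / (1 + α)) (deriv (wscore f α))
      (fun z => (1 + α) * wscore f α z + z * deriv (wscore f α) z) (zeta11 f α)
      (4 * zeta22 f α) (zeta11 f (2 * α) - phi1 f α ^ 2)
      (4 * (zeta22 f (2 * α) - phi2 f α ^ 2)) := by
  have := hf.isProbabilityMeasure
  obtain ⟨hM12, hM12', hM01'⟩ := hf.M_orthogonal hα hM
  have hM01 := hf.M_zero_one hα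
  have hM11 := hf.M_one_one hα
  set K := α * M f 0 0 α / (1 + α) with hK
  have I : ∀ i ≤ 2, ∀ j ≤ 2, Integrable fun s => s ^ i * score f s ^ j * f s ^ (1 + α) :=
    hf.integrable_M
  have I2 : ∀ i ≤ 2, ∀ j ≤ 2, Integrable fun s => s ^ i * score f s ^ j * f s ^ (1 + 2 * α) :=
    fun i hi j hj => hf.integrable_M_two_mul hα hi hj
  have e1 : ∀ s, wscore f α s * f s = s ^ 0 * score f s ^ 1 * f s ^ (1 + α) := fun s => by
    rw [hf.rpow_one_add, wscore]; ring
  have e2 : ∀ s, scaleScore f α s * f s = s ^ 0 * score f s ^ 0 * f s ^ (1 + α)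
      + s ^ 1 * score f s ^ 1 * f s ^ (1 + α) := fun s => by
    rw [hf.rpow_one_add, scaleScore]; ring
  have e3 : ∀ s, wscore f α s ^ 2 * f s = s ^ 0 * score f s ^ 2 * f s ^ (1 + 2 * α) :=
    fun s => by rw [hf.rpow_one_add_two_mul, wscore]; ring
  have e4 : ∀ s, scaleScore f α s ^ 2 * f s = (1 + s * score f s) ^ 2 * f s ^ (1 + 2 * α) :=
    fun s => by rw [hf.rpow_one_add_two_mul, scaleScore]; ring
  have e5 : ∀ s, wscore f α s * scaleScore f α s * f s
      = s ^ 0 * score f s ^ 1 * f s ^ (1 + 2 * α) + s ^ 1 * score f s ^ 2 * f s ^ (1 + 2 * α) :=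
    fun s => by rw [hf.rpow_one_add_two_mul, wscore, scaleScore]; ring
  have i1 : Integrable (wscore f α) (errorLaw f) := by
    rw [hf.integrable_errorLaw]; simpa only [e1] using I 0 (by norm_num) 1 (by norm_num)
  have i2 : Integrable (scaleScore f α) (errorLaw f) := by
    rw [hf.integrable_errorLaw]
    simp only [e2]
    exact (I 0 (by norm_num) 0 (by norm_num)).add (I 1 (by norm_num) 1 (by norm_num))
  have i3 : Integrable (fun z => wscore f α z ^ 2) (errorLaw f) := by
    rw [hf.integrable_errorLaw]; simpa only [e3] using I2 0 (by norm_num) 2 le_rfl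
  have i4 : Integrable (fun z => scaleScore f α z ^ 2) (errorLaw f) := by
    rw [hf.integrable_errorLaw]
    simp only [e4]
    refine (((I2 2 le_rfl 2 le_rfl).add ((I2 1 (by norm_num) 1 (by norm_num)).const_mul 2)).add
      (I2 0 (by norm_num) 0 (by norm_num))).congr (Eventually.of_forall fun s => ?_)
    simp only [Pi.add_apply]
    ring
  have i5 : Integrable (fun z => wscore f α z * scaleScore f α z) (errorLaw f) := by
    rw [hf.integrable_errorLaw]
    simp only [e5]
    exact (I2 0 (by norm_num) 1 (by norm_num)).add (I2 1 (by norm_num) 2 le_rfl)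
  have E1 : ∫ z, wscore f α z ∂errorLaw f = 0 := by
    rw [hf.integral_errorLaw]; simp only [e1]; exact hM01
  have E2 : ∫ z, scaleScore f α z ∂errorLaw f = K := by
    rw [hf.integral_errorLaw, ← hM11]
    simp only [e2]
    exact integral_add (I 0 (by norm_num) 0 (by norm_num)) (I 1 (by norm_num) 1 (by norm_num))
  obtain ⟨δ, hδ, h, hint, hdom⟩ := hf.dominated' hα
  have hbound : ∀ s, (1 + |s|) * (|deriv (wscore f α) s|
      + |(1 + α) * wscore f α s + s * deriv (wscore f α) s|) ≤ h s := fun s => by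
    have := hdom s 0 1 (by simpa using hδ.le) (by simpa using hδ.le)
    simp only [one_mul, sub_zero] at this
    refine le_trans ?_ this
    gcongr
    exact le_add_of_nonneg_left (abs_nonneg _)
  have hcψ := hf.continuous_deriv_wscore α
  have hcχ : Continuous fun z => (1 + α) * wscore f α z + z * deriv (wscore f α) z :=
    (continuous_const.mul (hf.continuous_wscore α)).add (continuous_id.mul hcψ)
  have mono : ∀ g : ℝ → ℝ, Continuous g → (∀ s, |g s| ≤ (1 + |s|) * (|deriv (wscore f α) s|
      + |(1 + α) * wscore f α s + s * deriv (wscore f α) s|)) →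
      Integrable (fun s => g s * f s) := fun g hg hb => by
    rw [← hf.integrable_errorLaw]
    exact hint.mono' hg.aestronglyMeasurable
      (Eventually.of_forall fun s => (hb s).trans (hbound s))
  have j1 : Integrable fun s => deriv (wscore f α) s * f s := mono _ hcψ fun s => by
    nlinarith [abs_nonneg s, abs_nonneg (deriv (wscore f α) s),
      abs_nonneg ((1 + α) * wscore f α s + s * deriv (wscore f α) s)]
  have j2 : Integrable fun s => (s * deriv (wscore f α) s) * f s :=
    mono _ (continuous_id.mul hcψ) fun s => by
    rw [abs_mul]
    nlinarith [abs_nonneg s, abs_nonneg (deriv (wscore f α) s),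
      abs_nonneg ((1 + α) * wscore f α s + s * deriv (wscore f α) s)]
  have j3 := mono _ hcχ fun s => by
    nlinarith [abs_nonneg s, abs_nonneg (deriv (wscore f α) s),
      abs_nonneg ((1 + α) * wscore f α s + s * deriv (wscore f α) s)]
  have j4 : Integrable fun s =>
      (s * ((1 + α) * wscore f α s + s * deriv (wscore f α) s)) * f s :=
    mono _ (continuous_id.mul hcχ) fun s => by
    rw [abs_mul]
    nlinarith [abs_nonneg s, abs_nonneg (deriv (wscore f α) s),
      abs_nonneg ((1 + α) * wscore f α s + s * deriv (wscore f α) s)]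
  have dsf : ∀ s, HasDerivAt (fun s => s * f s) (f s + s * (score f s * f s)) s := fun s => by
    exact ((hasDerivAt_id s).mul (hf.hasDerivAt s)).congr_deriv (by simp)
  have g1 : ∀ s, wscore f α s * (score f s * f s) = s ^ 0 * score f s ^ 2 * f s ^ (1 + α) :=
    fun s => by rw [hf.rpow_one_add, wscore]; ring
  have g2 : ∀ s, wscore f α s * (f s + s * (score f s * f s))
      = s ^ 0 * score f s ^ 1 * f s ^ (1 + α) + s ^ 1 * score f s ^ 2 * f s ^ (1 + α) :=
    fun s => by rw [hf.rpow_one_add, wscore]; ring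
  have g3 : ∀ s, scaleScore f α s * (score f s * f s)
      = s ^ 0 * score f s ^ 1 * f s ^ (1 + α) + s ^ 1 * score f s ^ 2 * f s ^ (1 + α) :=
    fun s => by rw [hf.rpow_one_add, scaleScore]; ring
  have g4 : ∀ s, scaleScore f α s * (f s + s * (score f s * f s))
      = (1 + s * score f s) ^ 2 * f s ^ (1 + α) :=
    fun s => by rw [hf.rpow_one_add, scaleScore]; ring
  have g5 : ∀ s, wscore f α s * (s * f s) = s ^ 1 * score f s ^ 1 * f s ^ (1 + α) :=
    fun s => by rw [hf.rpow_one_add, wscore]; ring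
  have g6 : ∀ s, scaleScore f α s * (s * f s)
      = s ^ 1 * score f s ^ 0 * f s ^ (1 + α) + s ^ 2 * score f s ^ 1 * f s ^ (1 + α) :=
    fun s => by rw [hf.rpow_one_add, scaleScore]; ring
  have k12 := (I 0 (by norm_num) 1 (by norm_num)).add (I 1 (by norm_num) 2 le_rfl)
  -- This single cancellation makes both cross-sensitivities vanish.
  have hv12 : ∫ s, s ^ 0 * score f s ^ 1 * f s ^ (1 + α)
      + s ^ 1 * score f s ^ 2 * f s ^ (1 + α) = 0 := by
    rw [integral_add (I 0 (by norm_num) 1 (by norm_num)) (I 1 (by norm_num) 2 le_rfl)]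
    change M f 0 1 α + M f 1 2 α = 0
    rw [hM01, hM12, add_zero]
  refine ⟨hf.hasDerivAt_wscore α, fun z => (hf.hasDerivAt_scaleScore α z).sub_const _, hcψ, hcχ,
    i3, ?_, E1, ?_, ?_, ?_, ?_, ?_, ?_, ?_, ?_, hf.zeta11_pos, by linarith [hf.zeta22_pos],
    ⟨δ, hδ, h, hint, fun s c l hc hl => ?_⟩⟩
  · refine ((i4.sub (i2.const_mul (2 * K))).add (integrable_const (K ^ 2))).congr
      (Eventually.of_forall fun s => ?_)
    simp only [Pi.add_apply, Pi.sub_apply]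
    ring
  · rw [integral_sub i2 (integrable_const _), E2]
    simp
  · rw [hf.integral_errorLaw, phi1, hM01, zeta11, M]
    simp only [e3]
    simp
  -- The centering constant is `K = M₀₀ + M₁₁ = -2 φ₂`, so subtracting `K²` from the second moment
  -- gives the term `-4 φ₂²`.
  · have : ∀ z, (scaleScore f α z - K) ^ 2 = scaleScore f α z ^ 2
        - (2 * K * scaleScore f α z - K ^ 2) := fun z => by ring
    simp only [this]
    have hB : Integrable (fun z => 2 * K * scaleScore f α z - K ^ 2) (errorLaw f) :=
      (i2.const_mul _).sub (integrable_const _)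
    rw [integral_sub i4 hB, integral_sub (i2.const_mul _) (integrable_const _), integral_const_mul, E2,
      hf.integral_errorLaw, mul_sub, four_mul_zeta22 (I2 2 le_rfl 2 le_rfl)
        (I2 1 (by norm_num) 1 (by norm_num)) (I2 0 (by norm_num) 0 (by norm_num)), phi2, hM11]
    simp only [e4]
    simp
    ring
  · simp only [mul_sub]
    rw [integral_sub i5 (i1.mul_const _), integral_mul_const, E1, hf.integral_errorLaw]
    simp only [e5]
    rw [integral_add (I2 0 (by norm_num) 1 (by norm_num)) (I2 1 (by norm_num) 2 le_rfl)]
    change M f 0 1 (2 * α) + M f 1 2 (2 * α) - 0 * K = 0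
    rw [hM01', hM12']
    ring
  · rw [hf.integral_errorLaw, integral_deriv_mul (hf.hasDerivAt_wscore α) hf.hasDerivAt j1
      (by simpa only [g1] using I 0 (by norm_num) 2 le_rfl)
      (by simpa only [e1] using I 0 (by norm_num) 1 (by norm_num))]
    simp only [g1]
    rfl
  · rw [hf.integral_errorLaw]
    have := integral_deriv_mul (hf.hasDerivAt_wscore α) dsf
      (j2.congr (Eventually.of_forall fun s => by ring))
      (by simp only [g2]; exact k12)
      (by simpa only [g5] using I 1 (by norm_num) 1 (by norm_num))
    simp only [g2, hv12] at this
    rw [← neg_zero, ← this]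
    congr 1; funext s; ring
  · rw [hf.integral_errorLaw, integral_deriv_mul (hf.hasDerivAt_scaleScore α) hf.hasDerivAt j3
      (by simp only [g3]; exact k12)
      (by simp only [e2]; exact (I 0 (by norm_num) 0 (by norm_num)).add
            (I 1 (by norm_num) 1 (by norm_num)))]
    simp only [g3, hv12, neg_zero]
  · rw [hf.integral_errorLaw, four_mul_zeta22 (I 2 le_rfl 2 le_rfl)
        (I 1 (by norm_num) 1 (by norm_num)) (I 0 (by norm_num) 0 (by norm_num))]
    have := integral_deriv_mul (hf.hasDerivAt_scaleScore α) dsf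
      (j4.congr (Eventually.of_forall fun s => by ring))
      (by simp only [g4]; exact hf.integrable_combo)
      (by simp only [g6]; exact (I 1 (by norm_num) 0 (by norm_num)).add
            (I 2 le_rfl 1 (by norm_num)))
    simp only [g4] at this
    rw [← this]
    congr 1; funext s; ring
  · refine le_trans ?_ (hdom s c l hc hl)
    gcongr
    exact le_add_of_nonneg_left (abs_nonneg _)

lemma vBeta_nonneg (hf : IsErrorDensity f α) (hα : 0 ≤ α)
    (hM : ∀ a > 0, M f 0 1 a = 0 ∧ M f 1 2 a = 0) : 0 ≤ vBeta f α := by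
  have h := (hf.isEstimatingPair hα hM).integral_loc_sq
  rw [vBeta, ← h]
  exact div_nonneg (integral_nonneg fun _ => sq_nonneg _) (sq_nonneg _)

lemma vSigma_nonneg (hf : IsErrorDensity f α) (hα : 0 ≤ α)
    (hM : ∀ a > 0, M f 0 1 a = 0 ∧ M f 1 2 a = 0) : 0 ≤ vSigma f α := by
  have h := (hf.isEstimatingPair hα hM).integral_scale_sq
  have h0 : 0 ≤ 4 * (zeta22 f (2 * α) - phi2 f α ^ 2) := by
    rw [← h]
    exact integral_nonneg fun _ => sq_nonneg _
  exact div_nonneg (by linarith) (sq_nonneg _)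

end IsErrorDensity

end

end MDPDE

/-! ### Events of high probability and characteristic functions of sums -/

namespace MDPDE

noncomputable section

section HighProbability

variable {Ω : Type*} [MeasurableSpace Ω] {P : Measure Ω}

/-- `A T` holds with probability tending to one (the events need not be measurable: the outer
measure of the complement tends to zero). -/
def WithHighProb (P : Measure Ω) (A : ℕ → Ω → Prop) : Prop :=
  ∀ ε > 0, ∀ᶠ T in atTop, P.real {ω | ¬A T ω} ≤ ε

namespace WithHighProb

variable [IsProbabilityMeasure P] {A B : ℕ → Ω → Prop}

lemma mono' (hA : WithHighProb P A) (h : ∀ᶠ T in atTop, ∀ ω, A T ω → B T ω) :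
    WithHighProb P B := fun ε hε => by
  filter_upwards [hA ε hε, h] with T hT hAB
  exact (measureReal_mono fun ω hω => mt (hAB ω) hω).trans hT

lemma mono (hA : WithHighProb P A) (h : ∀ T ω, A T ω → B T ω) : WithHighProb P B :=
  hA.mono' (Eventually.of_forall h)

lemma of_forall (h : ∀ T ω, A T ω) : WithHighProb P A := fun ε hε =>
  Eventually.of_forall fun T => by simp [h, hε.le]

/-- This lets auxiliary constants (a bound on the regressors, a radius, a tightness constant) depend
on the probability level: the claim need only be shown on an event `B` of probability close to one.
-/
lemma of_approx (h : ∀ ε > 0, ∃ B : ℕ → Ω → Prop, (∀ᶠ T in atTop, P.real {ω | ¬B T ω} ≤ ε) ∧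
    WithHighProb P fun T ω => B T ω → A T ω) : WithHighProb P A := fun ε hε => by
  obtain ⟨B, hB, hBA⟩ := h (ε / 2) (by positivity)
  filter_upwards [hB, hBA (ε / 2) (by positivity)] with T h1 h2
  have hsub : {ω | ¬A T ω} ⊆ {ω | ¬B T ω} ∪ {ω | ¬(B T ω → A T ω)} := fun ω hω => by
    simp only [Set.mem_union, Set.mem_ofPred_eq] at *
    tauto
  have := (measureReal_mono (μ := P) hsub).trans (measureReal_union_le _ _)
  linarith

lemma and (hA : WithHighProb P A) (hB : WithHighProb P B) :
    WithHighProb P fun T ω => A T ω ∧ B T ω :=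
  of_approx fun ε hε => ⟨A, hA ε hε, hB.mono fun _ _ h h' => ⟨h', h⟩⟩

lemma forall_fintype {ι : Type*} [Finite ι] {A : ι → ℕ → Ω → Prop}
    (h : ∀ i, WithHighProb P (A i)) : WithHighProb P fun T ω => ∀ i, A i T ω := by
  have := Fintype.ofFinite ι
  intro ε hε
  have hc : (0 : ℝ) < Fintype.card ι + 1 := by positivity
  have hall : ∀ᶠ T in atTop, ∀ i, P.real {ω | ¬A i T ω} ≤ ε / (Fintype.card ι + 1) :=
    eventually_all.2 fun i => h i _ (by positivity)
  filter_upwards [hall] with T hT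
  have hsub : {ω | ¬∀ i, A i T ω} ⊆ ⋃ i, {ω | ¬A i T ω} := fun ω hω => by
    simpa using hω
  calc P.real {ω | ¬∀ i, A i T ω} ≤ P.real (⋃ i, {ω | ¬A i T ω}) := measureReal_mono hsub
    _ ≤ ∑ i, P.real {ω | ¬A i T ω} := measureReal_iUnion_fintype_le _
    _ ≤ ∑ _i : ι, ε / (Fintype.card ι + 1) := Finset.sum_le_sum fun i _ => hT i
    _ = Fintype.card ι / (Fintype.card ι + 1) * ε := by simp; ring
    _ ≤ ε := by
      refine mul_le_of_le_one_left hε.le ?_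
      rw [div_le_one hc]; linarith

end WithHighProb

lemma tendstoInMeasure_iff_withHighProb [IsProbabilityMeasure P] {E : Type*}
    [PseudoMetricSpace E] {X : ℕ → Ω → E} {Y : Ω → E} :
    TendstoInMeasure P X atTop Y ↔
      ∀ ε > 0, WithHighProb P fun T ω => dist (X T ω) (Y ω) < ε := by
  rw [tendstoInMeasure_iff_measureReal_dist]
  simp only [WithHighProb, not_lt]
  refine forall₂_congr fun ε _ => ⟨fun h δ hδ => (h.eventually_lt_const hδ).mono fun _ => le_of_lt,
    fun h => ?_⟩
  refine tendsto_order.2 ⟨fun a ha => Eventually.of_forall fun T => ha.trans_le measureReal_nonneg,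
    fun a ha => (h (a / 2) (by positivity)).mono fun T hT => by linarith⟩

/-- Bounded random variables converging in probability to a constant converge in mean. -/
lemma tendsto_integral_of_withHighProb [IsProbabilityMeasure P] {Z : ℕ → Ω → ℂ} {z : ℂ}
    (hZ : ∀ T, AEStronglyMeasurable (Z T) P) (hZ1 : ∀ T ω, ‖Z T ω‖ ≤ 1) (hz : ‖z‖ ≤ 1)
    (h : ∀ ε > 0, WithHighProb P fun T ω => ‖Z T ω - z‖ < ε) :
    Tendsto (fun T => ∫ ω, Z T ω ∂P) atTop (𝓝 z) := by
  rw [Metric.tendsto_nhds]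
  intro ε hε
  -- The integrand differs from `z` by at most 2 on the exceptional event, so the total error is at
  -- most `ε/4 + 2 · ε/8 < ε`.
  filter_upwards [h (ε / 4) (by positivity) (ε / 8) (by positivity)] with T hT
  have hint : Integrable (Z T) P := Integrable.of_bound (hZ T) 1 (Eventually.of_forall (hZ1 T))
  have hmeas : NullMeasurableSet {ω | ¬‖Z T ω - z‖ < ε / 4} P :=
    (nullMeasurableSet_lt (((hZ T).sub aestronglyMeasurable_const).norm.aemeasurable)
      aemeasurable_const).compl
  have hind : Integrable (fun ω => {ω | ¬‖Z T ω - z‖ < ε / 4}.indicator (fun _ => (2 : ℝ)) ω) P :=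
    (integrable_const _).indicator₀ hmeas
  rw [dist_eq_norm]
  calc ‖(∫ ω, Z T ω ∂P) - z‖ = ‖∫ ω, (Z T ω - z) ∂P‖ := by
        rw [integral_sub hint (integrable_const _)]; simp
    _ ≤ ∫ ω, (ε / 4 + {ω | ¬‖Z T ω - z‖ < ε / 4}.indicator (fun _ => (2 : ℝ)) ω) ∂P := by
        refine norm_integral_le_of_norm_le ((integrable_const _).add hind)
          (Eventually.of_forall fun ω => ?_)
        by_cases hω : ‖Z T ω - z‖ < ε / 4
        · simp [hω, hω.le]
        · have h2 : ‖Z T ω - z‖ ≤ 2 := (norm_sub_le _ _).trans (by linarith [hZ1 T ω])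
          simp only [Set.indicator, Set.mem_ofPred_eq, hω, not_false_eq_true, if_true]
          linarith
    _ = ε / 4 + P.real {ω | ¬‖Z T ω - z‖ < ε / 4} * 2 := by
        rw [integral_add (integrable_const _) hind, integral_indicator₀ hmeas]
        simp
    _ < ε := by linarith

end HighProbability

/-- Errors `e_t`, i.i.d. with law `ν` and independent of the regressors `x_t`, which are bounded in
probability and whose averaged second moments converge to `S`. -/
structure IsDesign {Ω : Type*} [MeasurableSpace Ω] (P : Measure Ω) (ν : Measure ℝ) {k : ℕ}
    (e : ℕ → Ω → ℝ) (x : ℕ → Ω → Fin k → ℝ) (S : Matrix (Fin k) (Fin k) ℝ) : Prop where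
  measurable_error : ∀ t, Measurable (e t)
  measurable_regressor : ∀ t, Measurable (x t)
  map_error : ∀ t, P.map (e t) = ν
  iIndepFun_error : iIndepFun e P
  indepFun_regressor : IndepFun (fun ω t => e t ω) (fun ω t => x t ω) P
  bounded : ∀ ε > 0, ∃ C, ∀ᶠ T : ℕ in atTop, P.real {ω | ¬∀ (t : Fin T) j, |x t ω j| ≤ C} ≤ ε
  gram_tendsto : ∀ i j, TendstoInMeasure P
    (fun (T : ℕ) ω => (T : ℝ)⁻¹ * ∑ t : Fin T, x t ω i * x t ω j) atTop (fun _ => S i j)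

/-- Telescoping: the factors are exchanged one at a time and all others have modulus at most one.
With `T` factors, errors `o(1/T)` per factor are negligible. -/
lemma norm_prod_sub_prod_le {ι : Type*} (s : Finset ι) {a b : ι → ℂ} (ha : ∀ i, ‖a i‖ ≤ 1)
    (hb : ∀ i, ‖b i‖ ≤ 1) : ‖∏ i ∈ s, a i - ∏ i ∈ s, b i‖ ≤ ∑ i ∈ s, ‖a i - b i‖ := by
  classical
  induction s using Finset.induction with
  | empty => simp
  | insert i s hi ih =>
    rw [Finset.prod_insert hi, Finset.prod_insert hi, Finset.sum_insert hi]
    have hs : ‖∏ i ∈ s, a i‖ ≤ 1 := by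
      rw [norm_prod]; exact Finset.prod_le_one (fun _ _ => norm_nonneg _) fun i _ => ha i
    calc _ = ‖(a i - b i) * ∏ i ∈ s, a i + b i * (∏ i ∈ s, a i - ∏ i ∈ s, b i)‖ := by
          congr 1; ring
      _ ≤ ‖a i - b i‖ * 1 + 1 * ‖∏ i ∈ s, a i - ∏ i ∈ s, b i‖ := by
          refine (norm_add_le _ _).trans ?_
          rw [norm_mul, norm_mul]
          gcongr
          exact hb i
      _ ≤ _ := by linarith

namespace IsDesign

variable {Ω : Type*} [MeasurableSpace Ω] {P : Measure Ω} [IsProbabilityMeasure P]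
  {ν : Measure ℝ} {k : ℕ} {e : ℕ → Ω → ℝ} {x : ℕ → Ω → Fin k → ℝ}
  {S : Matrix (Fin k) (Fin k) ℝ}

lemma isProbabilityMeasure (hD : IsDesign P ν e x S) : IsProbabilityMeasure ν := by
  rw [← hD.map_error 0]
  exact Measure.isProbabilityMeasure_map (hD.measurable_error 0).aemeasurable

/-- The expectation of a product over `t` is computed by first integrating out the errors. -/
lemma integral_prod_eq (hD : IsDesign P ν e x S) (T : ℕ) {H : ℝ × (Fin k → ℝ) → ℂ}
    (hH : Measurable H) (hH1 : ∀ p, ‖H p‖ ≤ 1) :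
    ∫ ω, ∏ t : Fin T, H (e t ω, x t ω) ∂P = ∫ ω, ∏ t : Fin T, (∫ s, H (s, x t ω) ∂ν) ∂P := by
  have := hD.isProbabilityMeasure
  have hE : Measurable fun ω (t : Fin T) => e t ω :=
    measurable_pi_lambda _ fun t => hD.measurable_error t
  have hX : Measurable fun ω (t : Fin T) => x t ω :=
    measurable_pi_lambda _ fun t => hD.measurable_regressor t
  have hind : IndepFun (fun ω (t : Fin T) => e t ω) (fun ω (t : Fin T) => x t ω) P :=
    hD.indepFun_regressor.comp (φ := fun g (t : Fin T) => g t) (ψ := fun g (t : Fin T) => g t)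
      (measurable_pi_lambda _ fun t => measurable_pi_apply _)
      (measurable_pi_lambda _ fun t => measurable_pi_apply _)
  have hlaw : P.map (fun ω (t : Fin T) => e t ω) = Measure.pi fun _ => ν := by
    rw [(iIndepFun_iff_map_fun_eq_pi_map fun t : Fin T =>
      (hD.measurable_error t).aemeasurable).1 (hD.iIndepFun_error.precomp Fin.val_injective)]
    simp only [hD.map_error]
  have hjoint := (indepFun_iff_map_prod_eq_prod_map_map hE.aemeasurable hX.aemeasurable).1 hind
  rw [hlaw] at hjoint
  have hmX : IsProbabilityMeasure (P.map fun ω (t : Fin T) => x t ω) :=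
    Measure.isProbabilityMeasure_map hX.aemeasurable
  set F : (Fin T → ℝ) × (Fin T → Fin k → ℝ) → ℂ := fun p => ∏ t, H (p.1 t, p.2 t) with hF
  have hFm : Measurable F := Finset.measurable_prod _ fun t _ => hH.comp
    (((measurable_pi_apply t).comp measurable_fst).prodMk
      ((measurable_pi_apply t).comp measurable_snd))
  have hF1 : ∀ p, ‖F p‖ ≤ 1 := fun p => by
    rw [hF, norm_prod]; exact Finset.prod_le_one (fun _ _ => norm_nonneg _) fun i _ => hH1 _
  have hc : Measurable fun v : Fin k → ℝ => ∫ s, H (s, v) ∂ν :=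
    (StronglyMeasurable.integral_prod_left' hH.stronglyMeasurable).measurable
  calc ∫ ω, ∏ t : Fin T, H (e t ω, x t ω) ∂P
      = ∫ p, F p ∂(P.map fun ω => ((fun t : Fin T => e t ω), fun t : Fin T => x t ω)) := by
        rw [integral_map (hE.prodMk hX).aemeasurable hFm.aestronglyMeasurable]
    _ = ∫ v, ∫ u, F (u, v) ∂(Measure.pi fun _ => ν) ∂(P.map fun ω (t : Fin T) => x t ω) := by
        rw [hjoint, integral_prod_symm]
        exact Integrable.of_bound hFm.aestronglyMeasurable 1 (Eventually.of_forall hF1)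
    _ = ∫ v, ∏ t : Fin T, (∫ s, H (s, v t) ∂ν) ∂(P.map fun ω (t : Fin T) => x t ω) := by
        congr 1
        funext v
        exact integral_fintype_prod_eq_prod (fun (t : Fin T) s => H (s, v t))
    _ = _ := by
        rw [integral_map hX.aemeasurable]
        exact (Finset.measurable_prod _ fun t _ =>
          hc.comp (measurable_pi_apply t)).aestronglyMeasurable

/-- Limit of a characteristic function: if `∫ exp (i G_T(s, v)) dν(s)` is `exp (-q_T(v))` up to
`o(1/T)`, uniformly in bounded `v`, and `∑ q_T(x_t) → Q` in probability, then
`E exp (i ∑ G_T(e_t, x_t)) → exp (-Q)`. -/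
lemma tendsto_integral_exp_sum (hD : IsDesign P ν e x S) {G : ℕ → ℝ × (Fin k → ℝ) → ℝ}
    (hG : ∀ T, Measurable (G T)) {q : ℕ → (Fin k → ℝ) → ℝ} (hq0 : ∀ T v, 0 ≤ q T v) {Q : ℝ}
    (hQ : 0 ≤ Q)
    (happ : ∀ C, ∀ ε > 0, ∀ᶠ T : ℕ in atTop, ∀ v : Fin k → ℝ, (∀ j, |v j| ≤ C) →
      ‖(∫ s, Complex.exp (G T (s, v) * Complex.I) ∂ν) - Complex.exp (-(q T v : ℂ))‖ ≤ ε / T)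
    (hq : TendstoInMeasure P (fun (T : ℕ) ω => ∑ t : Fin T, q T (x t ω)) atTop (fun _ => Q)) :
    Tendsto (fun T : ℕ => ∫ ω, Complex.exp ((∑ t : Fin T, G T (e t ω, x t ω) : ℝ) * Complex.I) ∂P)
      atTop (𝓝 (Complex.exp (-(Q : ℂ)))) := by
  have := hD.isProbabilityMeasure
  have hHm : ∀ T, Measurable fun p => Complex.exp (G T p * Complex.I) := fun T =>
    Complex.measurable_exp.comp ((Complex.measurable_ofReal.comp (hG T)).mul_const _)
  have hH1 : ∀ T p, ‖Complex.exp (G T p * Complex.I)‖ ≤ 1 := fun T p => by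
    rw [Complex.norm_exp_ofReal_mul_I]
  have hexp1 : ∀ r : ℝ, 0 ≤ r → ‖Complex.exp (-(r : ℂ))‖ ≤ 1 := fun r hr => by
    rw [Complex.norm_exp]; simpa using hr
  set c : ℕ → (Fin k → ℝ) → ℂ := fun T v => ∫ s, Complex.exp (G T (s, v) * Complex.I) ∂ν
  have hcm : ∀ T, Measurable (c T) := fun T =>
    (StronglyMeasurable.integral_prod_left' (hHm T).stronglyMeasurable).measurable
  have hc1 : ∀ T v, ‖c T v‖ ≤ 1 := fun T v => by
    refine (norm_integral_le_of_norm_le_const (C := 1)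
      (Eventually.of_forall fun s => hH1 T (s, v))).trans ?_
    simp
  have heq : ∀ T : ℕ, ∫ ω, Complex.exp ((∑ t : Fin T, G T (e t ω, x t ω) : ℝ) * Complex.I) ∂P
      = ∫ ω, ∏ t : Fin T, c T (x t ω) ∂P := fun T => by
    rw [← hD.integral_prod_eq T (hHm T) (hH1 T)]
    congr 1
    funext ω
    rw [Complex.ofReal_sum, Finset.sum_mul, Complex.exp_sum]
  simp only [heq]
  have hZm : ∀ T : ℕ, Measurable fun ω => ∏ t : Fin T, c T (x t ω) := fun T =>
    Finset.measurable_prod _ fun t _ => (hcm T).comp (hD.measurable_regressor t)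
  refine tendsto_integral_of_withHighProb (fun T => (hZm T).aestronglyMeasurable)
    (fun T ω => ?_) (hexp1 Q hQ) fun ε hε => ?_
  · rw [norm_prod]; exact Finset.prod_le_one (fun _ _ => norm_nonneg _) fun i _ => hc1 _ _
  have hcA : ContinuousAt (fun r : ℝ => Complex.exp (-(r : ℂ))) Q := by fun_prop
  obtain ⟨δ, hδ, hcont⟩ := Metric.continuousAt_iff.1 hcA (ε / 2) (by positivity)
  refine WithHighProb.of_approx fun ε' hε' => ?_
  obtain ⟨C, hC⟩ := hD.bounded ε' hε'
  refine ⟨fun T ω => ∀ (t : Fin T) j, |x t ω j| ≤ C, hC,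
    (tendstoInMeasure_iff_withHighProb.1 hq δ hδ).mono' ?_⟩
  filter_upwards [happ C (ε / 4) (by positivity), eventually_gt_atTop 0] with T hT hT0 ω hω hb
  have hT0' : (0 : ℝ) < T := by exact_mod_cast hT0
  -- Each of the `T` factors is off by at most `(ε/4)/T`.
  have h1 : ‖∏ t : Fin T, c T (x t ω) - ∏ t : Fin T, Complex.exp (-(q T (x t ω) : ℂ))‖
      ≤ ε / 4 := by
    refine (norm_prod_sub_prod_le _ (fun t => hc1 _ _) fun t => hexp1 _ (hq0 _ _)).trans ?_
    refine (Finset.sum_le_sum fun (t : Fin T) _ => hT (x t ω) (hb t)).trans ?_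
    simp
    field_simp
    rfl
  have h2 := hcont hω
  rw [dist_eq_norm] at h2
  have h3 : ∏ t : Fin T, Complex.exp (-(q T (x t ω) : ℂ))
      = Complex.exp (-((∑ t : Fin T, q T (x t ω) : ℝ) : ℂ)) := by
    rw [← Complex.exp_sum]
    simp
  rw [h3] at h1
  calc _ ≤ _ := norm_sub_le_norm_sub_add_norm_sub _ _ _
    _ < ε := by linarith

end IsDesign

end

end MDPDE

/-! ### Weighted law of large numbers -/

namespace MDPDE

noncomputable section

/-- The remainder is controlled both at the order of the expansion (large `y`) and at the next order
(small `y`). With the minimum of the two, no moment beyond the first is needed here, and none beyond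
the second in the next lemma. -/
lemma norm_exp_mul_I_sub_one_sub_le (y : ℝ) :
    ‖Complex.exp (y * Complex.I) - 1 - y * Complex.I‖ ≤ 3 * |y| * min 1 |y| := by
  have hn : ‖(y * Complex.I : ℂ)‖ = |y| := by simp
  rcases le_total |y| 1 with h | h
  · rw [min_eq_right h]
    refine (Complex.norm_exp_sub_one_sub_id_le (by rwa [hn])).trans ?_
    rw [hn]
    nlinarith [abs_nonneg y]
  · rw [min_eq_left h]
    have h1 := norm_sub_le (Complex.exp (y * Complex.I) - 1) (y * Complex.I)
    have h2 := norm_sub_le (Complex.exp (y * Complex.I)) 1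
    rw [Complex.norm_exp_ofReal_mul_I, norm_one] at h2
    rw [hn] at h1
    linarith

lemma norm_exp_mul_I_sub_taylor_two_le (y : ℝ) :
    ‖Complex.exp (y * Complex.I) - 1 - y * Complex.I + (y ^ 2 / 2 : ℝ)‖
      ≤ 4 * y ^ 2 * min 1 |y| := by
  have hn : ‖(y * Complex.I : ℂ)‖ = |y| := by simp
  rcases le_total |y| 1 with h | h
  · rw [min_eq_right h]
    have hb := Complex.exp_bound (x := y * Complex.I) (by rwa [hn]) (n := 3) (by norm_num)
    rw [hn] at hb
    have heq : Complex.exp (y * Complex.I) - 1 - y * Complex.I + (y ^ 2 / 2 : ℝ)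
        = Complex.exp (y * Complex.I)
          - ∑ m ∈ Finset.range 3, (y * Complex.I) ^ m / (m.factorial : ℂ) := by
      simp [Finset.sum_range_succ, mul_pow, Nat.factorial]
      ring
    rw [heq]
    refine hb.trans ?_
    have : |y| ^ 3 = y ^ 2 * |y| := by rw [pow_succ, sq_abs]
    rw [this]
    norm_num [Nat.factorial]
    nlinarith [mul_nonneg (sq_nonneg y) (abs_nonneg y)]
  · rw [min_eq_left h]
    have h0 := norm_add_le (Complex.exp (y * Complex.I) - 1 - y * Complex.I) ((y ^ 2 / 2 : ℝ) : ℂ)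
    have h1 := norm_sub_le (Complex.exp (y * Complex.I) - 1) (y * Complex.I)
    have h2 := norm_sub_le (Complex.exp (y * Complex.I)) 1
    rw [Complex.norm_exp_ofReal_mul_I, norm_one] at h2
    rw [hn] at h1
    rw [Complex.norm_real, Real.norm_of_nonneg (by positivity : (0 : ℝ) ≤ y ^ 2 / 2)] at h0
    have : |y| ≤ y ^ 2 := by rw [← sq_abs]; nlinarith
    linarith

/-- Truncation: `∫ g min(1, r W) → 0` as `r → 0`. -/
lemma tendsto_integral_mul_min {ν : Measure ℝ} {g W : ℝ → ℝ} (hg : Integrable g ν)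
    (hW : AEStronglyMeasurable W ν) {r : ℕ → ℝ} (hr : Tendsto r atTop (𝓝 0)) :
    Tendsto (fun n => ∫ s, g s * min 1 (|r n * W s|) ∂ν) atTop (𝓝 0) := by
  rw [← integral_zero ℝ ℝ (μ := ν)]
  refine tendsto_integral_of_dominated_convergence (fun s => ‖g s‖) (fun n => ?_) hg.norm
    (fun n => Eventually.of_forall fun s => ?_) (Eventually.of_forall fun s => ?_)
  · exact hg.aestronglyMeasurable.mul (aestronglyMeasurable_const.inf (hW.const_mul _).norm)
  · rw [norm_mul, Real.norm_of_nonneg (le_min zero_le_one (abs_nonneg _))]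
    exact mul_le_of_le_one_right (norm_nonneg _) (min_le_left _ _)
  · have h1 : Tendsto (fun n => |r n * W s|) atTop (𝓝 0) := by
      simpa using (hr.mul_const (W s)).abs
    have h2 : Tendsto (fun n => min 1 |r n * W s|) atTop (𝓝 (min 1 0)) :=
      tendsto_const_nhds.min h1
    simpa using h2.const_mul (g s)

section

variable {Ω : Type*} [MeasurableSpace Ω] {P : Measure Ω} [IsProbabilityMeasure P]

/-- By Lévy's theorem the laws converge to the point mass at zero. The closed set `{ε ≤ |y|}` and
its frontier miss zero, so its probability tends to zero. -/
lemma tendstoInMeasure_zero_of_tendsto_integral_exp {X : ℕ → Ω → ℝ} (hX : ∀ T, AEMeasurable (X T) P)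
    (h : ∀ u : ℝ, Tendsto (fun T => ∫ ω, Complex.exp ((u * X T ω : ℝ) * Complex.I) ∂P) atTop
      (𝓝 1)) : TendstoInMeasure P X atTop (fun _ => (0 : ℝ)) := by
  have hp : ∀ T, IsProbabilityMeasure (P.map (X T)) := fun T =>
    Measure.isProbabilityMeasure_map (hX T)
  have hconv : Tendsto (β := ProbabilityMeasure ℝ) (fun T => ⟨P.map (X T), hp T⟩) atTop
      (𝓝 ⟨Measure.dirac 0, inferInstance⟩) := by
    refine ProbabilityMeasure.tendsto_iff_tendsto_charFun.2 fun u => ?_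
    simp only [ProbabilityMeasure.coe_mk, charFun_dirac]
    refine (h u).congr' (Eventually.of_forall fun T => ?_) |>.trans (by simp)
    rw [charFun_apply_real, integral_map (hX T) (by fun_prop)]
    simp
  rw [tendstoInMeasure_iff_dist]
  intro ε hε
  have hcl : IsClosed {y : ℝ | ε ≤ |y|} := isClosed_le continuous_const continuous_abs
  have h0 : (0 : ℝ) ∉ {y : ℝ | ε ≤ |y|} := by simpa using hε
  have := ProbabilityMeasure.tendsto_measure_of_null_frontier_of_tendsto' hconv
    (E := {y : ℝ | ε ≤ |y|}) (by
      simp only [ProbabilityMeasure.coe_mk]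
      rw [Measure.dirac_apply' _ isClosed_frontier.measurableSet]
      simp only [Set.indicator_apply_eq_zero]
      intro hmem
      exact absurd (hcl.frontier_subset hmem) h0)
  simp only [ProbabilityMeasure.coe_mk] at this
  rw [Measure.dirac_apply' _ hcl.measurableSet, Set.indicator_of_notMem h0] at this
  refine this.congr fun T => ?_
  rw [Measure.map_apply_of_aemeasurable (hX T) hcl.measurableSet]
  simp

/-- Continuous mapping for finitely many sequences converging in probability to constants. -/
lemma tendstoInMeasure_comp_of_continuousAt {ι E : Type*} [Fintype ι] [PseudoMetricSpace E]
    {X : ι → ℕ → Ω → ℝ} {c : ι → ℝ} (hX : ∀ i, TendstoInMeasure P (X i) atTop fun _ => c i)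
    {F : (ι → ℝ) → E} (hF : ContinuousAt F c) :
    TendstoInMeasure P (fun T ω => F fun i => X i T ω) atTop fun _ => F c := by
  rw [tendstoInMeasure_iff_withHighProb]
  intro ε hε
  obtain ⟨δ, hδ, h⟩ := Metric.continuousAt_iff.1 hF ε hε
  refine (WithHighProb.forall_fintype fun i =>
    tendstoInMeasure_iff_withHighProb.1 (hX i) δ hδ).mono fun T ω hω => h ?_
  exact (dist_pi_lt_iff hδ).2 hω

end

namespace IsDesign

variable {Ω : Type*} [MeasurableSpace Ω] {P : Measure Ω} [IsProbabilityMeasure P]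
  {ν : Measure ℝ} {k : ℕ} {e : ℕ → Ω → ℝ} {x : ℕ → Ω → Fin k → ℝ}
  {S : Matrix (Fin k) (Fin k) ℝ}

/-- Weighted law of large numbers for centered errors. -/
lemma tendstoInMeasure_average_of_centered (hD : IsDesign P ν e x S) {g : ℝ → ℝ}
    (hgm : Measurable g) (hg : Integrable g ν) (hg0 : ∫ s, g s ∂ν = 0) {φ : (Fin k → ℝ) → ℝ}
    (hφ : Measurable φ) (hφb : ∀ C, ∃ K, ∀ v : Fin k → ℝ, (∀ j, |v j| ≤ C) → |φ v| ≤ K) :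
    TendstoInMeasure P (fun (T : ℕ) ω => (T : ℝ)⁻¹ * ∑ t : Fin T, g (e t ω) * φ (x t ω)) atTop
      (fun _ => (0 : ℝ)) := by
  have := hD.isProbabilityMeasure
  have hm : ∀ T : ℕ, Measurable fun ω => ∑ t : Fin T, g (e t ω) * φ (x t ω) := fun T =>
    Finset.measurable_sum _ fun t _ => (hgm.comp (hD.measurable_error t)).mul
      (hφ.comp (hD.measurable_regressor t))
  refine tendstoInMeasure_zero_of_tendsto_integral_exp
    (fun T => ((hm T).const_mul _).aemeasurable) fun u => ?_
  -- Here `q = 0`: for centered `g` each factor is `1 + o(1/T)`, by the first-order remainder bound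
  -- and truncation, so first moments suffice.
  have key := hD.tendsto_integral_exp_sum (G := fun T p => u * (T : ℝ)⁻¹ * (g p.1 * φ p.2))
    (fun T => ((hgm.comp measurable_fst).mul (hφ.comp measurable_snd)).const_mul _)
    (q := fun _ _ => 0) (fun _ _ => le_rfl) (Q := 0) le_rfl ?_ ?_
  · simp only [Complex.ofReal_zero, neg_zero, Complex.exp_zero] at key
    refine key.congr fun T => ?_
    congr 1
    funext ω
    rw [← Finset.mul_sum, mul_assoc]
  · intro C ε hε
    obtain ⟨K, hK⟩ := hφb C
    have hr : Tendsto (fun n : ℕ => (|u| * |K|) * ((n : ℝ))⁻¹) atTop (𝓝 0) := by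
      simpa using tendsto_inv_atTop_nhds_zero_nat.const_mul (|u| * |K|)
    have htr := tendsto_integral_mul_min (hg.norm.const_mul (3 * (|u| * |K|)))
      hg.aestronglyMeasurable hr
    filter_upwards [htr.eventually_le_const hε] with T hT v hv
    have hφK : |φ v| ≤ |K| := (hK v hv).trans (le_abs_self K)
    have hint : Integrable (fun s => u * (T : ℝ)⁻¹ * (g s * φ v)) ν :=
      (hg.mul_const _).const_mul _
    have hexp : Integrable (fun s =>
        Complex.exp ((u * (T : ℝ)⁻¹ * (g s * φ v) : ℝ) * Complex.I)) ν := by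
      refine Integrable.of_bound (by fun_prop) 1 (Eventually.of_forall fun s => ?_)
      rw [Complex.norm_exp_ofReal_mul_I]
    have hzero : ∫ s, ((u * (T : ℝ)⁻¹ * (g s * φ v) : ℝ) * Complex.I : ℂ) ∂ν = 0 := by
      rw [integral_mul_const, integral_complex_ofReal, integral_const_mul, integral_mul_const, hg0]
      simp
    have heq : (∫ s, Complex.exp ((u * (T : ℝ)⁻¹ * (g s * φ v) : ℝ) * Complex.I) ∂ν) - 1
        = ∫ s, (Complex.exp ((u * (T : ℝ)⁻¹ * (g s * φ v) : ℝ) * Complex.I) - 1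
          - (u * (T : ℝ)⁻¹ * (g s * φ v) : ℝ) * Complex.I) ∂ν := by
      have hexp' : Integrable (fun s =>
          Complex.exp ((u * (T : ℝ)⁻¹ * (g s * φ v) : ℝ) * Complex.I) - 1) ν :=
        hexp.sub (integrable_const _)
      have hintC : Integrable (fun s =>
          ((u * (T : ℝ)⁻¹ * (g s * φ v) : ℝ) * Complex.I : ℂ)) ν := hint.ofReal.mul_const _
      rw [integral_sub hexp' hintC,
        integral_sub hexp (integrable_const _), hzero]
      simp
    simp only [Complex.ofReal_zero, neg_zero, Complex.exp_zero]
    rw [heq]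
    have hb : ∀ s, |u * (T : ℝ)⁻¹ * (g s * φ v)| ≤ |(|u| * |K|) * ((T : ℝ))⁻¹ * g s| := fun s => by
      have : (0 : ℝ) ≤ (T : ℝ)⁻¹ := by positivity
      simp only [abs_mul, abs_abs, abs_of_nonneg this]
      calc |u| * (T : ℝ)⁻¹ * (|g s| * |φ v|) ≤ |u| * (T : ℝ)⁻¹ * (|g s| * |K|) := by gcongr
        _ = _ := by ring
    calc _ ≤ ∫ s, (T : ℝ)⁻¹ * (3 * (|u| * |K|) * ‖g s‖
            * min 1 |(|u| * |K|) * ((T : ℝ))⁻¹ * g s|) ∂ν := by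
          refine norm_integral_le_of_norm_le (Integrable.const_mul ?_ _)
            (Eventually.of_forall fun s => (norm_exp_mul_I_sub_one_sub_le _).trans ?_)
          · refine (hg.norm.const_mul (3 * (|u| * |K|))).mul_bdd (c := 1)
              (aestronglyMeasurable_const.inf (hg.aestronglyMeasurable.const_mul _).norm)
              (Eventually.of_forall fun s => ?_)
            rw [Real.norm_of_nonneg (le_min zero_le_one (abs_nonneg _))]
            exact min_le_left _ _
          · have h1 : |(|u| * |K|) * ((T : ℝ))⁻¹ * g s| = |u| * |K| * (T : ℝ)⁻¹ * |g s| := by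
              simp [abs_mul]
            calc 3 * |u * (T : ℝ)⁻¹ * (g s * φ v)| * min 1 |u * (T : ℝ)⁻¹ * (g s * φ v)|
                ≤ 3 * |(|u| * |K|) * ((T : ℝ))⁻¹ * g s|
                  * min 1 |(|u| * |K|) * ((T : ℝ))⁻¹ * g s| := by
                  have := hb s
                  gcongr
              _ = _ := by
                  rw [Real.norm_eq_abs, h1]; ring
      _ ≤ ε / T := by
          rw [integral_const_mul, div_eq_inv_mul]
          gcongr
  · simpa using (tendstoInMeasure_iff_withHighProb (P := P)).2
      fun ε hε => WithHighProb.of_forall fun T ω => by simpa using hε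

/-- Weighted law of large numbers. -/
lemma tendstoInMeasure_average (hD : IsDesign P ν e x S) {g : ℝ → ℝ}
    (hgm : Measurable g) (hg : Integrable g ν) {φ : (Fin k → ℝ) → ℝ}
    (hφ : Measurable φ) (hφb : ∀ C, ∃ K, ∀ v : Fin k → ℝ, (∀ j, |v j| ≤ C) → |φ v| ≤ K) {c : ℝ}
    (hc : (∫ s, g s ∂ν) = 0 ∧ c = 0 ∨ ∃ m, TendstoInMeasure P
      (fun (T : ℕ) ω => (T : ℝ)⁻¹ * ∑ t : Fin T, φ (x t ω)) atTop (fun _ => m) ∧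
      c = (∫ s, g s ∂ν) * m) :
    TendstoInMeasure P (fun (T : ℕ) ω => (T : ℝ)⁻¹ * ∑ t : Fin T, g (e t ω) * φ (x t ω)) atTop
      (fun _ => c) := by
  have := hD.isProbabilityMeasure
  -- For centered `g` no limit for the averages of `φ` is needed. Otherwise `g` is split into its
  -- centered part and its mean, and the mean multiplies the limit of these averages.
  rcases hc with ⟨h0, rfl⟩ | ⟨m, hm, rfl⟩
  · exact hD.tendstoInMeasure_average_of_centered hgm hg h0 hφ hφb
  · have h1 := hD.tendstoInMeasure_average_of_centered (g := fun s => g s - ∫ s, g s ∂ν)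
      (hgm.sub_const _) (hg.sub (integrable_const _))
      (by rw [integral_sub hg (integrable_const _)]; simp) hφ hφb
    have h2 := tendstoInMeasure_comp_of_continuousAt (ι := Fin 2)
      (X := ![fun (T : ℕ) ω => (T : ℝ)⁻¹ * ∑ t : Fin T, (g (e t ω) - ∫ s, g s ∂ν) * φ (x t ω),
        fun (T : ℕ) ω => (T : ℝ)⁻¹ * ∑ t : Fin T, φ (x t ω)]) (c := ![0, m])
      (F := fun z => z 0 + (∫ s, g s ∂ν) * z 1) (by
        intro i
        fin_cases i
        · exact h1
        · exact hm) (by fun_prop)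
    simp only [Matrix.cons_val_zero, Matrix.cons_val_one, zero_add] at h2
    refine h2.congr_left fun T => Eventually.of_forall fun ω => ?_
    simp only [sub_mul, Finset.sum_sub_distrib, ← Finset.mul_sum]
    ring

end IsDesign

end

end MDPDE

/-! ### Characteristic function of the normalized scores -/

namespace MDPDE

noncomputable section

/-- The error bound depends on `h` only through the majorant `W`. It is therefore uniform over the
regressor value hidden in `h`. -/
lemma norm_integral_exp_mul_I_sub_le {ν : Measure ℝ} [IsProbabilityMeasure ν] {h : ℝ → ℝ}
    (hm : AEStronglyMeasurable h ν) (h2 : Integrable (fun s => h s ^ 2) ν)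
    (h0 : ∫ s, h s ∂ν = 0) {W : ℝ → ℝ} (hW : AEStronglyMeasurable W ν)
    (hW2 : Integrable (fun s => W s ^ 2) ν) (hhW : ∀ s, |h s| ≤ W s) :
    ‖(∫ s, Complex.exp (h s * Complex.I) ∂ν) - (1 - ((∫ s, h s ^ 2 ∂ν) / 2 : ℝ))‖
      ≤ ∫ s, 4 * W s ^ 2 * min 1 |W s| ∂ν := by
  have hint : Integrable h ν := (memLp_two_iff_integrable_sq hm).2 h2 |>.integrable (by norm_num)
  have hexp : Integrable (fun s => Complex.exp (h s * Complex.I)) ν := by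
    refine Integrable.of_bound ?_ 1 (Eventually.of_forall fun s => ?_)
    · exact Complex.continuous_exp.comp_aestronglyMeasurable
        ((Complex.continuous_ofReal.comp_aestronglyMeasurable hm).mul_const _)
    · rw [Complex.norm_exp_ofReal_mul_I]
  have i1 : Integrable (fun s => Complex.exp (h s * Complex.I) - 1) ν :=
    hexp.sub (integrable_const _)
  have i2 : Integrable (fun s => (h s * Complex.I : ℂ)) ν := hint.ofReal.mul_const _
  have i3 : Integrable (fun s => Complex.exp (h s * Complex.I) - 1 - h s * Complex.I) ν :=
    i1.sub i2
  have i4 : Integrable (fun s => ((h s ^ 2 / 2 : ℝ) : ℂ)) ν := (h2.div_const 2).ofReal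
  have hzero : ∫ s, (h s * Complex.I : ℂ) ∂ν = 0 := by
    rw [integral_mul_const, integral_complex_ofReal, h0]
    simp
  have heq : (∫ s, Complex.exp (h s * Complex.I) ∂ν) - (1 - ((∫ s, h s ^ 2 ∂ν) / 2 : ℝ))
      = ∫ s, (Complex.exp (h s * Complex.I) - 1 - h s * Complex.I + (h s ^ 2 / 2 : ℝ)) ∂ν := by
    rw [integral_add i3 i4, integral_sub i1 i2, integral_sub hexp (integrable_const _), hzero,
      integral_complex_ofReal, integral_div]
    simp
    ring
  rw [heq]
  refine norm_integral_le_of_norm_le ?_ (Eventually.of_forall fun s =>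
    (norm_exp_mul_I_sub_taylor_two_le _).trans ?_)
  · refine (hW2.const_mul 4).mul_bdd (c := 1) (aestronglyMeasurable_const.inf hW.norm)
      (Eventually.of_forall fun s => ?_)
    rw [Real.norm_of_nonneg (le_min zero_le_one (abs_nonneg _))]
    exact min_le_left _ _
  · have h1 : h s ^ 2 ≤ W s ^ 2 := sq_le_sq' (by linarith [(abs_le.1 (hhW s)).1])
      ((le_abs_self _).trans (hhW s))
    have h2 := (hhW s).trans (le_abs_self (W s))
    gcongr

namespace IsDesign

variable {Ω : Type*} [MeasurableSpace Ω] {P : Measure Ω} [IsProbabilityMeasure P]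
  {ν : Measure ℝ} {k : ℕ} {e : ℕ → Ω → ℝ} {x : ℕ → Ω → Fin k → ℝ}
  {S : Matrix (Fin k) (Fin k) ℝ}

/-- Pointwise convergence of the characteristic function of the normalized scores. -/
lemma tendsto_integral_exp_scores (hD : IsDesign P ν e x S) {ψ χ ψ' χ' : ℝ → ℝ} {a d v₁ v₂ : ℝ}
    (hE : IsEstimatingPair ν ψ χ ψ' χ' a d v₁ v₂) (l : Fin k → ℝ) (r : ℝ)
    (hS : 0 ≤ ∑ i, ∑ j, l i * l j * S i j) :
    Tendsto (fun T : ℕ => ∫ ω, Complex.exp ((∑ t : Fin T, (√(T : ℝ))⁻¹ *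
      ((∑ j, l j * x t ω j) * ψ (e t ω) + r * χ (e t ω)) : ℝ) * Complex.I) ∂P) atTop
      (𝓝 (Complex.exp (-(((v₁ * ∑ i, ∑ j, l i * l j * S i j + v₂ * r ^ 2) / 2 : ℝ) : ℂ)))) := by
  have := hD.isProbabilityMeasure
  have hψm : Measurable ψ := (continuous_iff_continuousAt.2 fun z =>
    (hE.hasDerivAt_loc z).continuousAt).measurable
  have hχm : Measurable χ := (continuous_iff_continuousAt.2 fun z =>
    (hE.hasDerivAt_scale z).continuousAt).measurable
  have hv1 : 0 ≤ v₁ := by rw [← hE.integral_loc_sq]; exact integral_nonneg fun _ => sq_nonneg _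
  have hv2 : 0 ≤ v₂ := by rw [← hE.integral_scale_sq]; exact integral_nonneg fun _ => sq_nonneg _
  have hψ2 : MemLp ψ 2 ν := (memLp_two_iff_integrable_sq hψm.aestronglyMeasurable).2
    hE.integrable_loc_sq
  have hχ2 : MemLp χ 2 ν := (memLp_two_iff_integrable_sq hχm.aestronglyMeasurable).2
    hE.integrable_scale_sq
  have hψ1 : Integrable ψ ν := hψ2.integrable (by norm_num)
  have hχ1 : Integrable χ ν := hχ2.integrable (by norm_num)
  have hψχ : Integrable (fun s => ψ s * χ s) ν := hψ2.integrable_mul hχ2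
  have hlm : Measurable fun v : Fin k → ℝ => ∑ j, l j * v j :=
    Finset.measurable_sum _ fun j _ => (measurable_pi_apply j).const_mul _
  refine hD.tendsto_integral_exp_sum
    (G := fun T p => (√(T : ℝ))⁻¹ * ((∑ j, l j * p.2 j) * ψ p.1 + r * χ p.1))
    (q := fun T v => (v₁ * (∑ j, l j * v j) ^ 2 + v₂ * r ^ 2) / (2 * T))
    (fun T => (((hlm.comp measurable_snd).mul (hψm.comp measurable_fst)).add
      ((hχm.comp measurable_fst).const_mul r)).const_mul _) (fun T v => by positivity)
    (by positivity) ?_ ?_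
  · intro C ε hε
    -- One constant dominating both coefficients, `l·v` and `r`, for all regressors bounded by `C`;
    -- `K (|ψ| + |χ|) / √T` is then the uniform majorant.
    set K := (∑ j, |l j| * |C|) + |r| with hK
    have hK0 : 0 ≤ K := by positivity
    set Z : ℝ → ℝ := fun s => |ψ s| + |χ s| with hZ
    have hZm : AEStronglyMeasurable Z ν :=
      (hψm.aestronglyMeasurable.norm.add hχm.aestronglyMeasurable.norm)
    have hZ2 : Integrable (fun s => Z s ^ 2) ν :=
      (memLp_two_iff_integrable_sq hZm).1 (hψ2.norm.add hχ2.norm)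
    set B := (v₁ * K ^ 2 + v₂ * r ^ 2) / 2 with hB
    have hB0 : 0 ≤ B := by positivity
    have hrT : Tendsto (fun n : ℕ => K * (√(n : ℝ))⁻¹) atTop (𝓝 0) := by
      have : Tendsto (fun n : ℕ => (√(n : ℝ))⁻¹) atTop (𝓝 0) :=
        tendsto_inv_atTop_zero.comp (Real.tendsto_sqrt_atTop.comp tendsto_natCast_atTop_atTop)
      simpa using this.const_mul K
    have htr := tendsto_integral_mul_min (hZ2.const_mul (4 * K ^ 2)) hZm hrT
    have hBT : Tendsto (fun n : ℕ => B ^ 2 * (n : ℝ)⁻¹) atTop (𝓝 0) := by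
      simpa using tendsto_inv_atTop_nhds_zero_nat.const_mul (B ^ 2)
    have hBT1 : Tendsto (fun n : ℕ => B * (n : ℝ)⁻¹) atTop (𝓝 0) := by
      simpa using tendsto_inv_atTop_nhds_zero_nat.const_mul B
    filter_upwards [htr.eventually_le_const (half_pos hε), hBT.eventually_le_const (half_pos hε),
      hBT1.eventually_le_const one_pos, eventually_gt_atTop 0] with T hT1 hT2 hT3 hT0 v hv
    have hT0' : (0 : ℝ) < T := by exact_mod_cast hT0
    have hsq : (√(T : ℝ))⁻¹ ^ 2 = (T : ℝ)⁻¹ := by rw [inv_pow, Real.sq_sqrt hT0'.le]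
    set p := ∑ j, l j * v j with hp
    have hpK' : |p| ≤ ∑ j, |l j| * |C| := by
      refine (Finset.abs_sum_le_sum_abs _ _).trans (Finset.sum_le_sum fun j _ => ?_)
      rw [abs_mul]
      exact mul_le_mul_of_nonneg_left ((hv j).trans (le_abs_self _)) (abs_nonneg _)
    have hpK : |p| ≤ K := hpK'.trans (le_add_of_nonneg_right (abs_nonneg _))
    have hrK : |r| ≤ K := le_add_of_nonneg_left (by positivity)
    set h : ℝ → ℝ := fun s => (√(T : ℝ))⁻¹ * (p * ψ s + r * χ s) with hh
    have hhm : Measurable h := ((hψm.const_mul p).add (hχm.const_mul r)).const_mul _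
    have hh2L : MemLp h 2 ν := ((hψ2.const_mul p).add (hχ2.const_mul r)).const_mul _
    have hh2 : Integrable (fun s => h s ^ 2) ν := hh2L.integrable_sq
    have hh0 : ∫ s, h s ∂ν = 0 := by
      rw [hh, integral_const_mul, integral_add (hψ1.const_mul p) (hχ1.const_mul r),
        integral_const_mul, integral_const_mul, hE.integral_loc, hE.integral_scale]
      simp
    have hhv : ∫ s, h s ^ 2 ∂ν = (T : ℝ)⁻¹ * (v₁ * p ^ 2 + v₂ * r ^ 2) := by
      have : ∀ s, h s ^ 2 = (T : ℝ)⁻¹ * (p ^ 2 * ψ s ^ 2 + (r ^ 2 * χ s ^ 2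
          + 2 * p * r * (ψ s * χ s))) := fun s => by
        rw [hh]; simp only [mul_pow, hsq]; ring
      simp only [this]
      have j2 : Integrable (fun s => r ^ 2 * χ s ^ 2 + 2 * p * r * (ψ s * χ s)) ν :=
        (hE.integrable_scale_sq.const_mul _).add (hψχ.const_mul _)
      rw [integral_const_mul, integral_add (hE.integrable_loc_sq.const_mul _) j2,
        integral_add (hE.integrable_scale_sq.const_mul _) (hψχ.const_mul _), integral_const_mul,
        integral_const_mul, integral_const_mul, hE.integral_loc_sq, hE.integral_scale_sq,
        hE.integral_loc_mul_scale]
      ring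
    set W : ℝ → ℝ := fun s => K * (√(T : ℝ))⁻¹ * Z s with hW
    have hhW : ∀ s, |h s| ≤ W s := fun s => by
      have h3 : |p * ψ s + r * χ s| ≤ K * Z s := by
        refine (abs_add_le _ _).trans ?_
        rw [abs_mul, abs_mul, hZ]
        simp only [mul_add]
        gcongr
      rw [hh, hW]
      simp only [abs_mul, abs_of_nonneg (inv_nonneg.2 (Real.sqrt_nonneg (T : ℝ)))]
      calc (√(T : ℝ))⁻¹ * |p * ψ s + r * χ s| ≤ (√(T : ℝ))⁻¹ * (K * Z s) := by gcongr
        _ = _ := by ring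
    have hWm : AEStronglyMeasurable W ν := hZm.const_mul _
    have hW2 : Integrable (fun s => W s ^ 2) ν := by
      simp only [hW, mul_pow]
      exact hZ2.const_mul _
    have hmain := norm_integral_exp_mul_I_sub_le hhm.aestronglyMeasurable hh2 hh0 hWm hW2 hhW
    have hWint : ∫ s, 4 * W s ^ 2 * min 1 |W s| ∂ν ≤ ε / 2 / T := by
      have : ∀ s, 4 * W s ^ 2 * min 1 |W s| = (T : ℝ)⁻¹ * (4 * K ^ 2 * Z s ^ 2
          * min 1 |K * (√(T : ℝ))⁻¹ * Z s|) := fun s => by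
        simp only [hW, mul_pow, hsq]; ring
      simp only [this]
      rw [integral_const_mul, div_eq_inv_mul (ε / 2)]
      gcongr
    set y := (v₁ * p ^ 2 + v₂ * r ^ 2) / (2 * T) with hy
    have hyh : (∫ s, h s ^ 2 ∂ν) / 2 = y := by rw [hhv, hy]; field_simp
    rw [hyh] at hmain
    have hy0 : 0 ≤ y := by positivity
    have hyB : y ≤ B * (T : ℝ)⁻¹ := by
      rw [hy, hB, div_mul_eq_mul_div, mul_comm _ (T : ℝ)⁻¹, ← div_eq_inv_mul, div_div,
        mul_comm (T : ℝ) 2]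
      gcongr 1
      · have := sq_le_sq' (by linarith [(abs_le.1 hpK).1]) ((le_abs_self p).trans hpK)
        gcongr
    -- Since `y ≤ B/T`, replacing `1 - y` by `exp(-y)` costs at most `B²/T²`, which is `o(1/T)`.
    have hexp : ‖Complex.exp (-(y : ℂ)) - (1 - (y : ℝ))‖ ≤ ε / 2 / T := by
      have h4 := Complex.norm_exp_sub_one_sub_id_le (x := -(y : ℂ)) (by
        rw [norm_neg, Complex.norm_real, Real.norm_of_nonneg hy0]; exact hyB.trans hT3)
      rw [norm_neg, Complex.norm_real, Real.norm_of_nonneg hy0] at h4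
      rw [show Complex.exp (-(y : ℂ)) - (1 - (y : ℝ)) = Complex.exp (-(y : ℂ)) - 1 - -(y : ℂ) by
        ring]
      refine h4.trans ?_
      calc y ^ 2 ≤ (B * (T : ℝ)⁻¹) ^ 2 := by gcongr
        _ = B ^ 2 * (T : ℝ)⁻¹ / T := by rw [mul_pow, div_eq_mul_inv]; ring
        _ ≤ _ := by gcongr
    calc _ ≤ _ := norm_sub_le_norm_sub_add_norm_sub _ (1 - (y : ℂ)) _
      _ ≤ ε / 2 / T + ε / 2 / T := by
        rw [norm_sub_rev (1 - (y : ℂ))]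
        exact add_le_add (hmain.trans hWint) hexp
      _ = ε / T := by ring
  -- The sum of the `q_T(x_t)` is half of `v₁ l'(X'X/T) l + v₂ r²`, a continuous function of the
  -- Gram entries.
  · have h := tendstoInMeasure_comp_of_continuousAt (ι := Fin k × Fin k)
      (X := fun i (T : ℕ) ω => (T : ℝ)⁻¹ * ∑ t : Fin T, x t ω i.1 * x t ω i.2)
      (c := fun i => S i.1 i.2) (fun i => hD.gram_tendsto i.1 i.2)
      (F := fun z => (v₁ * ∑ i, ∑ j, l i * l j * z (i, j) + v₂ * r ^ 2) / 2)
      (Continuous.continuousAt (by fun_prop))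
    refine h.congr' ?_ Filter.EventuallyEq.rfl
    filter_upwards [eventually_gt_atTop 0] with T hT0
    refine Eventually.of_forall fun ω => ?_
    have hT0' : (T : ℝ) ≠ 0 := by exact_mod_cast hT0.ne'
    simp only
    rw [← Finset.sum_div, Finset.sum_add_distrib]
    simp only [← Finset.mul_sum, Finset.sum_const, Finset.card_univ, Fintype.card_fin, nsmul_eq_mul]
    have : ∑ i, ∑ j, l i * l j * ((T : ℝ)⁻¹ * ∑ t : Fin T, x t ω i * x t ω j)
        = (T : ℝ)⁻¹ * ∑ t : Fin T, (∑ j, l j * x t ω j) ^ 2 := by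
      have h5 : ∀ t : Fin T, (∑ j, l j * x t ω j) ^ 2
          = ∑ i, ∑ j, l i * l j * (x t ω i * x t ω j) := fun t => by
        rw [sq, Finset.sum_mul_sum]
        exact Finset.sum_congr rfl fun i _ => Finset.sum_congr rfl fun j _ => by ring
      simp only [h5]
      symm
      simp only [Finset.mul_sum]
      rw [Finset.sum_comm]
      refine Finset.sum_congr rfl fun i _ => ?_
      rw [Finset.sum_comm]
      exact Finset.sum_congr rfl fun j _ => Finset.sum_congr rfl fun t _ => by ring
    rw [this]
    field_simp

end IsDesign

end

end MDPDE

/-! ### Central limit theorem for the scores -/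

namespace MDPDE

noncomputable section

namespace IsDesign

variable {Ω : Type*} [MeasurableSpace Ω] {P : Measure Ω} [IsProbabilityMeasure P]
  {ν : Measure ℝ} {k : ℕ} {e : ℕ → Ω → ℝ} {x : ℕ → Ω → Fin k → ℝ}
  {S : Matrix (Fin k) (Fin k) ℝ}

/-- Central limit theorem for the normalized scores. -/
theorem tendstoInDistribution_scores (hD : IsDesign P ν e x S) {ψ χ ψ' χ' : ℝ → ℝ}
    {a d v₁ v₂ : ℝ} (hE : IsEstimatingPair ν ψ χ ψ' χ' a d v₁ v₂) (hS : S.PosDef) (c₁ c₂ : ℝ) :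
    TendstoInDistribution (fun (T : ℕ) ω =>
      (c₁ • WithLp.toLp 2 (S⁻¹.mulVec fun j => (√(T : ℝ))⁻¹ * ∑ t : Fin T, ψ (e t ω) * x t ω j),
        c₂ * ((√(T : ℝ))⁻¹ * ∑ t : Fin T, χ (e t ω)))) atTop id (fun _ => P)
      ((multivariateGaussian 0 ((c₁ ^ 2 * v₁) • S⁻¹)).prod
        (gaussianReal 0 (c₂ ^ 2 * v₂).toNNReal)) := by
  have := hD.isProbabilityMeasure
  have hψm : Measurable ψ := (continuous_iff_continuousAt.2 fun z =>
    (hE.hasDerivAt_loc z).continuousAt).measurable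
  have hχm : Measurable χ := (continuous_iff_continuousAt.2 fun z =>
    (hE.hasDerivAt_scale z).continuousAt).measurable
  have hv1 : 0 ≤ v₁ := by rw [← hE.integral_loc_sq]; exact integral_nonneg fun _ => sq_nonneg _
  have hv2 : 0 ≤ v₂ := by rw [← hE.integral_scale_sq]; exact integral_nonneg fun _ => sq_nonneg _
  set u : ℕ → Ω → Fin k → ℝ := fun T ω j => (√(T : ℝ))⁻¹ * ∑ t : Fin T, ψ (e t ω) * x t ω j
  set v : ℕ → Ω → ℝ := fun T ω => (√(T : ℝ))⁻¹ * ∑ t : Fin T, χ (e t ω) with hv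
  have hum : ∀ T, Measurable (u T) := fun T => measurable_pi_lambda _ fun j => by
    have h : Measurable fun ω => ∑ t : Fin T, ψ (e t ω) * x t ω j :=
      Finset.measurable_sum _ fun t _ => (hψm.comp (hD.measurable_error t)).mul
        ((measurable_pi_apply j).comp (hD.measurable_regressor t))
    exact h.const_mul _
  have hvm : ∀ T, Measurable (v T) := fun T => by
    have h : Measurable fun ω => ∑ t : Fin T, χ (e t ω) :=
      Finset.measurable_sum _ fun t _ => hχm.comp (hD.measurable_error t)
    exact h.const_mul _
  have hSm : Measurable fun w : Fin k → ℝ => S⁻¹.mulVec w :=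
    (Continuous.matrix_mulVec continuous_const continuous_id).measurable
  have hY1 : ∀ T, Measurable fun ω => c₁ • WithLp.toLp 2 (S⁻¹.mulVec (u T ω)) := fun T =>
    ((PiLp.continuous_toLp 2 _).measurable.comp (hSm.comp (hum T))).const_smul c₁
  have hYm : ∀ T, Measurable fun ω => WithLp.toLp 2
      ((c₁ • WithLp.toLp 2 (S⁻¹.mulVec (u T ω)) : EuclideanSpace ℝ (Fin k)), c₂ * v T ω) :=
    fun T => (WithLp.prod_continuous_toLp 2 _ _).measurable.comp
      ((hY1 T).prodMk ((hvm T).const_mul c₂))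
  -- Characteristic functions need an inner product, so the pair is first viewed in the `L²`
  -- product; the identification is undone by continuous mapping.
  have hlim : TendstoInDistribution (fun (T : ℕ) ω => WithLp.toLp 2
      ((c₁ • WithLp.toLp 2 (S⁻¹.mulVec (u T ω)) : EuclideanSpace ℝ (Fin k)), c₂ * v T ω)) atTop
      (WithLp.toLp 2) (fun _ => P) ((multivariateGaussian 0 ((c₁ ^ 2 * v₁) • S⁻¹)).prod
        (gaussianReal 0 (c₂ ^ 2 * v₂).toNNReal)) := by
    refine ⟨fun T => (hYm T).aemeasurable,
      (WithLp.prod_continuous_toLp 2 _ _).measurable.aemeasurable, ?_⟩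
    refine ProbabilityMeasure.tendsto_iff_tendsto_charFun.2 fun t => ?_
    simp only [ProbabilityMeasure.coe_mk]
    rw [charFun_prod, charFun_multivariateGaussian, charFun_gaussianReal, ← Complex.exp_add]
    swap
    · exact hS.inv.posSemidef.smul (by positivity)
    -- With this direction `l`, the frequency paired with `c₁ S⁻¹ u` is `l·u`, and `l' S l = c₁² t₁'
    -- S⁻¹ t₁`. The exponent has no cross term, so the limit is the characteristic function of a
    -- product law.
    set l : Fin k → ℝ := c₁ • S⁻¹.mulVec t.ofLp.1 with hl
    set r : ℝ := c₂ * t.ofLp.2 with hr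
    have hdet : IsUnit S.det := (S.isUnit_iff_isUnit_det).1 hS.isUnit
    have hSl : S.mulVec l = c₁ • (t.ofLp.1 : Fin k → ℝ) := by
      rw [hl, Matrix.mulVec_smul, Matrix.mulVec_mulVec, Matrix.mul_nonsing_inv _ hdet,
        Matrix.one_mulVec]
    have hquad : ∑ i, ∑ j, l i * l j * S i j
        = c₁ ^ 2 * ((t.ofLp.1 : Fin k → ℝ) ⬝ᵥ S⁻¹.mulVec t.ofLp.1) := by
      have h1 : ∑ i, ∑ j, l i * l j * S i j = l ⬝ᵥ S.mulVec l := by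
        simp only [dotProduct, Matrix.mulVec, Finset.mul_sum]
        exact Finset.sum_congr rfl fun i _ => Finset.sum_congr rfl fun j _ => by ring
      rw [h1, hSl, hl, smul_dotProduct, dotProduct_smul, dotProduct_comm]
      simp only [smul_eq_mul]
      ring
    have hquad0 : 0 ≤ ∑ i, ∑ j, l i * l j * S i j := by
      rw [hquad]
      have := hS.inv.posSemidef.dotProduct_mulVec_nonneg (t.ofLp.1 : Fin k → ℝ)
      simp only [star_trivial] at this
      positivity
    have key := hD.tendsto_integral_exp_scores hE l r hquad0
    have hsymm : ∀ w : Fin k → ℝ, S⁻¹.mulVec w ⬝ᵥ t.ofLp.1 = S⁻¹.mulVec t.ofLp.1 ⬝ᵥ w := fun w => by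
      have hT : (S⁻¹).transpose = S⁻¹ := by
        have := hS.inv.isHermitian.eq
        rwa [Matrix.conjTranspose_eq_transpose_of_trivial] at this
      rw [dotProduct_comm, Matrix.dotProduct_mulVec, ← Matrix.mulVec_transpose, hT]
    have hcf : ∀ T : ℕ, charFun (P.map fun ω => WithLp.toLp 2
        ((c₁ • WithLp.toLp 2 (S⁻¹.mulVec (u T ω)) : EuclideanSpace ℝ (Fin k)), c₂ * v T ω)) t
        = ∫ ω, Complex.exp ((∑ t : Fin T, (√(T : ℝ))⁻¹ *
          ((∑ j, l j * x t ω j) * ψ (e t ω) + r * χ (e t ω)) : ℝ) * Complex.I) ∂P := fun T => by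
      rw [charFun_apply, integral_map (hYm T).aemeasurable (by fun_prop)]
      congr 1
      funext ω
      congr 3
      rw [WithLp.prod_inner_apply, real_inner_smul_left, EuclideanSpace.inner_eq_star_dotProduct]
      simp only [star_trivial, RCLike.inner_apply, conj_trivial]
      rw [dotProduct_comm, hsymm, ← Finset.mul_sum, Finset.sum_add_distrib, ← Finset.mul_sum, hr,
        hv]
      have h2 : ∑ t : Fin T, (∑ j, l j * x t ω j) * ψ (e t ω)
          = ∑ j, l j * ∑ t : Fin T, ψ (e t ω) * x t ω j := by
        simp only [Finset.sum_mul, Finset.mul_sum]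
        rw [Finset.sum_comm]
        exact Finset.sum_congr rfl fun j _ => Finset.sum_congr rfl fun t _ => by ring
      rw [h2, hl]
      simp only [dotProduct, u, Pi.smul_apply, smul_eq_mul, Finset.mul_sum, mul_add]
      congr 1
      · exact Finset.sum_congr rfl fun j _ => Finset.sum_congr rfl fun t _ => by ring
      · exact Finset.sum_congr rfl fun t _ => by ring
    simp only [hcf]
    refine key.trans (le_of_eq ?_)
    congr 2
    rw [hquad, hr, Real.coe_toNNReal _ (by positivity), Matrix.smul_mulVec, dotProduct_smul]
    simp
    ring
  exact hlim.continuous_comp (WithLp.prod_continuous_ofLp 2 _ _)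

end IsDesign

end

end MDPDE

/-! ### Maps close to the identity, and oscillation of derivatives -/

namespace MDPDE

noncomputable section

/-- Near `θ₀`, the map `N` differs from the identity by an `ε`-Lipschitz map. -/
def IsNearIdentity {E : Type*} [NormedAddCommGroup E] (N : E → E) (θ₀ : E) (ρ ε : ℝ) : Prop :=
  ∀ θ ∈ Metric.closedBall θ₀ ρ, ∀ θ' ∈ Metric.closedBall θ₀ ρ,
    ‖N θ - N θ' - (θ - θ')‖ ≤ ε * ‖θ - θ'‖

/-- The Newton iteration with approximate inverse derivative. -/
def newtonStep {E : Type*} [NormedAddCommGroup E] (N : E → E) (θ : E) : E := θ - N θ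

/-- Comparing the root with `θ₀` gives `‖(θ - θ₀) + N θ₀‖ ≤ ε ‖θ - θ₀‖`. As `ε ≤ 1/2`, the right
side can be absorbed to bound `‖θ - θ₀‖` first, and then inserted again. -/
lemma IsNearIdentity.norm_root_sub_le {E : Type*} [NormedAddCommGroup E] {N : E → E} {θ₀ : E}
    {ρ ε : ℝ} (h : IsNearIdentity N θ₀ ρ ε) (hρ : 0 ≤ ρ) (hε : ε ≤ 1 / 2) {θ : E}
    (hθ : θ ∈ Metric.closedBall θ₀ ρ) (h0 : N θ = 0) :
    ‖θ - θ₀‖ ≤ 2 * ‖N θ₀‖ ∧ ‖(θ - θ₀) + N θ₀‖ ≤ 2 * ε * ‖N θ₀‖ := by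
  have h1 := h θ hθ θ₀ (Metric.mem_closedBall_self hρ)
  rw [h0, zero_sub, ← norm_neg, neg_sub, sub_neg_eq_add] at h1
  have h2 : ‖θ - θ₀‖ ≤ ‖θ - θ₀ + N θ₀‖ + ‖N θ₀‖ := by
    simpa using norm_sub_le (θ - θ₀ + N θ₀) (N θ₀)
  have h3 := norm_nonneg (θ - θ₀)
  have h4 : ‖θ - θ₀‖ ≤ 2 * ‖N θ₀‖ := by nlinarith
  refine ⟨h4, ?_⟩
  -- A negative `ε` forces `θ = θ₀`, and then `N θ₀ = 0`.
  by_cases hε0 : 0 ≤ ε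
  · nlinarith
  · have h5 : ‖θ - θ₀‖ = 0 := by
      nlinarith [norm_nonneg (θ - θ₀ + N θ₀)]
    have h6 : θ = θ₀ := by rwa [norm_eq_zero, sub_eq_zero] at h5
    rw [← h6, h0]
    simp

/-- The iteration map is Lipschitz with constant `1/2` on the ball, and maps it to itself because
`ρ/2 + ‖N θ₀‖ ≤ ρ`; Banach's fixed point theorem applies, and fixed points are the zeros of `N`. -/
lemma IsNearIdentity.tendsto_iterate {E : Type*} [NormedAddCommGroup E] [CompleteSpace E]
    {N : E → E} {θ₀ : E} {ρ : ℝ} (h : IsNearIdentity N θ₀ ρ (1 / 2)) (hρ : 0 ≤ ρ)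
    (h0 : ‖N θ₀‖ ≤ ρ / 2) : ∃ θ ∈ Metric.closedBall θ₀ ρ, N θ = 0 ∧
      Tendsto (fun n => (newtonStep N)^[n] θ₀) atTop (𝓝 θ) := by
  have hθ₀ := Metric.mem_closedBall_self (x := θ₀) hρ
  have hlip : ∀ θ ∈ Metric.closedBall θ₀ ρ, ∀ θ' ∈ Metric.closedBall θ₀ ρ,
      ‖newtonStep N θ - newtonStep N θ'‖ ≤ 1 / 2 * ‖θ - θ'‖ := fun θ hθ θ' hθ' => by
    refine le_trans (le_of_eq ?_) (h θ hθ θ' hθ')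
    rw [← norm_neg]
    congr 1
    simp only [newtonStep]
    abel
  have hmaps : Set.MapsTo (newtonStep N) (Metric.closedBall θ₀ ρ) (Metric.closedBall θ₀ ρ) :=
    fun θ hθ => by
    have h1 := hlip θ hθ θ₀ hθ₀
    rw [mem_closedBall_iff_norm] at hθ ⊢
    have h2 : ‖newtonStep N θ - θ₀‖ ≤ ‖newtonStep N θ - newtonStep N θ₀‖ + ‖N θ₀‖ := by
      have := norm_sub_le (newtonStep N θ - newtonStep N θ₀) (N θ₀)
      refine le_trans (le_of_eq ?_) this
      congr 1
      simp only [newtonStep]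
      abel
    linarith
  have hcontr : ContractingWith (1 / 2 : NNReal) (hmaps.restrict _ _ _) := by
    refine ⟨by rw [← NNReal.coe_lt_coe]; norm_num, LipschitzWith.of_dist_le_mul fun θ θ' => ?_⟩
    have := hlip θ θ.2 θ' θ'.2
    rw [← dist_eq_norm, ← dist_eq_norm] at this
    simpa [Subtype.dist_eq] using this
  obtain ⟨y, hy, hfix, hlim, -⟩ := hcontr.exists_fixedPoint' Metric.isClosed_closedBall.isComplete
    hmaps hθ₀ (edist_ne_top _ _)
  refine ⟨y, hy, ?_, hlim⟩
  have : y - N y = y := hfix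
  simpa using this

/-- Uniform smallness, in mean, of the oscillation of a derivative near the identity scaling. -/
lemma exists_modulus {ν : Measure ℝ} {g' : ℝ → ℝ} (hg : Continuous g') {δ : ℝ}
    (hδ : 0 < δ) {h : ℝ → ℝ} (hint : Integrable h ν)
    (hdom : ∀ s c l : ℝ, |c| ≤ δ → |l - 1| ≤ δ → (1 + |s|) * |g' (l * s - c)| ≤ h s) {η : ℝ}
    (hη : 0 < η) : ∃ ρ₀ > 0, ∀ ρ, 0 < ρ → ρ ≤ ρ₀ → ∃ W : ℝ → ℝ, Continuous W ∧ (∀ s, 0 ≤ W s) ∧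
      Integrable W ν ∧ ∫ s, W s ∂ν ≤ η ∧ ∀ s c l : ℝ, |c| ≤ ρ → |l - 1| ≤ ρ →
        (1 + |s|) * |g' (l * s - c) - g' s| ≤ W s := by
  set K : ℝ → Set (ℝ × ℝ) := fun ρ => Metric.closedBall (0, 1) ρ with hK
  set F : ℝ → ℝ × ℝ → ℝ := fun s p => |g' (p.2 * s - p.1) - g' s| with hF
  have hFc : Continuous fun q : ℝ × (ℝ × ℝ) => F q.1 q.2 := by
    simp only [hF]
    fun_prop
  have hFs : ∀ s, Continuous (F s) := fun s => by simp only [hF]; fun_prop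
  -- The supremum of the oscillation over a compact set of shifts and scales is continuous in `s`,
  -- so measurability is automatic.
  set m : ℝ → ℝ → ℝ := fun ρ s => sSup (F s '' K ρ) with hm
  have hmem : ∀ {ρ c l : ℝ}, (c, l) ∈ K ρ ↔ |c| ≤ ρ ∧ |l - 1| ≤ ρ := fun {ρ c l} => by
    rw [hK, Metric.mem_closedBall, Prod.dist_eq, max_le_iff, Real.dist_eq, Real.dist_eq, sub_zero]
  have hKc : ∀ ρ, IsCompact (K ρ) := fun ρ => isCompact_closedBall _ _
  have hmc : ∀ ρ, Continuous (m ρ) := fun ρ => (hKc ρ).continuous_sSup hFc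
  have hle : ∀ {ρ s c l : ℝ}, |c| ≤ ρ → |l - 1| ≤ ρ → F s (c, l) ≤ m ρ s := fun {ρ s c l} hc hl =>
    le_csSup ((hKc ρ).bddAbove_image (hFs s).continuousOn) ⟨(c, l), hmem.2 ⟨hc, hl⟩, rfl⟩
  have h0 : ∀ {ρ s : ℝ}, 0 ≤ ρ → 0 ≤ m ρ s := fun {ρ s} hρ =>
    (abs_nonneg _).trans (hle (c := 0) (l := 1) (by simpa using hρ) (by simpa using hρ))
  have hsup : ∀ {ρ s B : ℝ}, 0 ≤ ρ → (∀ c l : ℝ, |c| ≤ ρ → |l - 1| ≤ ρ → F s (c, l) ≤ B) →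
      m ρ s ≤ B := fun {ρ s B} hρ hB => by
    refine csSup_le (Set.Nonempty.image _ ⟨(0, 1), Metric.mem_closedBall_self hρ⟩) ?_
    rintro _ ⟨⟨c, l⟩, hp, rfl⟩
    exact hB c l (hmem.1 hp).1 (hmem.1 hp).2
  have hmono : ∀ {ρ ρ' s : ℝ}, 0 ≤ ρ → ρ ≤ ρ' → m ρ s ≤ m ρ' s := fun {ρ ρ' s} hρ hρ' =>
    hsup hρ fun c l hc hl => hle (hc.trans hρ') (hl.trans hρ')
  have hbound : ∀ {ρ s : ℝ}, 0 ≤ ρ → ρ ≤ δ → (1 + |s|) * m ρ s ≤ 2 * h s := fun {ρ s} hρ hρδ => by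
    have hs : 0 < 1 + |s| := by positivity
    rw [← le_div_iff₀' hs]
    refine hsup hρ fun c l hc hl => ?_
    rw [le_div_iff₀' hs]
    have h1 := hdom s c l (hc.trans hρδ) (hl.trans hρδ)
    have h2 := hdom s 0 1 (by simpa using hδ.le) (by simpa using hδ.le)
    simp only [one_mul, sub_zero] at h2
    have h3 : F s (c, l) ≤ |g' (l * s - c)| + |g' s| := abs_sub _ _
    nlinarith
  -- The oscillation tends to zero pointwise by continuity of `g'` and is dominated by `2 h`. One
  -- member of this sequence then serves as `W` for all smaller radii.
  have hlim : Tendsto (fun n : ℕ => ∫ s, (1 + |s|) * m (min δ (1 / ((n : ℝ) + 1))) s ∂ν) atTop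
      (𝓝 0) := by
    rw [← integral_zero ℝ ℝ (μ := ν)]
    have hmin : ∀ n : ℕ, 0 < min δ (1 / ((n : ℝ) + 1)) := fun n =>
      lt_min hδ Nat.one_div_pos_of_nat
    refine tendsto_integral_of_dominated_convergence (fun s => 2 * h s) (fun n => ?_)
      (hint.const_mul 2) (fun n => Eventually.of_forall fun s => ?_)
      (Eventually.of_forall fun s => ?_)
    · exact ((continuous_const.add continuous_abs).mul (hmc _)).aestronglyMeasurable
    · rw [Real.norm_of_nonneg (mul_nonneg (by positivity) (h0 (hmin n).le))]
      exact hbound (hmin n).le (min_le_left _ _)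
    · rw [← mul_zero (1 + |s|)]
      refine Tendsto.const_mul _ (Metric.tendsto_atTop.2 fun ε hε => ?_)
      have hFa := (hFs s).continuousAt (x := ((0 : ℝ), (1 : ℝ)))
      obtain ⟨r, hr, hr'⟩ := Metric.continuousAt_iff.1 hFa (ε / 2) (by positivity)
      obtain ⟨n₀, hn₀⟩ := exists_nat_one_div_lt hr
      refine ⟨n₀, fun n hn => ?_⟩
      have hmin0 := hmin n
      rw [Real.dist_eq, sub_zero, abs_of_nonneg (h0 (hmin n).le)]
      refine lt_of_le_of_lt (hsup (hmin n).le fun c l hc hl => ?_) (half_lt_self hε)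
      have hnr : 1 / ((n : ℝ) + 1) < r := (Nat.one_div_le_one_div hn).trans_lt hn₀
      have hd : dist (c, l) ((0 : ℝ), (1 : ℝ)) < r := by
        rw [Prod.dist_eq, Real.dist_eq, Real.dist_eq, sub_zero]
        exact max_lt ((hc.trans (min_le_right _ _)).trans_lt hnr)
          ((hl.trans (min_le_right _ _)).trans_lt hnr)
      have := hr' hd
      rw [Real.dist_eq] at this
      have h00 : F s (0, 1) = 0 := by simp [hF]
      rw [h00, sub_zero] at this
      exact (le_abs_self _).trans this.le
  obtain ⟨n, hn⟩ := (hlim.eventually_le_const hη).exists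
  have hmin : 0 < min δ (1 / ((n : ℝ) + 1)) := lt_min hδ Nat.one_div_pos_of_nat
  have hcW : Continuous fun s => (1 + |s|) * m (min δ (1 / ((n : ℝ) + 1))) s :=
    (continuous_const.add continuous_abs).mul (hmc _)
  refine ⟨min δ (1 / ((n : ℝ) + 1)), hmin, fun ρ hρ hρ' =>
    ⟨fun s => (1 + |s|) * m (min δ (1 / ((n : ℝ) + 1))) s, hcW,
      fun s => mul_nonneg (by positivity) (h0 hmin.le),
      (hint.const_mul 2).mono' hcW.aestronglyMeasurable (Eventually.of_forall fun s => ?_), hn,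
      fun s c l hc hl => ?_⟩⟩
  · rw [Real.norm_of_nonneg (mul_nonneg (by positivity) (h0 hmin.le))]
    exact hbound hmin.le (min_le_left _ _)
  · exact mul_le_mul_of_nonneg_left (hle (hc.trans hρ') (hl.trans hρ')) (by positivity)

/-- First-order expansion along a segment of scalings and shifts. -/
lemma abs_sub_sub_deriv_mul_le {g g' : ℝ → ℝ} (hg : ∀ z, HasDerivAt g (g' z) z) {W s ρ : ℝ}
    (hW : ∀ c l : ℝ, |c| ≤ ρ → |l - 1| ≤ ρ → (1 + |s|) * |g' (l * s - c) - g' s| ≤ W)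
    {c l c' l' m : ℝ} (hc : |c| ≤ ρ) (hl : |l - 1| ≤ ρ) (hc' : |c'| ≤ ρ) (hl' : |l' - 1| ≤ ρ)
    (hmc : |c - c'| ≤ m) (hml : |l - l'| ≤ m) :
    |g (l * s - c) - g (l' * s - c') - g' s * ((l - l') * s - (c - c'))| ≤ W * m := by
  set Δ := (l - l') * s - (c - c') with hΔ
  set z : ℝ → ℝ := fun τ => (l' + τ * (l - l')) * s - (c' + τ * (c - c')) with hz
  have hzd : ∀ τ, HasDerivAt z Δ τ := fun τ => by
    have h1 : HasDerivAt (fun τ : ℝ => (l' * s - c') + τ * Δ) Δ τ := by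
      simpa using ((hasDerivAt_id τ).mul_const Δ).const_add (l' * s - c')
    convert h1 using 1
    funext τ
    simp only [hz, hΔ]
    ring
  have hΔm : |Δ| ≤ (1 + |s|) * m := by
    have h1 : |Δ| ≤ |l - l'| * |s| + |c - c'| := by
      rw [hΔ, ← abs_mul]; exact abs_sub _ _
    nlinarith [abs_nonneg s]
  have hm : 0 ≤ m := (abs_nonneg _).trans hmc
  -- Mean value inequality for `g` minus its linear part with slope `g' s`; by convexity the whole
  -- segment keeps shift and scale within `ρ`.
  have key := norm_image_sub_le_of_norm_deriv_le_segment_01'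
    (f := fun τ => g (z τ) - g' s * z τ) (f' := fun τ => g' (z τ) * Δ - g' s * Δ) (C := W * m)
    (fun τ _ => (((hg (z τ)).comp τ (hzd τ)).sub ((hzd τ).const_mul (g' s))).hasDerivWithinAt)
    (fun τ hτ => by
      have b1 : |c' + τ * (c - c')| ≤ ρ := by
        rw [abs_le] at *
        constructor <;> nlinarith [hτ.1, hτ.2]
      have b2 : |l' + τ * (l - l') - 1| ≤ ρ := by
        rw [abs_le] at *
        constructor <;> nlinarith [hτ.1, hτ.2]
      have b3 := hW _ _ b1 b2
      rw [← sub_mul, norm_mul, Real.norm_eq_abs, Real.norm_eq_abs]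
      calc |g' (z τ) - g' s| * |Δ| ≤ |g' (z τ) - g' s| * ((1 + |s|) * m) := by gcongr
        _ = ((1 + |s|) * |g' (z τ) - g' s|) * m := by ring
        _ ≤ W * m := by gcongr)
  rw [Real.norm_eq_abs] at key
  refine le_trans (le_of_eq ?_) key
  congr 1
  have e1 : z 1 = l * s - c := by simp only [hz]; ring
  have e0 : z 0 = l' * s - c' := by simp only [hz]; ring
  rw [e1, e0, hΔ]
  ring

end

end MDPDE

/-! ### The averaged scores in linear coordinates -/

namespace MDPDE

noncomputable section

/-- The standardized residual as a linear function of the reparametrization `(κ, l)`. -/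
def linResidual {k : ℕ} (p : ℝ × (Fin k → ℝ)) (θ : (Fin k → ℝ) × ℝ) : ℝ :=
  θ.2 * p.1 - ∑ j, θ.1 j * p.2 j

/-- The average scores, premultiplied with the inverse of their limiting derivative. -/
def scaledScore (ψ χ : ℝ → ℝ) {k : ℕ} (S : Matrix (Fin k) (Fin k) ℝ) (a d : ℝ) {T : ℕ}
    (D : Fin T → ℝ × (Fin k → ℝ)) (θ : (Fin k → ℝ) × ℝ) : (Fin k → ℝ) × ℝ :=
  (a⁻¹ • S⁻¹.mulVec (fun j => (T : ℝ)⁻¹ * ∑ t, ψ (linResidual (D t) θ) * (D t).2 j),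
    -(d⁻¹ * ((T : ℝ)⁻¹ * ∑ t, χ (linResidual (D t) θ))))

variable {k : ℕ}

/-- The increment of an average is its linearization at the errors plus a remainder. The remainder
is bounded by the average of `W`, giving `C₁ (kC + 1) η`; replacing the averaged derivatives by `s₀`
and `s i` costs the terms `1` and `k`. The radius `ρ/(kC + 1)` keeps each shift `κ' x_t` within `ρ`.
The weight `w` is a regressor or the constant one. -/
lemma abs_average_sub_le {g g' : ℝ → ℝ} (hg : ∀ z, HasDerivAt g (g' z) z) {W : ℝ → ℝ}
    {C C₁ η ρ : ℝ} (hC : 0 ≤ C) (hC₁ : 0 ≤ C₁) (hW0 : ∀ s, 0 ≤ W s)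
    (hW : ∀ s c l : ℝ, |c| ≤ ρ → |l - 1| ≤ ρ → (1 + |s|) * |g' (l * s - c) - g' s| ≤ W s)
    {T : ℕ} {D : Fin T → ℝ × (Fin k → ℝ)} (hx : ∀ t j, |(D t).2 j| ≤ C) {w : Fin T → ℝ}
    (hw : ∀ t, |w t| ≤ C₁) (hWη : (T : ℝ)⁻¹ * ∑ t, W (D t).1 ≤ η) {s₀ : ℝ} {s : Fin k → ℝ}
    (h0 : |(T : ℝ)⁻¹ * ∑ t, g' (D t).1 * w t * (D t).1 - s₀| ≤ η)
    (h1 : ∀ i, |(T : ℝ)⁻¹ * ∑ t, g' (D t).1 * w t * (D t).2 i - s i| ≤ η)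
    {θ θ' : (Fin k → ℝ) × ℝ} (hθ : θ ∈ Metric.closedBall (0, 1) (ρ / (k * C + 1)))
    (hθ' : θ' ∈ Metric.closedBall (0, 1) (ρ / (k * C + 1))) :
    |(T : ℝ)⁻¹ * ∑ t, g (linResidual (D t) θ) * w t
      - (T : ℝ)⁻¹ * ∑ t, g (linResidual (D t) θ') * w t
      - (s₀ * (θ.2 - θ'.2) - ∑ i, s i * (θ.1 i - θ'.1 i))|
      ≤ (1 + k + C₁ * (k * C + 1)) * η * ‖θ - θ'‖ := by
  set n := ‖θ - θ'‖ with hn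
  have hn0 : 0 ≤ n := norm_nonneg _
  have hkC : 0 < k * C + 1 := by positivity
  have hT0 : (0 : ℝ) ≤ (T : ℝ)⁻¹ := by positivity
  have hρ : 0 ≤ ρ := by
    have := dist_nonneg.trans (Metric.mem_closedBall.1 hθ)
    by_contra h
    exact absurd this (not_le.2 (div_neg_of_neg_of_pos (not_le.1 h) hkC))
  have hlin : ∀ κ : Fin k → ℝ, ∀ B : ℝ, 0 ≤ B → (∀ i, |κ i| ≤ B) → ∀ t,
      |∑ i, κ i * (D t).2 i| ≤ k * C * B := fun κ B hB hκ t => by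
    calc |∑ i, κ i * (D t).2 i| ≤ ∑ i, |κ i * (D t).2 i| := Finset.abs_sum_le_sum_abs _ _
      _ ≤ ∑ _i : Fin k, B * C := Finset.sum_le_sum fun i _ => by
          rw [abs_mul]; exact mul_le_mul (hκ i) (hx t i) (abs_nonneg _) hB
      _ = k * C * B := by simp; ring
  have hdiv : ρ / (k * C + 1) ≤ ρ := div_le_self hρ (by nlinarith [show 0 ≤ k * C by positivity])
  have hdiv0 : 0 ≤ ρ / (k * C + 1) := by positivity
  have hball : ∀ ϑ : (Fin k → ℝ) × ℝ, ϑ ∈ Metric.closedBall (0, 1) (ρ / (k * C + 1)) →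
      (∀ t, |∑ i, ϑ.1 i * (D t).2 i| ≤ ρ) ∧ |ϑ.2 - 1| ≤ ρ := fun ϑ hϑ => by
    rw [Metric.mem_closedBall, Prod.dist_eq, max_le_iff, dist_zero_right, Real.dist_eq] at hϑ
    refine ⟨fun t => (hlin ϑ.1 _ hdiv0 (fun i => (norm_le_pi_norm ϑ.1 i).trans hϑ.1) t).trans ?_,
      hϑ.2.trans hdiv⟩
    rw [← mul_div_assoc, div_le_iff₀ hkC]
    nlinarith
  obtain ⟨hc, hl⟩ := hball θ hθ
  obtain ⟨hc', hl'⟩ := hball θ' hθ'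
  have hΔ1 : ∀ i, |θ.1 i - θ'.1 i| ≤ n := fun i =>
    (norm_le_pi_norm (θ - θ').1 i).trans (norm_fst_le (θ - θ'))
  have hΔ2 : |θ.2 - θ'.2| ≤ n := norm_snd_le (θ - θ')
  set m := (k * C + 1) * n with hm
  have hterm : ∀ t, |g (linResidual (D t) θ) - g (linResidual (D t) θ') - g' (D t).1 *
      ((θ.2 - θ'.2) * (D t).1 - ∑ i, (θ.1 i - θ'.1 i) * (D t).2 i)| ≤ W (D t).1 * m := fun t => by
    have hsub : ∑ i, (θ.1 i - θ'.1 i) * (D t).2 i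
        = ∑ i, θ.1 i * (D t).2 i - ∑ i, θ'.1 i * (D t).2 i := by
      rw [← Finset.sum_sub_distrib]
      exact Finset.sum_congr rfl fun i _ => by ring
    have hcm : |∑ i, θ.1 i * (D t).2 i - ∑ i, θ'.1 i * (D t).2 i| ≤ m := by
      rw [← hsub]
      refine (hlin (fun i => θ.1 i - θ'.1 i) n hn0 hΔ1 t).trans ?_
      rw [hm]; nlinarith
    rw [hsub]
    exact abs_sub_sub_deriv_mul_le hg (hW (D t).1) (hc t) hl (hc' t) hl' hcm
      (hΔ2.trans (by rw [hm]; nlinarith [show 0 ≤ k * C * n by positivity]))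
  set R := (T : ℝ)⁻¹ * ∑ t, (g (linResidual (D t) θ) - g (linResidual (D t) θ') - g' (D t).1 *
      ((θ.2 - θ'.2) * (D t).1 - ∑ i, (θ.1 i - θ'.1 i) * (D t).2 i)) * w t with hR
  have hRb : |R| ≤ C₁ * (k * C + 1) * η * n := by
    rw [hR, abs_mul, abs_of_nonneg hT0]
    calc (T : ℝ)⁻¹ * |∑ t, (g (linResidual (D t) θ) - g (linResidual (D t) θ') - g' (D t).1 *
          ((θ.2 - θ'.2) * (D t).1 - ∑ i, (θ.1 i - θ'.1 i) * (D t).2 i)) * w t|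
        ≤ (T : ℝ)⁻¹ * ∑ t, W (D t).1 * m * C₁ := by
          refine mul_le_mul_of_nonneg_left ((Finset.abs_sum_le_sum_abs _ _).trans
            (Finset.sum_le_sum fun t _ => ?_)) hT0
          rw [abs_mul]
          exact mul_le_mul (hterm t) (hw t) (abs_nonneg _)
            (mul_nonneg (hW0 _) (by positivity))
      _ = ((T : ℝ)⁻¹ * ∑ t, W (D t).1) * (m * C₁) := by
          rw [mul_assoc, Finset.sum_mul]
          congr 1
          exact Finset.sum_congr rfl fun t _ => by ring
      _ ≤ η * (m * C₁) := mul_le_mul_of_nonneg_right hWη (by positivity)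
      _ = _ := by rw [hm]; ring
  have hident : (T : ℝ)⁻¹ * ∑ t, g (linResidual (D t) θ) * w t
      - (T : ℝ)⁻¹ * ∑ t, g (linResidual (D t) θ') * w t
      - (s₀ * (θ.2 - θ'.2) - ∑ i, s i * (θ.1 i - θ'.1 i))
      = R + (((T : ℝ)⁻¹ * ∑ t, g' (D t).1 * w t * (D t).1 - s₀) * (θ.2 - θ'.2)
        - ∑ i, ((T : ℝ)⁻¹ * ∑ t, g' (D t).1 * w t * (D t).2 i - s i) * (θ.1 i - θ'.1 i)) := by
    have e0 : ∀ Δ : Fin k → ℝ,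
        ∑ i, ((T : ℝ)⁻¹ * ∑ t, g' (D t).1 * w t * (D t).2 i - s i) * Δ i
        = (T : ℝ)⁻¹ * ∑ t, g' (D t).1 * w t * (∑ i, Δ i * (D t).2 i)
          - ∑ i, s i * Δ i := fun Δ => by
      simp only [sub_mul, Finset.sum_sub_distrib, Finset.mul_sum, Finset.sum_mul]
      rw [Finset.sum_comm]
      congr 1
      exact Finset.sum_congr rfl fun t _ => Finset.sum_congr rfl fun i _ => by ring
    have e1 := e0 fun i => θ.1 i - θ'.1 i
    have e2 : R = (T : ℝ)⁻¹ * ∑ t, g (linResidual (D t) θ) * w t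
        - (T : ℝ)⁻¹ * ∑ t, g (linResidual (D t) θ') * w t
        - (((T : ℝ)⁻¹ * ∑ t, g' (D t).1 * w t * (D t).1) * (θ.2 - θ'.2)
        - (T : ℝ)⁻¹ * ∑ t, g' (D t).1 * w t * (∑ i, (θ.1 i - θ'.1 i) * (D t).2 i)) := by
      rw [hR, mul_assoc _ _ (θ.2 - θ'.2), Finset.sum_mul, ← mul_sub, ← mul_sub, ← mul_sub,
        ← Finset.sum_sub_distrib, ← Finset.sum_sub_distrib, ← Finset.sum_sub_distrib]
      congr 1
      exact Finset.sum_congr rfl fun t _ => by ring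
    rw [e1, e2]
    ring
  have hη : 0 ≤ η := (abs_nonneg _).trans h0
  rw [hident]
  calc _ ≤ |R| + (|((T : ℝ)⁻¹ * ∑ t, g' (D t).1 * w t * (D t).1 - s₀) * (θ.2 - θ'.2)|
        + |∑ i, ((T : ℝ)⁻¹ * ∑ t, g' (D t).1 * w t * (D t).2 i - s i) * (θ.1 i - θ'.1 i)|) :=
        (abs_add_le _ _).trans (add_le_add_right (abs_sub _ _) _)
    _ ≤ C₁ * (k * C + 1) * η * n + (η * n + ∑ _i : Fin k, η * n) := by
        refine add_le_add hRb (add_le_add ?_ ((Finset.abs_sum_le_sum_abs _ _).trans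
          (Finset.sum_le_sum fun i _ => ?_)))
        · rw [abs_mul]; exact mul_le_mul h0 hΔ2 (abs_nonneg _) hη
        · rw [abs_mul]; exact mul_le_mul (h1 i) (hΔ1 i) (abs_nonneg _) hη
    _ = _ := by simp; ring

lemma norm_mulVec_le (A : Matrix (Fin k) (Fin k) ℝ) {v : Fin k → ℝ} {B : ℝ} (hB : 0 ≤ B)
    (hv : ∀ j, |v j| ≤ B) : ‖A.mulVec v‖ ≤ (∑ i, ∑ j, |A i j|) * B := by
  have hnn : ∀ i, 0 ≤ ∑ j, |A i j| := fun i => Finset.sum_nonneg fun j _ => abs_nonneg _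
  refine (pi_norm_le_iff_of_nonneg (mul_nonneg (Finset.sum_nonneg fun i _ => hnn i) hB)).2
    fun i => ?_
  calc |∑ j, A i j * v j| ≤ ∑ j, |A i j * v j| := Finset.abs_sum_le_sum_abs _ _
    _ ≤ ∑ j, |A i j| * B := Finset.sum_le_sum fun j _ => by
        rw [abs_mul]; exact mul_le_mul_of_nonneg_left (hv j) (abs_nonneg _)
    _ = (∑ j, |A i j|) * B := by rw [Finset.sum_mul]
    _ ≤ _ := mul_le_mul_of_nonneg_right
        (Finset.single_le_sum (f := fun i => ∑ j, |A i j|) (fun i _ => hnn i)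
          (Finset.mem_univ i)) hB

/-- The limiting derivative of the averaged scores is block diagonal: the location score responds to
`κ` with `-(E ψ') S = a S`, the scale score responds to `l` with `E zχ' = -d`. Inverting it explains
the factors `a⁻¹ S⁻¹` and `-d⁻¹`; the remaining error is amplified by the size of this inverse. -/
lemma isNearIdentity_scaledScore {ψ χ ψ' χ' : ℝ → ℝ} (hψ : ∀ z, HasDerivAt ψ (ψ' z) z)
    (hχ : ∀ z, HasDerivAt χ (χ' z) z) {S : Matrix (Fin k) (Fin k) ℝ} (hS : IsUnit S.det)
    {a d : ℝ} (ha : 0 < a) (hd : 0 < d) {W V : ℝ → ℝ} {C η ρ : ℝ} (hC : 1 ≤ C)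
    (hW0 : ∀ s, 0 ≤ W s) (hV0 : ∀ s, 0 ≤ V s)
    (hW : ∀ s c l : ℝ, |c| ≤ ρ → |l - 1| ≤ ρ → (1 + |s|) * |ψ' (l * s - c) - ψ' s| ≤ W s)
    (hV : ∀ s c l : ℝ, |c| ≤ ρ → |l - 1| ≤ ρ → (1 + |s|) * |χ' (l * s - c) - χ' s| ≤ V s)
    {T : ℕ} {D : Fin T → ℝ × (Fin k → ℝ)} (hx : ∀ t j, |(D t).2 j| ≤ C)
    (hWη : (T : ℝ)⁻¹ * ∑ t, W (D t).1 ≤ η) (hVη : (T : ℝ)⁻¹ * ∑ t, V (D t).1 ≤ η)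
    (h1 : ∀ j, |(T : ℝ)⁻¹ * ∑ t, ψ' (D t).1 * (D t).2 j * (D t).1| ≤ η)
    (h2 : ∀ j i, |(T : ℝ)⁻¹ * ∑ t, ψ' (D t).1 * (D t).2 j * (D t).2 i + a * S j i| ≤ η)
    (h3 : |(T : ℝ)⁻¹ * ∑ t, χ' (D t).1 * (D t).1 + d| ≤ η)
    (h4 : ∀ i, |(T : ℝ)⁻¹ * ∑ t, χ' (D t).1 * (D t).2 i| ≤ η) :
    IsNearIdentity (scaledScore ψ χ S a d D) (0, 1) (ρ / (k * C + 1))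
      ((a⁻¹ * (∑ i, ∑ j, |S⁻¹ i j|) + d⁻¹) * ((1 + k + C * (k * C + 1)) * η)) := by
  intro θ hθ θ' hθ'
  have hη : 0 ≤ η := (abs_nonneg _).trans h3
  have hC0 : 0 ≤ C := by linarith
  set Q := (1 + k + C * (k * C + 1)) * η * ‖θ - θ'‖ with hQ
  have hQ0 : 0 ≤ Q := by positivity
  set u : (Fin k → ℝ) × ℝ → Fin k → ℝ := fun ϑ j =>
    (T : ℝ)⁻¹ * ∑ t, ψ (linResidual (D t) ϑ) * (D t).2 j with hu
  have b1 : ∀ j, |u θ j - u θ' j - a * S.mulVec (θ - θ').1 j| ≤ Q := fun j => by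
    have := abs_average_sub_le hψ hC0 hC0 hW0 hW hx (fun t => hx t j) hWη (s₀ := 0)
      (s := fun i => -(a * S j i)) (by simpa using h1 j)
      (fun i => by simpa using h2 j i) hθ hθ'
    refine le_trans (le_of_eq ?_) this
    congr 1
    simp only [hu, Matrix.mulVec, dotProduct, Finset.mul_sum, Prod.fst_sub, Pi.sub_apply,
      zero_mul, zero_sub, neg_mul, Finset.sum_neg_distrib, neg_neg]
    congr 1
    exact Finset.sum_congr rfl fun i _ => by ring
  have b2 : |(T : ℝ)⁻¹ * ∑ t, χ (linResidual (D t) θ) - (T : ℝ)⁻¹ * ∑ t, χ (linResidual (D t) θ')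
      + d * (θ.2 - θ'.2)| ≤ Q := by
    have := abs_average_sub_le hχ hC0 zero_le_one hV0 hV hx (w := fun _ => 1) (by simp) hVη
      (s₀ := -d) (s := fun _ => 0) (by simpa using h3) (fun i => by simpa using h4 i) hθ hθ'
    refine le_trans (le_of_eq ?_) (this.trans ?_)
    · congr 1
      simp
    · rw [hQ]
      gcongr
  have hSS : S⁻¹.mulVec (S.mulVec (θ - θ').1) = (θ - θ').1 := by
    rw [Matrix.mulVec_mulVec, Matrix.nonsing_inv_mul _ hS, Matrix.one_mulVec]
  have e1 : (scaledScore ψ χ S a d D θ - scaledScore ψ χ S a d D θ' - (θ - θ')).1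
      = a⁻¹ • S⁻¹.mulVec (fun j => u θ j - u θ' j - a * S.mulVec (θ - θ').1 j) := by
    have : (fun j => u θ j - u θ' j - a * S.mulVec (θ - θ').1 j)
        = u θ - u θ' - a • S.mulVec (θ - θ').1 := rfl
    rw [this, Matrix.mulVec_sub, Matrix.mulVec_sub, Matrix.mulVec_smul, hSS, smul_sub, smul_sub,
      smul_smul, inv_mul_cancel₀ ha.ne', one_smul]
    rfl
  have e2 : (scaledScore ψ χ S a d D θ - scaledScore ψ χ S a d D θ' - (θ - θ')).2
      = -(d⁻¹ * ((T : ℝ)⁻¹ * ∑ t, χ (linResidual (D t) θ)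
        - (T : ℝ)⁻¹ * ∑ t, χ (linResidual (D t) θ') + d * (θ.2 - θ'.2))) := by
    simp only [scaledScore, Prod.snd_sub]
    field_simp
    ring
  rw [Prod.norm_def, e1, e2]
  refine (max_le (c := (a⁻¹ * (∑ i, ∑ j, |S⁻¹ i j|) + d⁻¹) * Q) ?_ ?_).trans (le_of_eq ?_)
  · rw [norm_smul, Real.norm_of_nonneg (inv_nonneg.2 ha.le)]
    have := mul_le_mul_of_nonneg_left (norm_mulVec_le S⁻¹ hQ0 b1) (inv_nonneg.2 ha.le)
    refine this.trans ?_
    have : 0 ≤ d⁻¹ * Q := by positivity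
    linarith
  · rw [norm_neg, norm_mul, Real.norm_of_nonneg (inv_nonneg.2 hd.le), Real.norm_eq_abs]
    have := mul_le_mul_of_nonneg_left b2 (inv_nonneg.2 hd.le)
    refine this.trans ?_
    have : 0 ≤ a⁻¹ * (∑ i, ∑ j, |S⁻¹ i j|) * Q := by positivity
    linarith
  · rw [hQ]; ring

end

end MDPDE

/-! ### Near-identity of the scaled score with probability close to one -/

namespace MDPDE

noncomputable section

variable {Ω : Type*} [MeasurableSpace Ω] {P : Measure Ω} [IsProbabilityMeasure P] {k : ℕ}
  {ν : Measure ℝ} {e : ℕ → Ω → ℝ} {x : ℕ → Ω → Fin k → ℝ} {S : Matrix (Fin k) (Fin k) ℝ}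

/-- The first `T` errors and regressors. -/
def errorSample (e : ℕ → Ω → ℝ) (x : ℕ → Ω → Fin k → ℝ) (T : ℕ) (ω : Ω) :
    Fin T → ℝ × (Fin k → ℝ) := fun t => (e t ω, x t ω)

lemma IsNearIdentity.mono {E : Type*} [NormedAddCommGroup E] {N : E → E} {θ₀ : E} {ρ ε ε' : ℝ}
    (h : IsNearIdentity N θ₀ ρ ε) (hε : ε ≤ ε') : IsNearIdentity N θ₀ ρ ε' :=
  fun θ hθ θ' hθ' => (h θ hθ θ' hθ').trans (mul_le_mul_of_nonneg_right hε (norm_nonneg _))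

lemma tendstoInMeasure_average_one :
    TendstoInMeasure P (fun (T : ℕ) (_ : Ω) => (T : ℝ)⁻¹ * ∑ _t : Fin T, (1 : ℝ)) atTop
      (fun _ => 1) := by
  rw [tendstoInMeasure_iff_withHighProb]
  intro ε hε
  refine (WithHighProb.of_forall (A := fun _ _ => True) fun _ _ => trivial).mono' ?_
  filter_upwards [eventually_gt_atTop 0] with T hT ω _
  have : (T : ℝ) ≠ 0 := by positivity
  simpa [this] using hε

lemma WithHighProb.eventually_measureReal_le {A B G : ℕ → Ω → Prop} (hG : WithHighProb P G)
    {δ δ' : ℝ} (hB : ∀ᶠ T in atTop, P.real {ω | ¬B T ω} ≤ δ') (hδ : δ' < δ)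
    (h : ∀ T ω, B T ω → G T ω → A T ω) : ∀ᶠ T in atTop, P.real {ω | ¬A T ω} ≤ δ := by
  filter_upwards [hB, hG (δ - δ') (by linarith)] with T h1 h2
  have hsub : {ω | ¬A T ω} ⊆ {ω | ¬B T ω} ∪ {ω | ¬G T ω} := fun ω hω => by
    have := h T ω
    simp only [Set.mem_union, Set.mem_ofPred_eq] at *
    tauto
  have := (measureReal_mono (μ := P) hsub).trans (measureReal_union_le _ _)
  linarith

namespace IsDesign

lemma tendstoInMeasure_average_error (hD : IsDesign P ν e x S) {g : ℝ → ℝ}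
    (hgm : Measurable g) (hg : Integrable g ν) :
    TendstoInMeasure P (fun (T : ℕ) ω => (T : ℝ)⁻¹ * ∑ t : Fin T, g (e t ω)) atTop
      (fun _ => ∫ s, g s ∂ν) := by
  simpa using hD.tendstoInMeasure_average hgm hg (φ := fun _ => 1) measurable_const
    (fun _ => ⟨1, by simp⟩) (c := ∫ s, g s ∂ν)
    (Or.inr ⟨1, tendstoInMeasure_average_one, by simp⟩)

lemma tendstoInMeasure_average_mul_regressor (hD : IsDesign P ν e x S) {g : ℝ → ℝ}
    (hgm : Measurable g) (hg : Integrable g ν) (h0 : ∫ s, g s ∂ν = 0) (j : Fin k) :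
    TendstoInMeasure P (fun (T : ℕ) ω => (T : ℝ)⁻¹ * ∑ t : Fin T, g (e t ω) * x t ω j) atTop
      (fun _ => 0) :=
  hD.tendstoInMeasure_average hgm hg (φ := fun v => v j) (measurable_pi_apply j)
    (fun C => ⟨C, fun _ hv => hv j⟩) (Or.inl ⟨h0, rfl⟩)

lemma tendstoInMeasure_average_mul_gram (hD : IsDesign P ν e x S) {g : ℝ → ℝ}
    (hgm : Measurable g) (hg : Integrable g ν) (j i : Fin k) :
    TendstoInMeasure P
      (fun (T : ℕ) ω => (T : ℝ)⁻¹ * ∑ t : Fin T, g (e t ω) * (x t ω j * x t ω i)) atTop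
      (fun _ => (∫ s, g s ∂ν) * S j i) :=
  hD.tendstoInMeasure_average hgm hg (φ := fun v => v j * v i) (by fun_prop)
    (fun C => ⟨C * C, fun v hv => by
      rw [abs_mul]
      exact mul_le_mul (hv j) (hv i) (abs_nonneg _) ((abs_nonneg _).trans (hv j))⟩)
    (Or.inr ⟨_, hD.gram_tendsto j i, rfl⟩)

/-- With probability close to one, the scaled score is close to the identity near the truth. -/
lemma exists_isNearIdentity (hD : IsDesign P ν e x S) {ψ χ ψ' χ' : ℝ → ℝ} {a d v₁ v₂ : ℝ}
    (hE : IsEstimatingPair ν ψ χ ψ' χ' a d v₁ v₂) (ha : 0 < a) (hd : 0 < d)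
    (hS : IsUnit S.det) {ε δ : ℝ} (hε : 0 < ε) (hδ : 0 < δ) :
    ∃ ρ > 0, ∀ᶠ T in atTop, P.real {ω | ¬IsNearIdentity
      (scaledScore ψ χ S a d (errorSample e x T ω)) (0, 1) ρ ε} ≤ δ := by
  obtain ⟨C₀, hC₀⟩ := hD.bounded (δ / 2) (by positivity)
  -- The bound is raised to at least one so that it also covers the constant weight in the scale
  -- equation.
  set C := max C₀ 1 with hC
  have hC1 : 1 ≤ C := le_max_right _ _
  have hkC : 0 < k * C + 1 := by positivity
  set K := (a⁻¹ * (∑ i, ∑ j, |S⁻¹ i j|) + d⁻¹) * (1 + k + C * (k * C + 1)) with hK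
  have hK0 : 0 < K := by positivity
  -- `K` is the total amplification in the deterministic estimate, so averages within `η` of their
  -- limits give the error `ε`.
  set η := ε / K with hη
  have hη0 : 0 < η := by positivity
  obtain ⟨r, hr, h, hint, hdom⟩ := hE.envelope
  have hdom1 : ∀ s c l : ℝ, |c| ≤ r → |l - 1| ≤ r → (1 + |s|) * |ψ' (l * s - c)| ≤ h s :=
    fun s c l hc hl => (mul_le_mul_of_nonneg_left (le_add_of_nonneg_right (abs_nonneg _))
      (by positivity)).trans (hdom s c l hc hl)
  have hdom2 : ∀ s c l : ℝ, |c| ≤ r → |l - 1| ≤ r → (1 + |s|) * |χ' (l * s - c)| ≤ h s :=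
    fun s c l hc hl => (mul_le_mul_of_nonneg_left (le_add_of_nonneg_left (abs_nonneg _))
      (by positivity)).trans (hdom s c l hc hl)
  have key : ∀ {g : ℝ → ℝ}, Continuous g →
      (∀ s c l : ℝ, |c| ≤ r → |l - 1| ≤ r → (1 + |s|) * |g (l * s - c)| ≤ h s) →
      Integrable g ν ∧ Integrable (fun s => g s * s) ν := fun {g} hg hgd => by
    have hg0 : ∀ s, (1 + |s|) * |g s| ≤ h s := fun s => by
      simpa using hgd s 0 1 (by simpa using hr.le) (by simpa using hr.le)
    refine ⟨hint.mono' hg.aestronglyMeasurable (Eventually.of_forall fun s => ?_),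
      hint.mono' (hg.mul continuous_id).aestronglyMeasurable (Eventually.of_forall fun s => ?_)⟩
    · rw [Real.norm_eq_abs]
      nlinarith [hg0 s, abs_nonneg s, abs_nonneg (g s), mul_nonneg (abs_nonneg s) (abs_nonneg (g s))]
    · rw [norm_mul, Real.norm_eq_abs, Real.norm_eq_abs]
      nlinarith [hg0 s, abs_nonneg s, abs_nonneg (g s), mul_nonneg (abs_nonneg s) (abs_nonneg (g s))]
  obtain ⟨hψi, hψi'⟩ := key hE.continuous_loc' hdom1
  obtain ⟨hχi, hχi'⟩ := key hE.continuous_scale' hdom2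
  -- Half of `η` bounds the mean of the oscillation; the law of large numbers uses the other half.
  obtain ⟨ρ₁, hρ₁, H₁⟩ := exists_modulus hE.continuous_loc' hr hint hdom1 (half_pos hη0)
  obtain ⟨ρ₂, hρ₂, H₂⟩ := exists_modulus hE.continuous_scale' hr hint hdom2 (half_pos hη0)
  set ρ := min ρ₁ ρ₂ with hρ
  have hρ0 : 0 < ρ := lt_min hρ₁ hρ₂
  obtain ⟨W, hWc, hW0, hWi, hWη, hW⟩ := H₁ ρ hρ0 (min_le_left _ _)
  obtain ⟨V, hVc, hV0, hVi, hVη, hV⟩ := H₂ ρ hρ0 (min_le_right _ _)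
  have hψm := hE.continuous_loc'.measurable
  have hχm := hE.continuous_scale'.measurable
  have cW := tendstoInMeasure_iff_withHighProb.1
    (hD.tendstoInMeasure_average_error hWc.measurable hWi) _ (half_pos hη0)
  have cV := tendstoInMeasure_iff_withHighProb.1
    (hD.tendstoInMeasure_average_error hVc.measurable hVi) _ (half_pos hη0)
  have c1 := WithHighProb.forall_fintype fun j => tendstoInMeasure_iff_withHighProb.1
    (hD.tendstoInMeasure_average_mul_regressor (hψm.mul measurable_id) hψi'
      (by simpa [mul_comm] using hE.integral_mul_loc') j) _ hη0
  have c2 := WithHighProb.forall_fintype fun p : Fin k × Fin k =>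
    tendstoInMeasure_iff_withHighProb.1
      (hD.tendstoInMeasure_average_mul_gram hψm hψi p.1 p.2) _ hη0
  have c3 := tendstoInMeasure_iff_withHighProb.1
    (hD.tendstoInMeasure_average_error (hχm.mul measurable_id) hχi') _ hη0
  have c4 := WithHighProb.forall_fintype fun j => tendstoInMeasure_iff_withHighProb.1
    (hD.tendstoInMeasure_average_mul_regressor hχm hχi hE.integral_scale' j) _ hη0
  have hall := ((cW.and cV).and (c1.and c2)).and (c3.and c4)
  refine ⟨ρ / (k * C + 1), by positivity, ?_⟩
  refine hall.eventually_measureReal_le hC₀ (half_lt_self hδ) fun T ω hx hgood => ?_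
  obtain ⟨⟨⟨qW, qV⟩, q1, q2⟩, q3, q4⟩ := hgood
  refine (isNearIdentity_scaledScore hE.hasDerivAt_loc hE.hasDerivAt_scale hS ha hd hC1
    hW0 hV0 hW hV (η := η) (fun t j => (hx t j).trans (le_max_left _ _)) ?_ ?_ ?_ ?_ ?_ ?_).mono ?_
  · rw [Real.dist_eq] at qW
    exact (by linarith [le_abs_self ((T : ℝ)⁻¹ * ∑ t : Fin T, W (e t ω) - ∫ s, W s ∂ν)] :
      (T : ℝ)⁻¹ * ∑ t : Fin T, W (e t ω) ≤ η)
  · rw [Real.dist_eq] at qV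
    exact (by linarith [le_abs_self ((T : ℝ)⁻¹ * ∑ t : Fin T, V (e t ω) - ∫ s, V s ∂ν)] :
      (T : ℝ)⁻¹ * ∑ t : Fin T, V (e t ω) ≤ η)
  · intro j
    have := (q1 j).le
    rw [Real.dist_eq, sub_zero] at this
    simpa only [errorSample, mul_right_comm, Pi.mul_apply, id] using this
  · intro j i
    have := (q2 (j, i)).le
    rw [Real.dist_eq, hE.integral_loc'] at this
    simpa only [errorSample, mul_assoc, neg_mul, sub_neg_eq_add] using this
  · have := q3.le
    have hh : ∫ s, χ' s * s ∂ν = -d := by simpa [mul_comm] using hE.integral_mul_scale'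
    rw [Real.dist_eq] at this
    simpa [errorSample, hh] using this
  · intro i
    have := (q4 i).le
    rw [Real.dist_eq, sub_zero] at this
    exact this
  · rw [← mul_assoc, ← hK, hη, mul_div_cancel₀ _ hK0.ne']

end IsDesign

end

end MDPDE

/-! ### Boundedness in probability and expansion of roots -/

namespace MDPDE

noncomputable section

section BoundedInProb

variable {Ω : Type*} [MeasurableSpace Ω] {P : Measure Ω} [IsProbabilityMeasure P]
  {E F : Type*} [NormedAddCommGroup E] [NormedAddCommGroup F]

/-- Boundedness in probability of a sequence of random vectors. -/
def BoundedInProb (P : Measure Ω) (X : ℕ → Ω → E) : Prop :=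
  ∀ δ > 0, ∃ K, ∀ᶠ T in atTop, P.real {ω | ¬‖X T ω‖ ≤ K} ≤ δ

lemma eventually_measureReal_not_and_le {A B : ℕ → Ω → Prop} {δ δ' : ℝ}
    (hA : ∀ᶠ T in atTop, P.real {ω | ¬A T ω} ≤ δ) (hB : ∀ᶠ T in atTop, P.real {ω | ¬B T ω} ≤ δ') :
    ∀ᶠ T in atTop, P.real {ω | ¬(A T ω ∧ B T ω)} ≤ δ + δ' := by
  filter_upwards [hA, hB] with T h1 h2
  have hsub : {ω | ¬(A T ω ∧ B T ω)} ⊆ {ω | ¬A T ω} ∪ {ω | ¬B T ω} := fun ω hω => by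
    simp only [Set.mem_union, Set.mem_ofPred_eq] at *
    tauto
  have := (measureReal_mono (μ := P) hsub).trans (measureReal_union_le _ _)
  linarith

/-- The closed sets `{n ≤ ‖v‖}` decrease to the empty set, so one has small limit mass; the
portmanteau inequality carries this over to large `T`. -/
lemma BoundedInProb.of_tendstoInDistribution [MeasurableSpace E] [BorelSpace E]
    {X : ℕ → Ω → E} {μ : Measure E} [IsProbabilityMeasure μ]
    (h : TendstoInDistribution X atTop id (fun _ => P) μ) : BoundedInProb P X := by
  intro δ hδ
  have hF : ∀ n : ℕ, IsClosed {v : E | (n : ℝ) ≤ ‖v‖} := fun n =>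
    isClosed_le continuous_const continuous_norm
  have hlim : Tendsto (fun n : ℕ => μ {v : E | (n : ℝ) ≤ ‖v‖}) atTop (𝓝 0) := by
    have h1 : ⋂ n : ℕ, {v : E | (n : ℝ) ≤ ‖v‖} = ∅ := by
      ext v
      simp only [Set.mem_iInter, Set.mem_ofPred_eq, Set.mem_empty_iff_false, iff_false, not_forall,
        not_le]
      exact exists_nat_gt _
    have := tendsto_measure_iInter_atTop (μ := μ) (s := fun n : ℕ => {v : E | (n : ℝ) ≤ ‖v‖})
      (fun n => (hF n).measurableSet.nullMeasurableSet)
      (fun n m hnm v (hv : (m : ℝ) ≤ ‖v‖) => show (n : ℝ) ≤ ‖v‖ from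
        le_trans (by exact_mod_cast hnm) hv) ⟨0, measure_ne_top _ _⟩
    rwa [h1, measure_empty] at this
  obtain ⟨n, hn⟩ := (hlim.eventually_lt_const (ENNReal.ofReal_pos.2 hδ)).exists
  refine ⟨n, ?_⟩
  have hlimsup := ProbabilityMeasure.limsup_measure_closed_le_of_tendsto h.tendsto (hF n)
  simp only [ProbabilityMeasure.coe_mk, Measure.map_id] at hlimsup
  filter_upwards [eventually_lt_of_limsup_lt (hlimsup.trans_lt hn)] with T hT
  rw [Measure.map_apply_of_aemeasurable (h.forall_aemeasurable T) (hF n).measurableSet] at hT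
  refine ENNReal.toReal_le_of_le_ofReal hδ.le ((measure_mono fun ω hω => ?_).trans hT.le)
  exact (not_le.1 hω).le

lemma BoundedInProb.of_norm_le {X : ℕ → Ω → E} (hX : BoundedInProb P X) {Y : ℕ → Ω → F} {c : ℝ}
    (hc : 0 ≤ c) (h : ∀ T ω, ‖Y T ω‖ ≤ c * ‖X T ω‖) : BoundedInProb P Y := fun δ hδ => by
  obtain ⟨K, hK⟩ := hX δ hδ
  refine ⟨c * K, hK.mono fun T hT => (measureReal_mono fun ω (hω : ¬_) => mt (fun hX => ?_) hω).trans hT⟩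
  exact (h T ω).trans (mul_le_mul_of_nonneg_left hX hc)

lemma BoundedInProb.tendstoInMeasure_zero {X : ℕ → Ω → E} (hX : BoundedInProb P X)
    {r : ℕ → Ω → ℝ} (hr : TendstoInMeasure P r atTop fun _ => 0) {Y : ℕ → Ω → F}
    (h : WithHighProb P fun T ω => ‖Y T ω‖ ≤ |r T ω| * ‖X T ω‖) :
    TendstoInMeasure P Y atTop fun _ => 0 := by
  rw [tendstoInMeasure_iff_withHighProb] at hr ⊢
  intro ε hε
  refine WithHighProb.of_approx fun δ hδ => ?_
  obtain ⟨K, hK⟩ := hX δ hδ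
  refine ⟨_, hK, ((hr (ε / (|K| + 1)) (by positivity)).and h).mono fun T ω ⟨h1, h2⟩ h3 => ?_⟩
  rw [dist_zero_right]
  rw [dist_zero_right, Real.norm_eq_abs, lt_div_iff₀ (by positivity)] at h1
  calc ‖Y T ω‖ ≤ |r T ω| * ‖X T ω‖ := h2
    _ ≤ |r T ω| * (|K| + 1) := mul_le_mul_of_nonneg_left
        (h3.trans ((le_abs_self K).trans (by linarith))) (abs_nonneg _)
    _ < ε := h1

lemma tendstoInMeasure_map_of_continuousAt {E F : Type*} [PseudoMetricSpace E]
    [PseudoMetricSpace F] {X : ℕ → Ω → E} {c : E} (hX : TendstoInMeasure P X atTop fun _ => c)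
    {g : E → F} (hg : ContinuousAt g c) :
    TendstoInMeasure P (fun T ω => g (X T ω)) atTop fun _ => g c := by
  rw [tendstoInMeasure_iff_withHighProb] at hX ⊢
  intro ε hε
  obtain ⟨δ, hδ, h⟩ := Metric.continuousAt_iff.1 hg ε hε
  exact (hX δ hδ).mono fun T ω hω => h hω

end BoundedInProb

section RootExpansion

variable {Ω : Type*} [MeasurableSpace Ω] {P : Measure Ω} [IsProbabilityMeasure P]
  {E : Type*} [NormedAddCommGroup E]

/-- Random maps that, with probability close to one, are close to the identity near `θ₀`. -/
def IsNearIdentityInProb (P : Measure Ω) (N : ℕ → Ω → E → E) (θ₀ : E) : Prop :=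
  ∀ ε > 0, ∀ δ > 0, ∃ ρ > 0, ∀ᶠ T in atTop, P.real {ω | ¬IsNearIdentity (N T ω) θ₀ ρ ε} ≤ δ

variable {N : ℕ → Ω → E → E} {θ₀ : E}

namespace IsNearIdentityInProb

variable {θ : ℕ → Ω → E}

/-- On the near-identity event, the distance of the root from `θ₀` is at most twice `‖N θ₀‖`, which
is of order `T^(-1/2)`. -/
lemma boundedInProb_root [NormedSpace ℝ E] (hN : IsNearIdentityInProb P N θ₀)
    (hb : BoundedInProb P fun (T : ℕ) ω => √(T : ℝ) • N T ω θ₀)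
    (hroot : WithHighProb P fun T ω => N T ω (θ T ω) = 0)
    (hθ : TendstoInMeasure P θ atTop fun _ => θ₀) :
    BoundedInProb P fun (T : ℕ) ω => √(T : ℝ) • (θ T ω - θ₀) := by
  intro δ hδ
  obtain ⟨K, hK⟩ := hb (δ / 4) (by positivity)
  obtain ⟨ρ, hρ, hρN⟩ := hN (1 / 2) (by norm_num) (δ / 4) (by positivity)
  refine ⟨2 * K, (hroot.and (tendstoInMeasure_iff_withHighProb.1 hθ ρ hρ)).eventually_measureReal_le
    (eventually_measureReal_not_and_le hK hρN) (by linarith) ?_⟩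
  rintro T ω ⟨h1, h2⟩ ⟨h3, h4⟩
  have := (h2.norm_root_sub_le hρ.le le_rfl h4.le h3).1
  rw [norm_smul] at h1 ⊢
  nlinarith [norm_nonneg √(T : ℝ)]

/-- Asymptotic linearity of consistent roots. -/
lemma tendstoInMeasure_root [NormedSpace ℝ E] (hN : IsNearIdentityInProb P N θ₀)
    (hb : BoundedInProb P fun (T : ℕ) ω => √(T : ℝ) • N T ω θ₀)
    (hroot : WithHighProb P fun T ω => N T ω (θ T ω) = 0)
    (hθ : TendstoInMeasure P θ atTop fun _ => θ₀) :
    TendstoInMeasure P (fun (T : ℕ) ω => √(T : ℝ) • (θ T ω - θ₀) + √(T : ℝ) • N T ω θ₀) atTop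
      fun _ => 0 := by
  rw [tendstoInMeasure_iff_withHighProb]
  intro ε hε
  refine WithHighProb.of_approx fun δ hδ => ?_
  obtain ⟨K, hK⟩ := hb (δ / 2) (by positivity)
  -- The bound `1/2` permits absorption; the other makes the scaled error at most `2 · ε/(4(|K| +
  -- 1)) · (|K| + 1) = ε/2`.
  have hε₁ : 0 < min (1 / 2) (ε / (4 * (|K| + 1))) := lt_min (by norm_num) (by positivity)
  obtain ⟨ρ, hρ, hρN⟩ := hN _ hε₁ (δ / 2) (by positivity)
  refine ⟨_, (eventually_measureReal_not_and_le hK hρN).mono fun T hT =>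
    hT.trans (add_halves δ).le,
    (hroot.and (tendstoInMeasure_iff_withHighProb.1 hθ ρ hρ)).mono ?_⟩
  rintro T ω ⟨h3, h4⟩ ⟨h1, h2⟩
  have := (h2.norm_root_sub_le hρ.le (min_le_left _ _) h4.le h3).2
  rw [dist_zero_right, ← smul_add, norm_smul]
  rw [norm_smul] at h1
  calc ‖√(T : ℝ)‖ * ‖θ T ω - θ₀ + N T ω θ₀‖
      ≤ ‖√(T : ℝ)‖ * (2 * min (1 / 2) (ε / (4 * (|K| + 1))) * ‖N T ω θ₀‖) :=
        mul_le_mul_of_nonneg_left this (norm_nonneg _)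
    _ = 2 * min (1 / 2) (ε / (4 * (|K| + 1))) * (‖√(T : ℝ)‖ * ‖N T ω θ₀‖) := by ring
    _ ≤ 2 * (ε / (4 * (|K| + 1))) * (|K| + 1) := by
        refine mul_le_mul (mul_le_mul_of_nonneg_left (min_le_right _ _) zero_le_two)
          (h1.trans ((le_abs_self K).trans (by linarith))) (by positivity) (by positivity)
    _ = ε / 2 := by field_simp; norm_num
    _ < ε := by linarith

/-- The limit of the Newton iteration started at `θ₀` is, with high probability, a root, and it is
consistent. -/
lemma limUnder_newton [CompleteSpace E] (hN : IsNearIdentityInProb P N θ₀)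
    (h0 : TendstoInMeasure P (fun T ω => N T ω θ₀) atTop fun _ => 0) :
    (WithHighProb P fun T ω =>
      N T ω (limUnder atTop fun n => (newtonStep (N T ω))^[n] θ₀) = 0) ∧
    TendstoInMeasure P (fun T ω => limUnder atTop fun n => (newtonStep (N T ω))^[n] θ₀) atTop
      fun _ => θ₀ := by
  rw [tendstoInMeasure_iff_withHighProb] at h0 ⊢
  have key : ∀ ε > 0, WithHighProb P fun T ω =>
      N T ω (limUnder atTop fun n => (newtonStep (N T ω))^[n] θ₀) = 0 ∧
        dist (limUnder atTop fun n => (newtonStep (N T ω))^[n] θ₀) θ₀ < ε := fun ε hε => by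
    refine WithHighProb.of_approx fun δ hδ => ?_
    obtain ⟨ρ, hρ, hρN⟩ := hN (1 / 2) (by norm_num) δ hδ
    -- The bound `ρ/2` starts the contraction, and `ε/4` keeps the root within `ε/2` of `θ₀`.
    have hm : 0 < min (ρ / 2) (ε / 4) := lt_min (by positivity) (by positivity)
    refine ⟨_, hρN, (h0 _ hm).mono fun T ω h1 h2 => ?_⟩
    rw [dist_zero_right] at h1
    obtain ⟨θ, hθ, hθ0, hlim⟩ := h2.tendsto_iterate hρ.le (h1.le.trans (min_le_left _ _))
    rw [hlim.limUnder_eq]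
    refine ⟨hθ0, ?_⟩
    have := (h2.norm_root_sub_le hρ.le le_rfl hθ hθ0).1
    rw [dist_eq_norm]
    linarith [h1.le.trans (min_le_right _ _)]
  exact ⟨(key 1 one_pos).mono fun T ω h => h.1, fun ε hε => (key ε hε).mono fun T ω h => h.2⟩

end IsNearIdentityInProb

end RootExpansion

end

end MDPDE

/-! ### Measurable roots and the size of the score at the truth -/

namespace MDPDE

noncomputable section

section Measurability

variable {k : ℕ} {ψ χ : ℝ → ℝ} (S : Matrix (Fin k) (Fin k) ℝ) (a d : ℝ) {T : ℕ}

lemma continuous_scaledScore (hψ : Continuous ψ) (hχ : Continuous χ) :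
    Continuous fun q : (Fin T → ℝ × (Fin k → ℝ)) × ((Fin k → ℝ) × ℝ) =>
      scaledScore ψ χ S a d q.1 q.2 := by
  have hr : ∀ t, Continuous fun q : (Fin T → ℝ × (Fin k → ℝ)) × ((Fin k → ℝ) × ℝ) =>
      linResidual (q.1 t) q.2 := fun t => by
    unfold linResidual
    fun_prop
  have hψr := fun t => hψ.comp (hr t)
  have hχr := fun t => hχ.comp (hr t)
  simp only [Function.comp_def] at hψr hχr
  have h1 : Continuous fun q : (Fin T → ℝ × (Fin k → ℝ)) × ((Fin k → ℝ) × ℝ) => fun j =>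
      (T : ℝ)⁻¹ * ∑ t, ψ (linResidual (q.1 t) q.2) * (q.1 t).2 j := by
    refine continuous_pi fun j => continuous_const.mul (continuous_finsetSum _ fun t _ => ?_)
    have h := hψr t
    fun_prop
  have h2 : Continuous fun q : (Fin T → ℝ × (Fin k → ℝ)) × ((Fin k → ℝ) × ℝ) =>
      ∑ t, χ (linResidual (q.1 t) q.2) := continuous_finsetSum _ fun t _ => hχr t
  unfold scaledScore
  have h3 : Continuous fun q : (Fin T → ℝ × (Fin k → ℝ)) × ((Fin k → ℝ) × ℝ) =>
      S⁻¹.mulVec fun j => (T : ℝ)⁻¹ * ∑ t, ψ (linResidual (q.1 t) q.2) * (q.1 t).2 j :=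
    Continuous.matrix_mulVec continuous_const h1
  exact (h3.const_smul a⁻¹).prodMk (((h2.const_mul _).const_mul _).neg)

/-- Every iterate is continuous in the data, so the root is selected measurably as a pointwise
limit; where the iterates diverge `limUnder` takes a default value, and measurability persists. -/
lemma measurable_limUnder_newton (hψ : Continuous ψ) (hχ : Continuous χ)
    (θ₀ : (Fin k → ℝ) × ℝ) : Measurable fun D : Fin T → ℝ × (Fin k → ℝ) =>
      limUnder atTop fun n => (newtonStep (scaledScore ψ χ S a d D))^[n] θ₀ := by
  have hc : ∀ n, Continuous fun D : Fin T → ℝ × (Fin k → ℝ) =>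
      (newtonStep (scaledScore ψ χ S a d D))^[n] θ₀ := fun n => by
    induction n with
    | zero => exact continuous_const
    | succ n ih =>
      simp only [Function.iterate_succ', Function.comp_apply, newtonStep]
      have h := (continuous_scaledScore S a d hψ hχ (T := T)).comp (continuous_id.prodMk ih)
      exact Continuous.sub ih h
  exact (StronglyMeasurable.limUnder fun n => (hc n).stronglyMeasurable).measurable

end Measurability

lemma BoundedInProb.tendstoInMeasure_zero_of_add {Ω : Type*} [MeasurableSpace Ω] {P : Measure Ω}
    [IsProbabilityMeasure P] {E F G : Type*} [NormedAddCommGroup E] [NormedAddCommGroup F]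
    [NormedAddCommGroup G] {X : ℕ → Ω → E} (hX : BoundedInProb P X)
    {r : ℕ → Ω → ℝ} (hr : TendstoInMeasure P r atTop fun _ => 0) {Z : ℕ → Ω → G}
    (hZ : TendstoInMeasure P Z atTop fun _ => 0) (c : ℝ) {Y : ℕ → Ω → F}
    (h : WithHighProb P fun T ω => ‖Y T ω‖ ≤ |r T ω| * ‖X T ω‖ + c * ‖Z T ω‖) :
    TendstoInMeasure P Y atTop fun _ => 0 := by
  have h1 := hX.tendstoInMeasure_zero hr (Y := fun T ω => |r T ω| * ‖X T ω‖)
    (WithHighProb.of_forall fun T ω => by simp)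
  rw [tendstoInMeasure_iff_withHighProb] at h1 hZ ⊢
  intro ε hε
  refine (((h1 (ε / 2) (half_pos hε)).and (hZ (ε / (2 * (|c| + 1))) (by positivity))).and h).mono
    fun T ω ⟨⟨h1, h2⟩, h3⟩ => ?_
  rw [dist_zero_right] at h1 h2 ⊢
  rw [lt_div_iff₀ (by positivity)] at h2
  rw [Real.norm_eq_abs, abs_of_nonneg (by positivity)] at h1
  nlinarith [le_abs_self c, norm_nonneg (Z T ω)]

lemma sqrt_smul_scaledScore {Ω : Type*} {k : ℕ} (ψ χ : ℝ → ℝ)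
    (S : Matrix (Fin k) (Fin k) ℝ) (a d : ℝ) (e : ℕ → Ω → ℝ) (x : ℕ → Ω → Fin k → ℝ) (T : ℕ) (ω : Ω) :
    √(T : ℝ) • scaledScore ψ χ S a d (errorSample e x T ω) (0, 1)
      = (a⁻¹ • S⁻¹.mulVec (fun j => (√(T : ℝ))⁻¹ * ∑ t : Fin T, ψ (e t ω) * x t ω j),
        -(d⁻¹ * ((√(T : ℝ))⁻¹ * ∑ t : Fin T, χ (e t ω)))) := by
  -- This also holds at `T = 0`, where both sides are zero.
  have hT : √(T : ℝ) * (T : ℝ)⁻¹ = (√(T : ℝ))⁻¹ := by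
    rw [← div_eq_mul_inv, Real.sqrt_div_self']
    simp
  ext j
  · simp only [scaledScore, linResidual, errorSample, Prod.smul_fst, Pi.smul_apply, smul_eq_mul,
      Matrix.mulVec, dotProduct, Pi.zero_apply, zero_mul, Finset.sum_const_zero, one_mul, sub_zero,
      ← hT, Finset.mul_sum]
    exact Finset.sum_congr rfl fun i _ => Finset.sum_congr rfl fun t _ => by ring
  · simp only [scaledScore, linResidual, errorSample, Prod.smul_snd, smul_eq_mul,
      Pi.zero_apply, zero_mul, Finset.sum_const_zero, one_mul, sub_zero, ← hT]
    ring

namespace IsDesign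

variable {Ω : Type*} [MeasurableSpace Ω] {P : Measure Ω} [IsProbabilityMeasure P] {k : ℕ}
  {ν : Measure ℝ} {e : ℕ → Ω → ℝ} {x : ℕ → Ω → Fin k → ℝ} {S : Matrix (Fin k) (Fin k) ℝ}
  {ψ χ ψ' χ' : ℝ → ℝ} {a d v₁ v₂ : ℝ}

lemma isNearIdentityInProb (hD : IsDesign P ν e x S)
    (hE : IsEstimatingPair ν ψ χ ψ' χ' a d v₁ v₂) (hS : IsUnit S.det) :
    IsNearIdentityInProb P (fun T ω => scaledScore ψ χ S a d (errorSample e x T ω)) (0, 1) :=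
  fun _ hε _ hδ => hD.exists_isNearIdentity hE hE.pos_loc hE.pos_scale hS hε hδ

/-- At `(0, 1)` the residuals are the errors, so this is tightness from the central limit theorem
with multipliers `a⁻¹` and `-d⁻¹`; the sup norm is bounded by the Euclidean one. -/
lemma boundedInProb_scaledScore (hD : IsDesign P ν e x S)
    (hE : IsEstimatingPair ν ψ χ ψ' χ' a d v₁ v₂) (hS : S.PosDef) :
    BoundedInProb P fun (T : ℕ) ω =>
      √(T : ℝ) • scaledScore ψ χ S a d (errorSample e x T ω) (0, 1) := by
  refine (BoundedInProb.of_tendstoInDistribution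
    (hD.tendstoInDistribution_scores hE hS a⁻¹ (-d⁻¹))).of_norm_le zero_le_one fun T ω => ?_
  rw [sqrt_smul_scaledScore, one_mul, Prod.norm_def, Prod.norm_def]
  refine max_le_max ?_ (le_of_eq (by rw [neg_mul]))
  refine (pi_norm_le_iff_of_nonneg (norm_nonneg _)).2 fun j => ?_
  exact PiLp.norm_apply_le (a⁻¹ • WithLp.toLp 2 (S⁻¹.mulVec fun j =>
    (√(T : ℝ))⁻¹ * ∑ t : Fin T, ψ (e t ω) * x t ω j)) j

lemma tendstoInMeasure_scaledScore (hD : IsDesign P ν e x S)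
    (hE : IsEstimatingPair ν ψ χ ψ' χ' a d v₁ v₂) (hS : S.PosDef) :
    TendstoInMeasure P (fun (T : ℕ) ω => scaledScore ψ χ S a d (errorSample e x T ω) (0, 1))
      atTop fun _ => 0 := by
  refine (hD.boundedInProb_scaledScore hE hS).tendstoInMeasure_zero
    (r := fun T _ => (√(T : ℝ))⁻¹) ?_ ?_
  · rw [tendstoInMeasure_iff_withHighProb]
    intro ε hε
    have hlim : Tendsto (fun T : ℕ => (√(T : ℝ))⁻¹) atTop (𝓝 0) :=
      tendsto_inv_atTop_zero.comp (Real.tendsto_sqrt_atTop.comp tendsto_natCast_atTop_atTop)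
    refine (WithHighProb.of_forall (A := fun _ _ => True) fun _ _ => trivial).mono' ?_
    filter_upwards [Metric.tendsto_nhds.1 hlim ε hε] with T hT ω _ using hT
  · refine (WithHighProb.of_forall (A := fun _ _ => True) fun _ _ => trivial).mono' ?_
    filter_upwards [eventually_gt_atTop 0] with T hT ω _
    have h : (0 : ℝ) < √(T : ℝ) := Real.sqrt_pos.2 (by exact_mod_cast hT)
    rw [norm_smul, Real.norm_of_nonneg h.le, abs_of_pos (inv_pos.2 h), ← mul_assoc,
      inv_mul_cancel₀ h.ne', one_mul]

end IsDesign

end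

end MDPDE

/-! ### From the regression model to the abstract design -/

namespace MDPDE

noncomputable section

lemma measurable_regressor {m : ℕ} : Measurable (regressor : (Fin m → ℝ) → Fin (m + 1) → ℝ) :=
  measurable_pi_lambda _ fun j => by
    refine Fin.cases ?_ (fun i => ?_) j
    · exact measurable_const
    · exact measurable_pi_apply i

lemma gram_apply {m T : ℕ} (w : Fin T → Fin m → ℝ) (i j : Fin (m + 1)) :
    gram w i j = (T : ℝ)⁻¹ * ∑ t, regressor (w t) i * regressor (w t) j := by
  simp [gram, design, Matrix.mul_apply]

lemma isHermitian_gram {m T : ℕ} (w : Fin T → Fin m → ℝ) : (gram w).IsHermitian :=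
  Matrix.IsHermitian.ext fun i j => by simp [gram_apply, mul_comm]

/-- The quadratic form of a symmetric matrix is bounded below by its spectrum. -/
lemma mul_dotProduct_self_le_of_spectrum {n : Type*} [Fintype n] [DecidableEq n]
    {A : Matrix n n ℝ} (hA : A.IsHermitian) {c : ℝ} (hc : ∀ μ ∈ spectrum ℝ A, c ≤ μ) (v : n → ℝ) :
    c * (v ⬝ᵥ v) ≤ v ⬝ᵥ A.mulVec v := by
  have hB : (A - algebraMap ℝ (Matrix n n ℝ) c).IsHermitian := by
    refine hA.sub (Matrix.IsHermitian.ext fun i j => ?_)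
    simp [Matrix.algebraMap_matrix_apply, eq_comm]
  have hpos : (A - algebraMap ℝ (Matrix n n ℝ) c).PosSemidef := by
    refine (hB.posSemidef_iff_eigenvalues_nonneg).2 fun i => ?_
    have h1 := hB.eigenvalues_mem_spectrum_real i
    have h2 : hB.eigenvalues i + c ∈ spectrum ℝ A := by
      rw [spectrum.add_mem_iff, neg_add_eq_sub]
      exact h1
    have := hc _ h2
    simp only [Pi.zero_apply]
    linarith
  have h := hpos.dotProduct_mulVec_nonneg v
  rw [Matrix.sub_mulVec, dotProduct_sub, Algebra.algebraMap_eq_smul_one, Matrix.smul_mulVec,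
    Matrix.one_mulVec, dotProduct_smul, smul_eq_mul, star_trivial] at h
  linarith

lemma map_div_withDensity {f : ℝ → ℝ} (hf : Continuous f) {σ : ℝ} (hσ : 0 < σ) :
    (volume.withDensity fun z => ENNReal.ofReal (1 / σ * f (z / σ))).map (fun z => z / σ)
      = errorLaw f := by
  have hm : Measurable fun z : ℝ => z / σ := measurable_id.div_const σ
  refine Measure.ext fun s hs => ?_
  rw [Measure.map_apply hm hs, withDensity_apply _ (hm hs), errorLaw, withDensity_apply _ hs,
    ← lintegral_indicator (hm hs), ← lintegral_indicator hs]
  have hg : Measurable (s.indicator fun z => ENNReal.ofReal (σ⁻¹ * f z)) :=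
    Measurable.indicator (by fun_prop) hs
  have h1 : ∀ z, ((fun z => z / σ) ⁻¹' s).indicator
      (fun z => ENNReal.ofReal (1 / σ * f (z / σ))) z
      = s.indicator (fun z => ENNReal.ofReal (σ⁻¹ * f z)) (σ⁻¹ * z) := fun z => by
    by_cases hz : σ⁻¹ * z ∈ s <;> simp [Set.indicator, div_eq_inv_mul, hz]
  simp_rw [h1]
  rw [← lintegral_map hg (measurable_const_mul σ⁻¹), Real.map_volume_mul_left (inv_ne_zero hσ.ne'),
    lintegral_smul_measure, inv_inv, abs_of_pos hσ, smul_eq_mul,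
    ← lintegral_const_mul' _ _ ENNReal.ofReal_ne_top]
  refine lintegral_congr fun z => ?_
  by_cases hz : z ∈ s
  · rw [Set.indicator_of_mem hz, Set.indicator_of_mem hz, ← ENNReal.ofReal_mul hσ.le,
      mul_inv_cancel_left₀ hσ.ne']
  · rw [Set.indicator_of_notMem hz, Set.indicator_of_notMem hz, mul_zero]

namespace IsModel

variable {Ω : Type*} [MeasurableSpace Ω] {P : Measure Ω} [IsProbabilityMeasure P] {m : ℕ}
  {f : ℝ → ℝ} {σ : ℝ} {β : EuclideanSpace ℝ (Fin (m + 1))}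
  {Sx : Matrix (Fin (m + 1)) (Fin (m + 1)) ℝ} {y η : ℕ → Ω → ℝ} {w : ℕ → Ω → Fin m → ℝ}

lemma eventually_measureReal_le (hM : IsModel P f σ β Sx y η w) {ε : ℝ} (hε : 0 < ε) :
    ∃ C, ∀ᶠ T : ℕ in atTop,
      P.real {ω | ¬∀ (t : Fin T) j, |regressor (w t ω) j| ≤ C} ≤ ε := by
  obtain ⟨C, -, c, -, hC⟩ := hM.design_bounds ε hε
  refine ⟨C, hC.mono fun T hT => ?_⟩
  -- Passing to the complement requires measurability, which is available for this larger event.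
  have hmeas : MeasurableSet {ω | ∀ (t : Fin T) j, |regressor (w t ω) j| ≤ C} := by
    simp only [Set.ofPred_forall]
    refine MeasurableSet.iInter fun t => MeasurableSet.iInter fun j => ?_
    exact measurableSet_le (((measurable_pi_apply j).comp
      (measurable_regressor.comp (hM.measurable_control t))).abs) measurable_const
  have h1 : 1 - ENNReal.ofReal ε ≤ P {ω | ∀ (t : Fin T) j, |regressor (w t ω) j| ≤ C} :=
    hT.trans (measure_mono fun ω hω => hω.1)
  refine ENNReal.toReal_le_of_le_ofReal hε.le ?_
  change P {ω | ∀ (t : Fin T) j, |regressor (w t ω) j| ≤ C}ᶜ ≤ _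
  rw [prob_compl_eq_one_sub hmeas]
  exact tsub_le_iff_tsub_le.1 h1

lemma isDesign (hM : IsModel P f σ β Sx y η w) (hf : Continuous f) (hσ : 0 < σ) :
    IsDesign P (errorLaw f) (fun t ω => η t ω / σ) (fun t ω => regressor (w t ω)) Sx where
  measurable_error t := (hM.measurable_error t).div_const σ
  measurable_regressor t := measurable_regressor.comp (hM.measurable_control t)
  map_error t := by
    rw [← map_div_withDensity hf hσ, ← hM.error_density t,
      Measure.map_map (by fun_prop) (hM.measurable_error t)]
    rfl
  iIndepFun_error := hM.error_indep.comp (fun _ z => z / σ) fun _ => measurable_id.div_const σ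
  indepFun_regressor := hM.error_indep_control.comp (φ := fun h t => h t / σ)
    (ψ := fun h t => regressor (h t))
    (by fun_prop)
    (measurable_pi_lambda _ fun t => measurable_regressor.comp (measurable_pi_apply t))
  bounded _ hε := hM.eventually_measureReal_le hε
  gram_tendsto i j := by simpa only [gram_apply] using hM.gram_tendsto i j

/-- With positive probability the Gram matrix is both close to `Sx` and bounded below by `c`. So
`Sx` is a limit of symmetric matrices with quadratic forms at least `c |v|²`, and inherits symmetry
and the bound. -/
lemma posDef (hM : IsModel P f σ β Sx y η w) : Sx.PosDef := by
  obtain ⟨C, -, c, hc, hC⟩ := hM.design_bounds (1 / 2) (by norm_num)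
  have happrox : ∀ ε > 0, ∃ A : Matrix (Fin (m + 1)) (Fin (m + 1)) ℝ, A.IsHermitian ∧
      (∀ v, c * (v ⬝ᵥ v) ≤ v ⬝ᵥ A.mulVec v) ∧ ∀ i j, |A i j - Sx i j| < ε := fun ε hε => by
    have hall := WithHighProb.forall_fintype fun p : Fin (m + 1) × Fin (m + 1) =>
      tendstoInMeasure_iff_withHighProb.1 (hM.gram_tendsto p.1 p.2) ε hε
    obtain ⟨T, hT1, hT2⟩ := (hC.and (hall (1 / 4) (by norm_num))).exists
    -- The events need not be measurable. If they were disjoint, the first, of outer measure at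
    -- least `1/2`, would lie in the complement of the second, of outer measure at most `1/4`.
    have hex : ∃ ω, DesignBounds (fun t : Fin T => w t ω) C c ∧
        ∀ p : Fin (m + 1) × Fin (m + 1),
          dist (gram (fun t : Fin T => w t ω) p.1 p.2) (Sx p.1 p.2) < ε := by
      by_contra! hcon
      have hsub : {ω | DesignBounds (fun t : Fin T => w t ω) C c} ⊆
          {ω | ¬∀ p : Fin (m + 1) × Fin (m + 1),
            dist (gram (fun t : Fin T => w t ω) p.1 p.2) (Sx p.1 p.2) < ε} := fun ω hω hall => by
        obtain ⟨p, hp⟩ := hcon ω hω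
        exact absurd (hall p) (not_lt.2 hp)
      have h1 := hT1.trans (measure_mono hsub)
      rw [← ofReal_measureReal (measure_ne_top _ _), ← ENNReal.ofReal_one,
        ← ENNReal.ofReal_sub _ (by norm_num), ENNReal.ofReal_le_ofReal_iff measureReal_nonneg] at h1
      linarith
    obtain ⟨ω, hω, hω'⟩ := hex
    exact ⟨_, isHermitian_gram _, mul_dotProduct_self_le_of_spectrum (isHermitian_gram _)
      hω.2.2.2.1, fun i j => hω' (i, j)⟩
  have hsymm : Sx.IsHermitian := Matrix.IsHermitian.ext fun i j => by
    refine eq_of_abs_sub_le_all fun ε hε => ?_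
    obtain ⟨A, hA, -, h⟩ := happrox (ε / 2) (half_pos hε)
    have h1 := h i j
    have h2 := h j i
    have h3 : A j i = A i j := by simpa using hA.apply i j
    rw [star_trivial]
    rw [abs_lt] at h1 h2
    rw [abs_le]
    constructor <;> linarith [h1.1, h1.2, h2.1, h2.2]
  refine Matrix.PosDef.of_dotProduct_mulVec_pos hsymm fun v hv => ?_
  rw [star_trivial]
  have hv0 : 0 < v ⬝ᵥ v := by
    have h := (Finset.sum_nonneg fun i _ => mul_self_nonneg (v i) : 0 ≤ v ⬝ᵥ v)
    exact h.lt_of_ne fun h0 => hv (dotProduct_self_eq_zero.1 h0.symm)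
  refine (mul_pos hc hv0).trans_le (le_of_forall_pos_le_add fun ε hε => ?_)
  set B := ∑ i, ∑ j, |v i| * |v j| with hB
  have hB0 : 0 ≤ B := Finset.sum_nonneg fun i _ => Finset.sum_nonneg fun j _ => by positivity
  obtain ⟨A, -, hA, h⟩ := happrox (ε / (B + 1)) (by positivity)
  have hdiff : v ⬝ᵥ A.mulVec v - v ⬝ᵥ Sx.mulVec v ≤ B * (ε / (B + 1)) := by
    simp only [dotProduct, Matrix.mulVec, Finset.mul_sum, ← Finset.sum_sub_distrib]
    rw [hB, Finset.sum_mul]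
    refine Finset.sum_le_sum fun i _ => ?_
    rw [Finset.sum_mul]
    refine Finset.sum_le_sum fun j _ => ?_
    calc v i * (A i j * v j) - v i * (Sx i j * v j) = v i * v j * (A i j - Sx i j) := by ring
      _ ≤ |v i * v j * (A i j - Sx i j)| := le_abs_self _
      _ = |v i| * |v j| * |A i j - Sx i j| := by rw [abs_mul, abs_mul]
      _ ≤ _ := mul_le_mul_of_nonneg_left (h i j).le (by positivity)
  have h2 : B * (ε / (B + 1)) ≤ ε := by
    rw [mul_div_assoc', div_le_iff₀ (by positivity)]
    nlinarith
  linarith [hA v]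

end IsModel

end

end MDPDE

/-! ### Linear coordinates for coefficients and variance; measurability of the root event -/

namespace MDPDE

noncomputable section

/-- Regression coefficients and error variance in coordinates in which the standardized residual
is linear and the true parameter is `(0, 1)`. -/
def localParam {m : ℕ} (β : EuclideanSpace ℝ (Fin (m + 1))) (σ : ℝ)
    (b : EuclideanSpace ℝ (Fin (m + 1))) (s2 : ℝ) : (Fin (m + 1) → ℝ) × ℝ :=
  (fun j => (b j - β j) / √s2, σ / √s2)

/-- The inverse of `localParam`. -/
def ofLocalParam {m : ℕ} (β : EuclideanSpace ℝ (Fin (m + 1))) (σ : ℝ)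
    (θ : (Fin (m + 1) → ℝ) × ℝ) : EuclideanSpace ℝ (Fin (m + 1)) × ℝ :=
  (β + (σ / θ.2) • WithLp.toLp 2 θ.1, (σ / θ.2) ^ 2)

/-- The centered estimating function of the scale equation. -/
def centeredScaleScore (f : ℝ → ℝ) (α z : ℝ) : ℝ := scaleScore f α z - α * M f 0 0 α / (1 + α)

section LocalParam

variable {m : ℕ} {f : ℝ → ℝ} {α σ : ℝ} {β b : EuclideanSpace ℝ (Fin (m + 1))} {s2 : ℝ}

lemma localParam_ofLocalParam (hσ : 0 < σ) {θ : (Fin (m + 1) → ℝ) × ℝ} (hθ : 0 < θ.2) :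
    localParam β σ (ofLocalParam β σ θ).1 (ofLocalParam β σ θ).2 = θ := by
  have h : √((σ / θ.2) ^ 2) = σ / θ.2 := Real.sqrt_sq (by positivity)
  ext j
  · simp only [localParam, ofLocalParam, h, PiLp.add_apply, PiLp.smul_apply, smul_eq_mul]
    field_simp
    ring
  · simp only [localParam, ofLocalParam, h]
    field_simp

/-- Inserting the model, `y - b'w` is `η - (b - β)'w` with `w` the regressor, and division by `√s2`
leaves a function linear in the new parameter. -/
lemma linResidual_localParam (hσ : σ ≠ 0) {y η : ℝ} {w : Fin m → ℝ}
    (hy : y = ∑ j, β j * regressor w j + η) :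
    linResidual (η / σ, regressor w) (localParam β σ b s2) = stdResidual y w b s2 := by
  have h : ∑ j, (b j - β j) / √s2 * regressor w j
      = (∑ j, b j * regressor w j - ∑ j, β j * regressor w j) / √s2 := by
    rw [← Finset.sum_sub_distrib, Finset.sum_div]
    exact Finset.sum_congr rfl fun j _ => by ring
  simp only [linResidual, localParam, stdResidual, h, hy]
  field_simp
  ring

/-- The sample in terms of the errors, computed from the data. -/
def errorOfData {T : ℕ} (β : EuclideanSpace ℝ (Fin (m + 1))) (σ : ℝ)
    (D : Fin T → ℝ × (Fin m → ℝ)) : Fin T → ℝ × (Fin (m + 1) → ℝ) := fun t =>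
  (((D t).1 - ∑ j, β j * regressor (D t).2 j) / σ, regressor (D t).2)

lemma measurable_errorOfData {T : ℕ} :
    Measurable (errorOfData β σ : (Fin T → ℝ × (Fin m → ℝ)) → _) := by
  refine measurable_pi_lambda _ fun t => ?_
  have h : Measurable fun D : Fin T → ℝ × (Fin m → ℝ) => regressor (D t).2 :=
    measurable_regressor.comp (by fun_prop)
  have h' : Measurable fun D : Fin T → ℝ × (Fin m → ℝ) => ∑ j, β j * regressor (D t).2 j :=
    Finset.measurable_sum _ fun j _ => ((measurable_pi_apply j).comp h).const_mul _
  refine Measurable.prodMk (Measurable.div_const (Measurable.sub ?_ h') σ) h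
  fun_prop

/-- Premultiplication by an invertible matrix and nonzero constants does not change the zeros. A
nonempty sample is needed for the average of the centering constant to be that constant. -/
lemma isRoot_iff {S : Matrix (Fin (m + 1)) (Fin (m + 1)) ℝ} (hS : IsUnit S.det) {a d : ℝ}
    (ha : a ≠ 0) (hd : d ≠ 0) (hσ : σ ≠ 0) {T : ℕ} (hT : 0 < T) (D : Fin T → ℝ × (Fin m → ℝ)) :
    IsRoot f α D b s2 ↔ 0 < s2 ∧ scaledScore (wscore f α) (centeredScaleScore f α) S a d
      (errorOfData β σ D) (localParam β σ b s2) = 0 := by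
  have hT' : (T : ℝ) ≠ 0 := by positivity
  have hres : ∀ t, linResidual (errorOfData β σ D t) (localParam β σ b s2)
      = stdResidual (D t).1 (D t).2 b s2 := fun t => linResidual_localParam hσ (by ring)
  have hx : ∀ t, (errorOfData β σ D t).2 = regressor (D t).2 := fun _ => rfl
  have hinj : ∀ v : Fin (m + 1) → ℝ, a⁻¹ • S⁻¹.mulVec v = 0 ↔ v = 0 := fun v => by
    rw [smul_eq_zero, or_iff_right (inv_ne_zero ha)]
    refine ⟨fun h => ?_, fun h => by rw [h, Matrix.mulVec_zero]⟩
    have := congrArg S.mulVec h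
    rwa [Matrix.mulVec_mulVec, Matrix.mul_nonsing_inv _ hS, Matrix.one_mulVec,
      Matrix.mulVec_zero] at this
  simp only [IsRoot, scaledScore, hres, hx, Prod.mk_eq_zero, hinj, funext_iff, Pi.zero_apply,
    mul_eq_zero, inv_eq_zero, hT', hd, false_or, neg_eq_zero, centeredScaleScore,
    Finset.sum_sub_distrib, Finset.sum_const, Finset.card_univ, Fintype.card_fin, nsmul_eq_mul,
    sub_eq_zero, scaleScore, wscore]
  rw [inv_mul_eq_iff_eq_mul₀ hT']

end LocalParam

namespace IsModel

variable {Ω : Type*} [MeasurableSpace Ω] {P : Measure Ω} {m : ℕ}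
  {f : ℝ → ℝ} {σ : ℝ} {β : EuclideanSpace ℝ (Fin (m + 1))}
  {Sx : Matrix (Fin (m + 1)) (Fin (m + 1)) ℝ} {y η : ℕ → Ω → ℝ} {w : ℕ → Ω → Fin m → ℝ}

lemma errorOfData_sample (hM : IsModel P f σ β Sx y η w) (T : ℕ) (ω : Ω) :
    errorOfData β σ (sample y w T ω)
      = errorSample (fun t ω => η t ω / σ) (fun t ω => regressor (w t ω)) T ω := by
  funext t
  simp [errorOfData, sample, errorSample, hM.outcome]

lemma measurable_outcome (hM : IsModel P f σ β Sx y η w) (t : ℕ) : Measurable (y t) := by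
  have h : Measurable fun ω => ∑ j, β j * regressor (w t ω) j + η t ω :=
    (Finset.measurable_sum _ fun j _ => ((measurable_pi_apply j).comp
      (measurable_regressor.comp (hM.measurable_control t))).const_mul _).add (hM.measurable_error t)
  exact (funext fun ω => hM.outcome t ω : y t = _) ▸ h

lemma measurable_sample (hM : IsModel P f σ β Sx y η w) (T : ℕ) : Measurable (sample y w T) :=
  measurable_pi_lambda _ fun t => (hM.measurable_outcome t).prodMk (hM.measurable_control t)

end IsModel

section IsRootMeasurable

variable {Ω : Type*} [MeasurableSpace Ω] {P : Measure Ω} {m : ℕ} {f : ℝ → ℝ} {α : ℝ}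

/-- Used to turn a probability tending to one into an exceptional event of probability tending to
zero, for estimators that are only almost everywhere measurable. -/
lemma nullMeasurableSet_isRoot (hf : Measurable f) {T : ℕ}
    {D : Ω → Fin T → ℝ × (Fin m → ℝ)} (hD : Measurable D)
    {b : Ω → EuclideanSpace ℝ (Fin (m + 1))} (hb : AEMeasurable b P) {s2 : Ω → ℝ}
    (hs2 : AEMeasurable s2 P) : NullMeasurableSet {ω | IsRoot f α (D ω) (b ω) (s2 ω)} P := by
  have hx : ∀ t j, Measurable fun ω => regressor (D ω t).2 j := fun t j =>
    (measurable_pi_apply j).comp (measurable_regressor.comp (by fun_prop))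
  have hbj : ∀ j, AEMeasurable (fun ω => b ω j) P := fun j =>
    ((PiLp.continuous_apply 2 (fun _ => ℝ) j).measurable).comp_aemeasurable hb
  have hr : ∀ t, AEMeasurable (fun ω => stdResidual (D ω t).1 (D ω t).2 (b ω) (s2 ω)) P := fun t => by
    have h1 : AEMeasurable (fun ω => ∑ j, b ω j * regressor (D ω t).2 j) P :=
      Finset.aemeasurable_fun_sum _ fun j _ => (hbj j).mul (hx t j).aemeasurable
    have h2 : AEMeasurable (fun ω => (D ω t).1) P := by fun_prop
    exact (h2.sub h1).div (Real.continuous_sqrt.measurable.comp_aemeasurable hs2)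
  have hscore : Measurable (score f) := (measurable_deriv f).div hf
  have hfr := fun t => hf.comp_aemeasurable (hr t)
  have hur := fun t => hscore.comp_aemeasurable (hr t)
  refine (nullMeasurableSet_lt aemeasurable_const hs2).inter (NullMeasurableSet.inter ?_ ?_)
  · have h : ∀ j, NullMeasurableSet {ω | ∑ t, f (stdResidual (D ω t).1 (D ω t).2 (b ω) (s2 ω)) ^ α
        * score f (stdResidual (D ω t).1 (D ω t).2 (b ω) (s2 ω)) * regressor (D ω t).2 j = 0} P :=
      fun j => nullMeasurableSet_eq_fun (Finset.aemeasurable_fun_sum _ fun t _ =>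
        (((hfr t).pow_const α).mul (hur t)).mul (hx t j).aemeasurable) aemeasurable_const
    have := NullMeasurableSet.iInter h
    rw [← Set.ofPred_forall] at this
    exact this
  · refine nullMeasurableSet_eq_fun (AEMeasurable.const_mul
      (Finset.aemeasurable_fun_sum _ fun t _ => ?_) _) aemeasurable_const
    exact (aemeasurable_const.add ((hr t).mul (hur t))).mul ((hfr t).pow_const α)

variable [IsProbabilityMeasure P]

lemma withHighProb_of_tendsto_one {A : ℕ → Ω → Prop} (hA : ∀ T, NullMeasurableSet {ω | A T ω} P)
    (h : Tendsto (fun T => P {ω | A T ω}) atTop (𝓝 1)) : WithHighProb P A := fun ε hε => by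
  have hlt : 1 - ENNReal.ofReal ε < 1 :=
    ENNReal.sub_lt_self ENNReal.one_ne_top one_ne_zero (ENNReal.ofReal_pos.2 hε).ne'
  filter_upwards [h.eventually_const_lt hlt] with T hT
  refine ENNReal.toReal_le_of_le_ofReal hε.le ?_
  change P {ω | A T ω}ᶜ ≤ _
  rw [prob_compl_eq_one_sub₀ (hA T)]
  exact tsub_le_iff_tsub_le.1 hT.le

lemma WithHighProb.tendsto_one {A : ℕ → Ω → Prop} (h : WithHighProb P A) :
    Tendsto (fun T => P {ω | A T ω}) atTop (𝓝 1) := by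
  refine tendsto_order.2 ⟨fun c hc => ?_, fun c hc => Eventually.of_forall fun T =>
    prob_le_one.trans_lt hc⟩
  have hc' : 0 < (1 - c).toReal := ENNReal.toReal_pos (tsub_pos_of_lt hc).ne'
    (ENNReal.sub_ne_top ENNReal.one_ne_top)
  filter_upwards [h ((1 - c).toReal / 2) (by positivity)] with T hT
  by_contra hcon
  have h1 : (1 : ENNReal) ≤ P {ω | A T ω} + P {ω | ¬A T ω} := by
    rw [← measure_univ (μ := P)]
    refine (measure_mono fun ω _ => ?_).trans (measure_union_le _ _)
    exact em (A T ω)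
  have h2 : P {ω | ¬A T ω} < 1 - c := by
    rw [← ENNReal.toReal_lt_toReal (measure_ne_top _ _) (ENNReal.sub_ne_top ENNReal.one_ne_top)]
    exact hT.trans_lt (half_lt_self hc')
  have h3 : P {ω | A T ω} + P {ω | ¬A T ω} < c + (1 - c) :=
    ENNReal.add_lt_add_of_le_of_lt (measure_ne_top _ _) (not_lt.1 hcon) h2
  rw [add_tsub_cancel_of_le hc.le] at h3
  exact absurd h1 (not_le.2 h3)

end IsRootMeasurable

end

end MDPDE

/-! ### Asymptotic normality and existence of consistent roots -/

namespace MDPDE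

noncomputable section

section Tools

variable {Ω : Type*} [MeasurableSpace Ω] {P : Measure Ω} [IsProbabilityMeasure P]

lemma tendstoInMeasure_map₂_of_continuousAt {E F G : Type*} [PseudoMetricSpace E]
    [PseudoMetricSpace F] [PseudoMetricSpace G] {X : ℕ → Ω → E} {Y : ℕ → Ω → F} {a : E} {b : F}
    (hX : TendstoInMeasure P X atTop fun _ => a) (hY : TendstoInMeasure P Y atTop fun _ => b)
    {g : E → F → G} (hg : ContinuousAt (fun q : E × F => g q.1 q.2) (a, b)) :
    TendstoInMeasure P (fun T ω => g (X T ω) (Y T ω)) atTop fun _ => g a b :=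
  tendstoInMeasure_iff_withHighProb.2 fun ε hε => by
    obtain ⟨δ, hδ, h⟩ := Metric.continuousAt_iff.1 hg ε hε
    refine ((tendstoInMeasure_iff_withHighProb.1 hX δ hδ).and
      (tendstoInMeasure_iff_withHighProb.1 hY δ hδ)).mono fun T ω hω => ?_
    exact h (x := (X T ω, Y T ω)) (max_lt hω.1 hω.2)

lemma tendstoInDistribution_id_of_map_eq {E Ω' : Type*} [TopologicalSpace E] [MeasurableSpace E]
    [OpensMeasurableSpace E] [MeasurableSpace Ω'] {X : ℕ → Ω → E} {Z : Ω' → E} {μ' : Measure Ω'}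
    [IsProbabilityMeasure μ'] {μ : Measure E} [IsProbabilityMeasure μ]
    (h : TendstoInDistribution X atTop Z (fun _ => P) μ') (hμ : μ'.map Z = μ) :
    TendstoInDistribution X atTop id (fun _ => P) μ := by
  subst hμ
  refine ⟨h.forall_aemeasurable, aemeasurable_id, ?_⟩
  simpa only [Measure.map_id] using h.tendsto

end Tools

namespace IsModel

variable {Ω : Type*} [MeasurableSpace Ω] {P : Measure Ω} [IsProbabilityMeasure P] {m : ℕ}
  {f : ℝ → ℝ} {α σ : ℝ} {β : EuclideanSpace ℝ (Fin (m + 1))}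
  {Sx : Matrix (Fin (m + 1)) (Fin (m + 1)) ℝ} {y η : ℕ → Ω → ℝ} {w : ℕ → Ω → Fin m → ℝ}
  {b : ℕ → Ω → EuclideanSpace ℝ (Fin (m + 1))} {s2 : ℕ → Ω → ℝ}

lemma tendstoInMeasure_localParam (hσ : 0 < σ) (h : IsConsistentRootSeq P f α σ β y w b s2) :
    TendstoInMeasure P (fun T ω => localParam β σ (b T ω) (s2 T ω)) atTop fun _ => (0, 1) := by
  have hsq : √(σ ^ 2) = σ := Real.sqrt_sq hσ.le
  have hc : ContinuousAt (fun q : EuclideanSpace ℝ (Fin (m + 1)) × ℝ => localParam β σ q.1 q.2)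
      (β, σ ^ 2) := by
    have hne : √(σ ^ 2) ≠ 0 := by rw [hsq]; exact hσ.ne'
    have h2 : ContinuousAt (fun q : EuclideanSpace ℝ (Fin (m + 1)) × ℝ => √q.2) (β, σ ^ 2) :=
      (Real.continuous_sqrt.comp continuous_snd).continuousAt
    have h1 : ∀ j, ContinuousAt (fun q : EuclideanSpace ℝ (Fin (m + 1)) × ℝ => q.1 j - β j)
        (β, σ ^ 2) := fun j =>
      (((PiLp.continuous_apply 2 (fun _ => ℝ) j).comp continuous_fst).sub
        continuous_const).continuousAt
    exact (continuousAt_pi.2 fun j => (h1 j).div h2 hne).prodMk (continuousAt_const.div h2 hne)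
  have h1 : localParam β σ β (σ ^ 2) = (0, 1) := by
    ext j
    · simp [localParam]
    · simp [localParam, hsq, hσ.ne']
  have hlim := tendstoInMeasure_map₂_of_continuousAt h.consistent_beta h.consistent_sigma
    (g := localParam β σ) hc
  rw [h1] at hlim
  exact hlim

lemma withHighProb_scaledScore_eq_zero (hM : IsModel P f σ β Sx y η w) (hf : Measurable f)
    (hσ : 0 < σ) {a d : ℝ} (ha : a ≠ 0) (hd : d ≠ 0)
    (h : IsConsistentRootSeq P f α σ β y w b s2) :
    WithHighProb P fun T ω => 0 < s2 T ω ∧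
      scaledScore (wscore f α) (centeredScaleScore f α) Sx a d
        (errorSample (fun t ω => η t ω / σ) (fun t ω => regressor (w t ω)) T ω)
        (localParam β σ (b T ω) (s2 T ω)) = 0 := by
  refine (withHighProb_of_tendsto_one (fun T => nullMeasurableSet_isRoot hf (hM.measurable_sample T)
    (h.aemeasurable_beta T) (h.aemeasurable_sigma T)) h.isRoot).mono' ?_
  filter_upwards [eventually_gt_atTop 0] with T hT ω hω
  rw [← hM.errorOfData_sample]
  exact (isRoot_iff hM.posDef.det_pos.ne'.isUnit ha hd hσ.ne' hT _).1 hω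

/-- Joint asymptotic normality of consistent roots. -/
theorem tendstoInDistribution_root (hM : IsModel P f σ β Sx y η w) (hf : Measurable f)
    (hσ : 0 < σ) (hD : IsDesign P (errorLaw f) (fun t ω => η t ω / σ)
      (fun t ω => regressor (w t ω)) Sx) {ψ' χ' : ℝ → ℝ} {a d v₁ v₂ : ℝ}
    (hE : IsEstimatingPair (errorLaw f) (wscore f α) (centeredScaleScore f α) ψ' χ' a d v₁ v₂)
    (h : IsConsistentRootSeq P f α σ β y w b s2) :
    TendstoInDistribution
      (fun (T : ℕ) ω => (√(T : ℝ) • (b T ω - β), √(T : ℝ) * (s2 T ω - σ ^ 2))) atTop id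
      (fun _ => P)
      ((multivariateGaussian 0 (((-(σ / a)) ^ 2 * v₁) • Sx⁻¹)).prod
        (gaussianReal 0 ((-(2 * σ ^ 2 / d)) ^ 2 * v₂).toNNReal)) := by
  have ha := hE.pos_loc
  have hd := hE.pos_scale
  have hS := hM.posDef
  have hroot := hM.withHighProb_scaledScore_eq_zero hf hσ ha.ne' hd.ne' h
  have hloc := tendstoInMeasure_localParam hσ h
  have hN := hD.isNearIdentityInProb hE hS.det_pos.ne'.isUnit
  have hb := hD.boundedInProb_scaledScore hE hS
  have hA := hN.boundedInProb_root hb (hroot.mono fun _ _ h => h.2) hloc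
  have hB := hN.tendstoInMeasure_root hb (hroot.mono fun _ _ h => h.2) hloc
  -- The multipliers come from linearizing at the truth: `b - β = √s2 κ ≈ σ κ`, and `s2 - σ² ≈
  -- -2σ²(l - 1)` because `s2 = σ²/l²`. To first order, `κ` and `l - 1` are minus the components of
  -- the scaled score.
  refine tendstoInDistribution_of_tendstoInMeasure_sub _ _
    (hD.tendstoInDistribution_scores hE hS (-(σ / a)) (-(2 * σ ^ 2 / d))) ?_
    fun T => ?_
  swap
  · have h1 : AEMeasurable (fun ω => √(T : ℝ) • (b T ω - β)) P :=
      ((h.aemeasurable_beta T).sub_const β).const_smul (√(T : ℝ))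
    exact h1.prodMk (((h.aemeasurable_sigma T).sub_const (σ ^ 2)).const_mul _)
  -- The roots are expanded in the sup norm, the conclusion is Euclidean; `c` compares the two.
  obtain ⟨c, hc0, hc⟩ : ∃ c : ℝ, 0 ≤ c ∧ ∀ v : Fin (m + 1) → ℝ, ‖WithLp.toLp 2 v‖ ≤ c * ‖v‖ := by
    have hl := PiLp.lipschitzWith_toLp 2 (fun _ : Fin (m + 1) => ℝ)
    exact ⟨_, NNReal.coe_nonneg _, fun v => hl.norm_le_mul rfl v⟩
  -- `r` collects the errors made by freezing the coefficients `√s2` and `√s2 (√s2 + σ)` at their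
  -- limits `σ` and `2σ²`; it vanishes at `σ²`, so its product with the tight term is negligible.
  set r : ℝ → ℝ := fun s => (c + 1) * (|√s - σ| + |√s * (√s + σ) - 2 * σ ^ 2|) with hr
  have hr0 : TendstoInMeasure P (fun T ω => r (s2 T ω)) atTop fun _ => 0 := by
    have h1 : r (σ ^ 2) = 0 := by
      have hsq : √(σ ^ 2) = σ := Real.sqrt_sq hσ.le
      simp only [hr, hsq]
      ring_nf
      simp
    have h2 : ContinuousAt r (σ ^ 2) := by simp only [hr]; fun_prop
    simpa only [h1] using tendstoInMeasure_map_of_continuousAt h.consistent_sigma h2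
  refine hA.tendstoInMeasure_zero_of_add hr0 hB (c * σ + 2 * σ ^ 2) (hroot.mono fun T ω hω => ?_)
  obtain ⟨hs, -⟩ := hω
  have hq : 0 < √(s2 T ω) := Real.sqrt_pos.2 hs
  have hqq : √(s2 T ω) * √(s2 T ω) = s2 T ω := Real.mul_self_sqrt hs.le
  set q := √(s2 T ω) with hq_def
  set θ := localParam β σ (b T ω) (s2 T ω) with hθ
  have hθ2 : (θ.2 - 1) * q = σ - q := by
    simp only [hθ, localParam, ← hq_def]
    field_simp
  have hθ1 : b T ω - β = q • WithLp.toLp 2 θ.1 := by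
    ext j
    simp only [hθ, localParam, ← hq_def, PiLp.sub_apply, PiLp.smul_apply, smul_eq_mul]
    field_simp
  set A := √(T : ℝ) • (θ - (0, 1)) with hAdef
  have hB' := sqrt_smul_scaledScore (wscore f α) (centeredScaleScore f α) Sx a d
    (fun t ω => η t ω / σ) (fun t ω => regressor (w t ω)) T ω
  set Z := √(T : ℝ) • scaledScore (wscore f α) (centeredScaleScore f α) Sx a d
    (errorSample (fun t ω => η t ω / σ) (fun t ω => regressor (w t ω)) T ω) (0, 1) with hZ
  have hA1 : A.1 = √(T : ℝ) • θ.1 := by simp [hAdef]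
  have hA2 : A.2 = √(T : ℝ) * (θ.2 - 1) := by simp [hAdef]
  set U := Sx⁻¹.mulVec (fun j => (√(T : ℝ))⁻¹ * ∑ t : Fin T,
    wscore f α (η t ω / σ) * regressor (w t ω) j) with hU
  set V := (√(T : ℝ))⁻¹ * ∑ t : Fin T, centeredScaleScore f α (η t ω / σ) with hV
  have hZ1 : Z.1 = a⁻¹ • U := by rw [hB']
  have hZ2 : Z.2 = -(d⁻¹ * V) := by rw [hB']
  have e1 : √(T : ℝ) • (b T ω - β) - (-(σ / a)) • WithLp.toLp 2 U
      = WithLp.toLp 2 ((q - σ) • A.1 + σ • (A + Z).1) := by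
    rw [hθ1, Prod.fst_add, hA1, hZ1]
    ext j
    simp only [PiLp.sub_apply, PiLp.smul_apply, smul_eq_mul, Pi.add_apply, Pi.smul_apply]
    ring
  have e2 : √(T : ℝ) * (s2 T ω - σ ^ 2) - (-(2 * σ ^ 2 / d)) * V
      = -((q * (q + σ) - 2 * σ ^ 2) * A.2) - 2 * σ ^ 2 * (A + Z).2 := by
    have hs2 : s2 T ω - σ ^ 2 = -((θ.2 - 1) * q) * (q + σ) := by
      rw [hθ2, ← hqq]; ring
    rw [hs2, Prod.snd_add, hA2, hZ2]
    ring
  have n1 : ‖(q - σ) • A.1 + σ • (A + Z).1‖ ≤ |q - σ| * ‖A‖ + σ * ‖A + Z‖ := by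
    refine (norm_add_le _ _).trans (add_le_add ?_ ?_)
    · rw [norm_smul]
      exact mul_le_mul_of_nonneg_left (norm_fst_le _) (norm_nonneg _)
    · rw [norm_smul, Real.norm_of_nonneg hσ.le]
      exact mul_le_mul_of_nonneg_left (norm_fst_le _) hσ.le
  have n2 : |-((q * (q + σ) - 2 * σ ^ 2) * A.2) - 2 * σ ^ 2 * (A + Z).2|
      ≤ |q * (q + σ) - 2 * σ ^ 2| * ‖A‖ + 2 * σ ^ 2 * ‖A + Z‖ := by
    refine (abs_sub _ _).trans (add_le_add ?_ ?_)
    · rw [abs_neg, abs_mul]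
      exact mul_le_mul_of_nonneg_left (norm_snd_le A) (abs_nonneg _)
    · rw [abs_mul, abs_of_nonneg (by positivity : 0 ≤ 2 * σ ^ 2)]
      exact mul_le_mul_of_nonneg_left (norm_snd_le (A + Z)) (by positivity)
  have hrr : |r (s2 T ω)| = (c + 1) * (|q - σ| + |q * (q + σ) - 2 * σ ^ 2|) :=
    abs_of_nonneg (by positivity)
  have p1 := mul_nonneg (abs_nonneg (q - σ)) (norm_nonneg A)
  have p2 := mul_nonneg (abs_nonneg (q * (q + σ) - 2 * σ ^ 2)) (norm_nonneg A)
  have p3 := mul_nonneg hσ.le (norm_nonneg (A + Z))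
  have p4 : 0 ≤ σ ^ 2 * ‖A + Z‖ := by positivity
  change ‖(√(T : ℝ) • (b T ω - β) - (-(σ / a)) • WithLp.toLp 2 U,
    √(T : ℝ) * (s2 T ω - σ ^ 2) - (-(2 * σ ^ 2 / d)) * V)‖ ≤ _
  rw [hrr, e1, e2]
  refine max_le ((hc _).trans ((mul_le_mul_of_nonneg_left n1 hc0).trans ?_)) (n2.trans ?_)
  · nlinarith [mul_nonneg hc0 p2]
  · nlinarith [mul_nonneg hc0 p2, mul_nonneg hc0 p1, mul_nonneg hc0 p3]

/-- Existence of measurable consistent roots. -/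
theorem exists_consistentRootSeq (hM : IsModel P f σ β Sx y η w) (hσ : 0 < σ)
    (hD : IsDesign P (errorLaw f) (fun t ω => η t ω / σ)
      (fun t ω => regressor (w t ω)) Sx) {ψ' χ' : ℝ → ℝ} {a d v₁ v₂ : ℝ}
    (hE : IsEstimatingPair (errorLaw f) (wscore f α) (centeredScaleScore f α) ψ' χ' a d v₁ v₂) :
    ∃ est : (T : ℕ) → (Fin T → ℝ × (Fin m → ℝ)) → EuclideanSpace ℝ (Fin (m + 1)) × ℝ,
      (∀ T, Measurable (est T)) ∧
      IsConsistentRootSeq P f α σ β y w (fun T ω => (est T (sample y w T ω)).1)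
        (fun T ω => (est T (sample y w T ω)).2) := by
  have hS := hM.posDef
  have hψ : Continuous (wscore f α) := continuous_iff_continuousAt.2 fun z =>
    (hE.hasDerivAt_loc z).continuousAt
  have hχ : Continuous (centeredScaleScore f α) := continuous_iff_continuousAt.2 fun z =>
    (hE.hasDerivAt_scale z).continuousAt
  -- The iteration starts at the true parameter. The map therefore depends on `β`, `σ` and `Sx`,
  -- which an existence claim permits; as a function of the data it is measurable.
  set θ : (T : ℕ) → (Fin T → ℝ × (Fin m → ℝ)) → (Fin (m + 1) → ℝ) × ℝ := fun T D =>
    limUnder atTop fun n => (newtonStep (scaledScore (wscore f α) (centeredScaleScore f α) Sx a d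
      (errorOfData β σ D)))^[n] (0, 1) with hθ
  have hθm : ∀ T, Measurable (θ T) := fun T =>
    (measurable_limUnder_newton Sx a d hψ hχ (0, 1)).comp measurable_errorOfData
  have hinv : Measurable (ofLocalParam β σ) := by
    have h1 : Measurable fun θ : (Fin (m + 1) → ℝ) × ℝ => WithLp.toLp 2 θ.1 :=
      (PiLp.continuous_toLp 2 _).measurable.comp measurable_fst
    have h2 : Measurable fun θ : (Fin (m + 1) → ℝ) × ℝ => σ / θ.2 :=
      measurable_const.div measurable_snd
    exact Measurable.prodMk ((h2.smul h1).const_add β) (h2.pow_const 2)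
  have hm : ∀ T, Measurable fun D => ofLocalParam β σ (θ T D) := fun T => hinv.comp (hθm T)
  obtain ⟨hroot, hcons⟩ := (hD.isNearIdentityInProb hE hS.det_pos.ne'.isUnit).limUnder_newton
    (hD.tendstoInMeasure_scaledScore hE hS)
  simp only [← hM.errorOfData_sample] at hroot hcons
  have hc : ContinuousAt (ofLocalParam β σ) (0, 1) := by
    unfold ofLocalParam
    have h2 : ContinuousAt (fun θ : (Fin (m + 1) → ℝ) × ℝ => σ / θ.2) (0, 1) :=
      ContinuousAt.div continuousAt_const continuousAt_snd one_ne_zero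
    have h1 : ContinuousAt (fun θ : (Fin (m + 1) → ℝ) × ℝ => WithLp.toLp 2 θ.1) (0, 1) :=
      (PiLp.continuous_toLp 2 _).continuousAt.comp continuousAt_fst
    exact ContinuousAt.prodMk (continuousAt_const.add (h2.smul h1)) (h2.pow 2)
  have hlim := tendstoInMeasure_map_of_continuousAt hcons hc
  have hval : ofLocalParam β σ (0, 1) = (β, σ ^ 2) := by simp [ofLocalParam]
  rw [hval] at hlim
  refine ⟨fun T D => ofLocalParam β σ (θ T D), hm, fun T =>
    ((measurable_fst.comp (hm T)).comp (hM.measurable_sample T)).aemeasurable, fun T =>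
    ((measurable_snd.comp (hm T)).comp (hM.measurable_sample T)).aemeasurable, ?_,
    tendstoInMeasure_map_of_continuousAt hlim continuousAt_fst,
    tendstoInMeasure_map_of_continuousAt hlim continuousAt_snd⟩
  refine WithHighProb.tendsto_one ((hroot.and
    (tendstoInMeasure_iff_withHighProb.1 hcons 1 one_pos)).mono' ?_)
  filter_upwards [eventually_gt_atTop 0] with T hT ω hω
  obtain ⟨h1, h2⟩ := hω
  -- Being within distance one of `(0, 1)` makes the scale coordinate positive, so the change of
  -- coordinates can be inverted and the variance is positive.
  have hpos : 0 < (θ T (sample y w T ω)).2 := by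
    have h3 := (max_lt_iff.1 h2).2
    rw [Real.dist_eq, abs_lt] at h3
    simp only [hθ]
    linarith [h3.1]
  refine (isRoot_iff (β := β) hS.det_pos.ne'.isUnit hE.pos_loc.ne' hE.pos_scale.ne' hσ.ne' hT _).2
    ⟨?_, ?_⟩
  · simp only [ofLocalParam]; positivity
  · rw [localParam_ofLocalParam hσ hpos]
    exact h1

end IsModel

end

end MDPDE

/-! ### The standard normal density -/

namespace MDPDE

noncomputable section

section GaussianMoments

variable {b : ℝ}

lemma integrable_pow_mul_exp (hb : 0 < b) (n : ℕ) :
    Integrable fun s : ℝ => s ^ n * Real.exp (-b * s ^ 2) := by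
  have h := integrable_rpow_mul_exp_neg_mul_sq hb (s := n)
    (by have : (0 : ℝ) ≤ n := n.cast_nonneg; linarith)
  simpa only [Real.rpow_natCast] using h

/-- The derivative of `s^n exp(-b s²)` integrates to zero. At `n = 0` the truncated exponent `n - 1`
is harmless because of the factor `n`, and the first moment vanishes. -/
lemma integral_pow_succ_mul_exp (hb : 0 < b) (n : ℕ) :
    ∫ s : ℝ, s ^ (n + 1) * Real.exp (-b * s ^ 2)
      = n / (2 * b) * ∫ s : ℝ, s ^ (n - 1) * Real.exp (-b * s ^ 2) := by
  have hderiv : ∀ s : ℝ, HasDerivAt (fun s => s ^ n * Real.exp (-b * s ^ 2))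
      (n * (s ^ (n - 1) * Real.exp (-b * s ^ 2))
        - 2 * b * (s ^ (n + 1) * Real.exp (-b * s ^ 2))) s := fun s => by
    have h1 : HasDerivAt (fun s : ℝ => -b * s ^ 2) (-b * (2 * s)) s := by
      simpa using (hasDerivAt_pow 2 s).const_mul (-b)
    have h2 : HasDerivAt (fun s => s ^ n * Real.exp (-b * s ^ 2)) _ s :=
      (hasDerivAt_pow n s).mul h1.exp
    exact h2.congr_deriv (by ring)
  have hi1 := (integrable_pow_mul_exp hb (n - 1)).const_mul (n : ℝ)
  have hi2 := (integrable_pow_mul_exp hb (n + 1)).const_mul (2 * b)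
  have h0 := integral_eq_zero_of_hasDerivAt_of_integrable hderiv (hi1.sub hi2)
    (integrable_pow_mul_exp hb n)
  rw [integral_sub hi1 hi2, integral_const_mul, integral_const_mul, sub_eq_zero] at h0
  rw [div_mul_eq_mul_div, eq_div_iff (by positivity), h0]
  ring

lemma integral_sq_mul_exp (hb : 0 < b) :
    ∫ s : ℝ, s ^ 2 * Real.exp (-b * s ^ 2) = 1 / (2 * b) * √(Real.pi / b) := by
  rw [integral_pow_succ_mul_exp hb 1]
  simp only [Nat.cast_one, Nat.sub_self, pow_zero, one_mul, integral_gaussian]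

lemma integral_pow_four_mul_exp (hb : 0 < b) :
    ∫ s : ℝ, s ^ 4 * Real.exp (-b * s ^ 2) = 3 / (2 * b) * (1 / (2 * b) * √(Real.pi / b)) := by
  rw [integral_pow_succ_mul_exp hb 3, ← integral_sq_mul_exp hb]
  norm_num

lemma integral_id_mul_exp (hb : 0 < b) : ∫ s : ℝ, s ^ 1 * Real.exp (-b * s ^ 2) = 0 := by
  rw [integral_pow_succ_mul_exp hb 0]
  simp

lemma integral_cube_mul_exp (hb : 0 < b) : ∫ s : ℝ, s ^ 3 * Real.exp (-b * s ^ 2) = 0 := by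
  rw [integral_pow_succ_mul_exp hb 2]
  rw [show (2 - 1 : ℕ) = 1 from rfl, integral_id_mul_exp hb, mul_zero]

end GaussianMoments

section StandardNormal

lemma gaussianPDFReal_std (s : ℝ) :
    gaussianPDFReal 0 1 s = (√(2 * Real.pi))⁻¹ * Real.exp (-(1 / 2) * s ^ 2) := by
  rw [gaussianPDFReal]
  simp only [NNReal.coe_one, mul_one, sub_zero]
  congr 2
  ring

lemma gaussianPDFReal_std_pos (s : ℝ) : 0 < gaussianPDFReal 0 1 s :=
  gaussianPDFReal_pos 0 1 s one_ne_zero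

lemma hasDerivAt_gaussianPDFReal_std (s : ℝ) :
    HasDerivAt (gaussianPDFReal 0 1) (-s * gaussianPDFReal 0 1 s) s := by
  have h1 : HasDerivAt (fun s : ℝ => -(1 / 2) * s ^ 2) (-(1 / 2) * (2 * s)) s := by
    simpa using (hasDerivAt_pow 2 s).const_mul (-(1 / 2) : ℝ)
  have h2 := h1.exp.const_mul (√(2 * Real.pi))⁻¹
  rw [show gaussianPDFReal 0 1 = fun s => (√(2 * Real.pi))⁻¹ * Real.exp (-(1 / 2) * s ^ 2) from
    funext gaussianPDFReal_std]
  exact h2.congr_deriv (by ring)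

lemma score_gaussianPDFReal_std (s : ℝ) : score (gaussianPDFReal 0 1) s = -s := by
  rw [score, (hasDerivAt_gaussianPDFReal_std s).deriv,
    mul_div_cancel_right₀ _ (gaussianPDFReal_std_pos s).ne']

lemma gaussianPDFReal_std_rpow (s p : ℝ) : gaussianPDFReal 0 1 s ^ p
    = (√(2 * Real.pi))⁻¹ ^ p * Real.exp (-(p / 2) * s ^ 2) := by
  rw [gaussianPDFReal_std, Real.mul_rpow (by positivity) (Real.exp_pos _).le, ← Real.exp_mul]
  congr 2
  ring

lemma M_integrand_gaussianPDFReal_std (i j : ℕ) (a s : ℝ) :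
    s ^ i * score (gaussianPDFReal 0 1) s ^ j * gaussianPDFReal 0 1 s ^ (1 + a)
      = ((-1) ^ j * (√(2 * Real.pi))⁻¹ ^ (1 + a))
        * (s ^ (i + j) * Real.exp (-((1 + a) / 2) * s ^ 2)) := by
  rw [score_gaussianPDFReal_std, gaussianPDFReal_std_rpow, neg_pow, pow_add]
  ring

lemma M_gaussianPDFReal_std (i j : ℕ) (a : ℝ) : M (gaussianPDFReal 0 1) i j a
    = ((-1) ^ j * (√(2 * Real.pi))⁻¹ ^ (1 + a))
      * ∫ s : ℝ, s ^ (i + j) * Real.exp (-((1 + a) / 2) * s ^ 2) := by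
  simp only [M, M_integrand_gaussianPDFReal_std, integral_const_mul]

variable {a : ℝ}

lemma M_gaussianPDFReal_std_odd (ha : 0 < 1 + a) :
    M (gaussianPDFReal 0 1) 0 1 a = 0 ∧ M (gaussianPDFReal 0 1) 1 2 a = 0 := by
  constructor
  · rw [M_gaussianPDFReal_std, zero_add, integral_id_mul_exp (half_pos ha), mul_zero]
  · rw [M_gaussianPDFReal_std, integral_cube_mul_exp (half_pos ha), mul_zero]

/-- All the constants are multiples of `∫ f ^ (1 + a)`. -/
lemma M_gaussianPDFReal_std_even (ha : 0 < 1 + a) :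
    M (gaussianPDFReal 0 1) 0 2 a = M (gaussianPDFReal 0 1) 0 0 a / (1 + a) ∧
    M (gaussianPDFReal 0 1) 1 1 a = -(M (gaussianPDFReal 0 1) 0 0 a / (1 + a)) ∧
    M (gaussianPDFReal 0 1) 2 2 a = 3 * M (gaussianPDFReal 0 1) 0 0 a / (1 + a) ^ 2 := by
  have h0 : ∫ s : ℝ, s ^ (0 + 0) * Real.exp (-((1 + a) / 2) * s ^ 2)
      = √(Real.pi / ((1 + a) / 2)) := by
    simp only [add_zero, pow_zero, one_mul, integral_gaussian]
  simp only [M_gaussianPDFReal_std, h0, zero_add, show 1 + 1 = 2 from rfl, show 2 + 2 = 4 from rfl,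
    integral_sq_mul_exp (half_pos ha), integral_pow_four_mul_exp (half_pos ha)]
  refine ⟨?_, ?_, ?_⟩ <;> field_simp

lemma M_zero_zero_gaussianPDFReal_std (a : ℝ) : M (gaussianPDFReal 0 1) 0 0 a
    = (√(2 * Real.pi))⁻¹ ^ (1 + a) * √(2 * Real.pi / (1 + a)) := by
  rw [M_gaussianPDFReal_std]
  simp only [pow_zero, one_mul, add_zero, integral_gaussian]
  rw [div_div_eq_mul_div, mul_comm Real.pi]

/-- The powers of `2π` cancel, leaving the ratio `(1 + a)/√(1 + 2a)`, and `(1 + a)² = (1 + 2a) +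
a²`. It is the only irrational quantity in the two variance factors. -/
lemma M_zero_zero_gaussianPDFReal_std_two_mul (ha : 0 ≤ a) :
    M (gaussianPDFReal 0 1) 0 0 (2 * a)
      = √(1 + a ^ 2 / (1 + 2 * a)) * M (gaussianPDFReal 0 1) 0 0 a ^ 2 := by
  have h2 : 0 < 1 + 2 * a := by linarith
  have h1 : 0 < 1 + a := by linarith
  set p := √(2 * Real.pi) with hp
  have hp0 : 0 < p := by positivity
  have hpp : p ^ 2 = 2 * Real.pi := Real.sq_sqrt (by positivity)
  have hq : √(1 + a ^ 2 / (1 + 2 * a)) = (1 + a) / √(1 + 2 * a) := by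
    rw [show 1 + a ^ 2 / (1 + 2 * a) = (1 + a) ^ 2 / (1 + 2 * a) by field_simp; ring,
      Real.sqrt_div (by positivity), Real.sqrt_sq h1.le]
  have hpow : (p⁻¹ ^ (1 + a)) ^ 2 = p⁻¹ ^ (1 + 2 * a) * p⁻¹ := by
    rw [← Real.rpow_natCast, ← Real.rpow_mul (by positivity), ← Real.rpow_add_one (by positivity)]
    congr 1
    push_cast
    ring
  rw [M_zero_zero_gaussianPDFReal_std, M_zero_zero_gaussianPDFReal_std, hq, ← hp, mul_pow, hpow,
    Real.sq_sqrt (by positivity), Real.sqrt_div (by positivity), ← hp, ← hpp]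
  field_simp

lemma rpow_div_two_eq_sqrt_pow {q : ℝ} (hq : 0 ≤ q) (n : ℕ) : q ^ ((n : ℝ) / 2) = √q ^ n := by
  rw [Real.sqrt_eq_rpow, ← Real.rpow_natCast, ← Real.rpow_mul hq]
  congr 1
  ring

lemma M_zero_zero_gaussianPDFReal_std_pos (ha : 0 ≤ a) : 0 < M (gaussianPDFReal 0 1) 0 0 a := by
  rw [M_zero_zero_gaussianPDFReal_std]
  positivity

lemma vBeta_gaussianPDFReal_std (ha : 0 ≤ a) :
    vBeta (gaussianPDFReal 0 1) a = (1 + a ^ 2 / (1 + 2 * a)) ^ (3 / 2 : ℝ) := by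
  have h1 : 0 < 1 + a := by linarith
  have h2 : 0 < 1 + 2 * a := by linarith
  have hq : 0 ≤ 1 + a ^ 2 / (1 + 2 * a) := by positivity
  have hr := Real.sq_sqrt hq
  have hK := M_zero_zero_gaussianPDFReal_std_pos ha
  have hpow := rpow_div_two_eq_sqrt_pow hq 3
  push_cast at hpow
  rw [hpow, vBeta, zeta11, zeta11, phi1, (M_gaussianPDFReal_std_odd h1).1,
    (M_gaussianPDFReal_std_even h1).1, (M_gaussianPDFReal_std_even h2).1,
    M_zero_zero_gaussianPDFReal_std_two_mul ha]
  have hr' : √(1 + a ^ 2 / (1 + 2 * a)) ^ 2 * (1 + 2 * a) = (1 + a) ^ 2 := by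
    rw [hr]; field_simp; ring
  generalize √(1 + a ^ 2 / (1 + 2 * a)) = r at *
  generalize M (gaussianPDFReal 0 1) 0 0 a = K at *
  field_simp
  linear_combination (-r * K ^ 2) * hr'

lemma vSigma_gaussianPDFReal_std (ha : 0 ≤ a) :
    vSigma (gaussianPDFReal 0 1) a = 4 / (a ^ 2 + 2) ^ 2 *
      (2 * (1 + 2 * a ^ 2) * (1 + a ^ 2 / (1 + 2 * a)) ^ (5 / 2 : ℝ) - a ^ 2 * (1 + a) ^ 2) := by
  have h1 : 0 < 1 + a := by linarith
  have h2 : 0 < 1 + 2 * a := by linarith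
  have hq : 0 ≤ 1 + a ^ 2 / (1 + 2 * a) := by positivity
  have hr := Real.sq_sqrt hq
  have hK := M_zero_zero_gaussianPDFReal_std_pos ha
  have hpow := rpow_div_two_eq_sqrt_pow hq 5
  push_cast at hpow
  obtain ⟨-, e11, e22⟩ := M_gaussianPDFReal_std_even h1
  obtain ⟨-, e11', e22'⟩ := M_gaussianPDFReal_std_even h2
  have hr' : √(1 + a ^ 2 / (1 + 2 * a)) ^ 2 = (1 + a) ^ 2 / (1 + 2 * a) := by
    rw [hr]; field_simp; ring
  rw [hpow, vSigma, zeta22, zeta22, phi2, e11, e22, e11', e22',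
    M_zero_zero_gaussianPDFReal_std_two_mul ha]
  generalize √(1 + a ^ 2 / (1 + 2 * a)) = r at *
  generalize M (gaussianPDFReal 0 1) 0 0 a = K at *
  -- Only one factor `r` comes from `M₀₀(2a)`; the other four are the rational number `((1 + a)²/(1
  -- + 2a))²`, supplied by the denominators.
  have hr5 : r ^ 5 = r * ((1 + a) ^ 2 / (1 + 2 * a)) ^ 2 := by rw [← hr']; ring
  have hz : (3 * K / (1 + a) ^ 2 + 2 * -(K / (1 + a)) + K) / 4
      = K * (a ^ 2 + 2) / (4 * (1 + a) ^ 2) := by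
    field_simp
    ring
  rw [hr5, hz]
  have ha2 : 0 < a ^ 2 + 2 := by positivity
  field_simp
  ring

lemma contDiff_gaussianPDFReal_std : ContDiff ℝ 2 (gaussianPDFReal 0 1) := by
  rw [show gaussianPDFReal 0 1 = fun s => (√(2 * Real.pi))⁻¹ * Real.exp (-(1 / 2) * s ^ 2) from
    funext gaussianPDFReal_std]
  fun_prop

lemma gaussianPDFReal_std_le_one (s : ℝ) : gaussianPDFReal 0 1 s ≤ 1 := by
  rw [gaussianPDFReal_std]
  have h1 : 1 ≤ √(2 * Real.pi) := Real.one_le_sqrt.2 (by linarith [Real.pi_gt_three])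
  have h2 : Real.exp (-(1 / 2) * s ^ 2) ≤ 1 := Real.exp_le_one_iff.2 (by nlinarith [sq_nonneg s])
  exact mul_le_one₀ (inv_le_one_of_one_le₀ h1) (Real.exp_pos _).le h2

lemma integrable_pow_mul_gaussianPDFReal_std (n : ℕ) :
    Integrable fun s => s ^ n * gaussianPDFReal 0 1 s := by
  have h := (integrable_pow_mul_exp (b := 1 / 2) (by norm_num) n).const_mul (√(2 * Real.pi))⁻¹
  refine h.congr (Eventually.of_forall fun s => ?_)
  simp only [gaussianPDFReal_std]
  ring

lemma wscore_gaussianPDFReal_std (a s : ℝ) :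
    wscore (gaussianPDFReal 0 1) a s = -s * gaussianPDFReal 0 1 s ^ a := by
  rw [wscore, score_gaussianPDFReal_std]
  ring

lemma deriv_wscore_gaussianPDFReal_std (a s : ℝ) : deriv (wscore (gaussianPDFReal 0 1) a) s
    = (a * s ^ 2 - 1) * gaussianPDFReal 0 1 s ^ a := by
  have h0 := gaussianPDFReal_std_pos s
  have h1 := (hasDerivAt_gaussianPDFReal_std s).rpow_const (p := a) (Or.inl h0.ne')
  have h2 := (hasDerivAt_neg s).mul h1
  have h3 : wscore (gaussianPDFReal 0 1) a = fun s => -s * gaussianPDFReal 0 1 s ^ a :=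
    funext (wscore_gaussianPDFReal_std a)
  rw [h3]
  refine (HasDerivAt.deriv (f' := _) h2).trans ?_
  rw [Real.rpow_sub_one h0.ne']
  field_simp
  ring

theorem isErrorDensity_gaussianPDFReal_std (ha : 0 ≤ a) :
    IsErrorDensity (gaussianPDFReal 0 1) a where
  pos := gaussianPDFReal_std_pos
  integrable := integrable_gaussianPDFReal 0 1
  integral_eq_one := integral_gaussianPDFReal_eq_one 0 one_ne_zero
  integrable_sq := integrable_pow_mul_gaussianPDFReal_std 2
  mean_zero := by
    have h := integral_id_mul_exp (b := 1 / 2) (by norm_num)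
    simp only [gaussianPDFReal_std, mul_left_comm _ (√(2 * Real.pi))⁻¹, integral_const_mul]
    simp only [pow_one] at h
    rw [h, mul_zero]
  variance_one := by
    have h := integral_sq_mul_exp (b := 1 / 2) (by norm_num)
    simp only [gaussianPDFReal_std, mul_left_comm _ (√(2 * Real.pi))⁻¹, integral_const_mul]
    rw [h, show Real.pi / (1 / 2) = 2 * Real.pi by ring]
    have : √(2 * Real.pi) ≠ 0 := by positivity
    field_simp
  contDiff := contDiff_gaussianPDFReal_std
  integrable_M i _ j _ := by
    simp only [M_integrand_gaussianPDFReal_std]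
    exact (integrable_pow_mul_exp (by linarith) _).const_mul _
  dominated := by
    -- For `|c| ≤ 1/2` and `τ ≥ 1/2` one has `z² ≤ 4(2s² + 2c²) ≤ 8s² + 2`, and powers of the
    -- density are at most one. So a polynomial of degree four dominates.
    set h : ℝ → ℝ := fun s => (1 + 2 * (8 * s ^ 2 + 2))
      + (1 + (8 * s ^ 2 + 2)) * (1 + a * (8 * s ^ 2 + 2)) with hh
    refine ⟨1 / 2, by norm_num, h, ?_, fun s c τ hc hτ => ?_⟩
    · have h0 := (integrable_pow_mul_gaussianPDFReal_std 0).const_mul (5 + 3 * (1 + 2 * a))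
      have h2 := (integrable_pow_mul_gaussianPDFReal_std 2).const_mul
        (16 + 8 * (1 + 2 * a) + 24 * a)
      have h4 := (integrable_pow_mul_gaussianPDFReal_std 4).const_mul (64 * a)
      refine ((h0.add h2).add h4).congr (Eventually.of_forall fun s => ?_)
      simp only [hh, Pi.add_apply]
      ring
    · set z := (s - c) / τ with hz
      have hτ1 : 1 / 2 ≤ τ := by linarith [(abs_le.1 hτ).1]
      have hz2 : z ^ 2 ≤ 8 * s ^ 2 + 2 := by
        rw [hz, div_pow, div_le_iff₀ (by positivity)]
        have hc2 : c ^ 2 ≤ 1 / 4 := by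
          have := sq_le_sq' (abs_le.1 hc).1 (abs_le.1 hc).2
          linarith
        have hτ2 : 1 / 4 ≤ τ ^ 2 := by nlinarith
        nlinarith [sq_nonneg (s + c), sq_nonneg s]
      set g := gaussianPDFReal 0 1 z ^ a with hg
      have hg0 : 0 ≤ g := Real.rpow_nonneg (gaussianPDFReal_std_pos z).le _
      have hg1 : g ≤ 1 :=
        Real.rpow_le_one (gaussianPDFReal_std_pos z).le (gaussianPDFReal_std_le_one z) ha
      rw [wscore_gaussianPDFReal_std, deriv_wscore_gaussianPDFReal_std, ← hg, abs_mul, abs_mul,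
        abs_neg, abs_of_nonneg hg0]
      have hz0 := abs_nonneg z
      have hzz : |z| ^ 2 = z ^ 2 := sq_abs z
      have hd : |a * z ^ 2 - 1| ≤ 1 + a * z ^ 2 := by
        have := mul_nonneg ha (sq_nonneg z)
        rw [abs_le]
        constructor <;> linarith
      have b1 : (1 + |z|) * (|z| * g) ≤ 1 + 2 * (8 * s ^ 2 + 2) := by
        calc (1 + |z|) * (|z| * g) ≤ (1 + |z|) * (|z| * 1) := by gcongr
          _ ≤ 1 + 2 * z ^ 2 := by nlinarith [sq_nonneg (|z| - 1)]
          _ ≤ _ := by linarith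
      have b2 : (1 + z ^ 2) * (|a * z ^ 2 - 1| * g)
          ≤ (1 + (8 * s ^ 2 + 2)) * (1 + a * (8 * s ^ 2 + 2)) := by
        calc (1 + z ^ 2) * (|a * z ^ 2 - 1| * g) ≤ (1 + z ^ 2) * ((1 + a * z ^ 2) * 1) := by gcongr
          _ ≤ _ := by
            rw [mul_one]
            gcongr
      exact add_le_add b1 b2

end StandardNormal

end

end MDPDE

/-! ### Assembly of the theorem -/

open MDPDE in
theorem corollary1 :
    (∀ {Ω : Type*} [MeasurableSpace Ω] (P : Measure Ω) [IsProbabilityMeasure P] (m : ℕ)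
        (f : ℝ → ℝ) (α σ : ℝ) (β : EuclideanSpace ℝ (Fin (m + 1)))
        (Sx : Matrix (Fin (m + 1)) (Fin (m + 1)) ℝ) (y η : ℕ → Ω → ℝ) (w : ℕ → Ω → Fin m → ℝ),
      0 ≤ α → 0 < σ → IsErrorDensity f α → IsModel P f σ β Sx y η w →
      (∀ a > 0, M f 0 1 a = 0 ∧ M f 1 2 a = 0) →
      -- there are estimators, i.e. measurable functions of the data, that are consistent roots
      (∃ est : (T : ℕ) → (Fin T → ℝ × (Fin m → ℝ)) → EuclideanSpace ℝ (Fin (m + 1)) × ℝ,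
        (∀ T, Measurable (est T)) ∧
        IsConsistentRootSeq P f α σ β y w (fun T ω => (est T (sample y w T ω)).1)
          (fun T ω => (est T (sample y w T ω)).2)) ∧
      -- the limit laws below are not degenerate by convention
      Sx.PosDef ∧ 0 ≤ vBeta f α ∧ 0 ≤ vSigma f α ∧
      -- every sequence of consistent roots has the stated asymptotic behaviour
      (∀ (b : ℕ → Ω → EuclideanSpace ℝ (Fin (m + 1))) (s2 : ℕ → Ω → ℝ),
        IsConsistentRootSeq P f α σ β y w b s2 →
        -- the joint limit is a product law (asymptotic independence)
        TendstoInDistribution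
          (fun (T : ℕ) ω => (√(T : ℝ) • (b T ω - β), √(T : ℝ) * (s2 T ω - σ ^ 2))) atTop id
          (fun _ => P)
          ((multivariateGaussian 0 ((σ ^ 2 * vBeta f α) • Sx⁻¹)).prod
            (gaussianReal 0 (σ ^ 4 * vSigma f α).toNNReal)) ∧
        TendstoInDistribution (fun (T : ℕ) ω => √(T : ℝ) • (b T ω - β)) atTop id (fun _ => P)
          (multivariateGaussian 0 ((σ ^ 2 * vBeta f α) • Sx⁻¹)) ∧
        TendstoInDistribution (fun (T : ℕ) ω => √(T : ℝ) * (s2 T ω - σ ^ 2)) atTop id (fun _ => P)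
          (gaussianReal 0 (σ ^ 4 * vSigma f α).toNNReal))) ∧
    -- standard normal errors
    (∀ a > 0, M (gaussianPDFReal 0 1) 0 1 a = 0 ∧ M (gaussianPDFReal 0 1) 1 2 a = 0) ∧
    (∀ α : ℝ, 0 ≤ α →
      IsErrorDensity (gaussianPDFReal 0 1) α ∧
      vBeta (gaussianPDFReal 0 1) α = (1 + α ^ 2 / (1 + 2 * α)) ^ (3 / 2 : ℝ) ∧
      vSigma (gaussianPDFReal 0 1) α = 4 / (α ^ 2 + 2) ^ 2 *
        (2 * (1 + 2 * α ^ 2) * (1 + α ^ 2 / (1 + 2 * α)) ^ (5 / 2 : ℝ)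
          - α ^ 2 * (1 + α) ^ 2)) := by
  refine ⟨?_, fun a ha => M_gaussianPDFReal_std_odd (by linarith), fun α hα =>
    ⟨isErrorDensity_gaussianPDFReal_std hα, vBeta_gaussianPDFReal_std hα,
      vSigma_gaussianPDFReal_std hα⟩⟩
  intro Ω _ P _ m f α σ β Sx y η w hα hσ hf hM hMzero
  have hE := hf.isEstimatingPair hα hMzero
  have hD := hM.isDesign hf.contDiff.continuous hσ
  have ha := hE.pos_loc
  have hd := hE.pos_scale
  refine ⟨hM.exists_consistentRootSeq hσ hD hE, hM.posDef, hf.vBeta_nonneg hα hMzero,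
    hf.vSigma_nonneg hα hMzero, fun b s2 h => ?_⟩
  have hjoint := hM.tendstoInDistribution_root hf.contDiff.continuous.measurable hσ hD hE h
  have e1 : (-(σ / zeta11 f α)) ^ 2 * (zeta11 f (2 * α) - phi1 f α ^ 2) = σ ^ 2 * vBeta f α := by
    rw [vBeta]
    field_simp
  -- The doubled scale score has sensitivity `4 ζ₂₂` and variance `4(ζ₂₂ - φ₂²)`, with `ζ₂₂` at
  -- `2α`; the factors `2²`, `4` and `4²` cancel.
  have e2 : (-(2 * σ ^ 2 / (4 * zeta22 f α))) ^ 2 * (4 * (zeta22 f (2 * α) - phi2 f α ^ 2))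
      = σ ^ 4 * vSigma f α := by
    have hz : zeta22 f α ≠ 0 := by linarith
    rw [vSigma]
    field_simp
    norm_num
  rw [e1, e2] at hjoint
  -- The marginal limits follow by continuous mapping under the two projections.
  refine ⟨hjoint, ?_, ?_⟩
  · have h1 := hjoint.continuous_comp (g := Prod.fst) continuous_fst
    refine tendstoInDistribution_id_of_map_eq h1 ?_
    rw [Function.comp_id, Measure.map_fst_prod, measure_univ, one_smul]
  · have h1 := hjoint.continuous_comp (g := Prod.snd) continuous_snd
    refine tendstoInDistribution_id_of_map_eq h1 ?_
    rw [Function.comp_id, Measure.map_snd_prod, measure_univ, one_smul]
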